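/- **Setting.** Let $a<b$, $\mu_l=\frac{2\pi l}{b-a}$, $\delta_l=\sqrt{1+\mu_l^2}$ $(l\in\mathbb Z)$. For a $(b-a)$-periodic function $w$ with Fourier coefficients $\widehat w_l=\frac1{b-a}\int_a^b w(x)e^{-i\mu_l(x-a)}\,dx$ put $\|w\|_s^2=\sum_{l\in\mathbb Z}(1+\mu_l^2)^s|\widehat w_l|^2$, let $H^s$ be the corresponding periodic Sobolev space, and let $\|w\|=\|w\|_0$. Let $p\ge1$ be an integer, $0<\varepsilon\le1$, $T>0$, $T_\varepsilon=T/\varepsilon^{2p}$, and consider the complex nonlinear Klein–Gordon equation with periodic boundary conditions $$\partial_{tt}u-\partial_{xx}u+u+\varepsilon^{2p}|u|^{2p}u=0,\qquad u(\cdot,0)=u_0,\quad \partial_tu(\cdot,0)=u_1,\qquad x\in(a,b).$$ A solution on $[0,T_\varepsilon]$ is a function $u$, $(b-a)$-periodic in $x$, such that $u$ and $\partial_tu$ are continuous in $(x,t)$ and the equation holds in the weak sense in $x$, i.e. for every smooth $(b-a)$-periodic $\varphi$ and all $t\in[0,T_\varepsilon]$, $\frac{d}{dt}\int_a^b\partial_tu\,\varphi\,dx=\int_a^b(u\varphi''-u\varphi-\varepsilon^{2p}|u|^{2p}u\varphi)\,dx$.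 **Method (TSFP).** With $v=\partial_tu$ and $\eta_\pm=u\mp i\langle\nabla\rangle^{-1}v$, $\langle\nabla\rangle=\sqrt{1-\partial_{xx}}$, the equation becomes the coupled relativistic nonlinear Schrödinger equations $i\partial_t\eta_\pm\pm\langle\nabla\rangle\eta_\pm\pm\varepsilon^{2p}\langle\nabla\rangle^{-1}f\big(\tfrac12\eta_++\tfrac12\eta_-\big)=0$ with $f(z)=|z|^{2p}z$. Let $N$ be an even positive integer, $h=(b-a)/N$, $x_j=a+jh$ $(0\le j\le N)$, $\mathcal T_N=\{-\frac N2,\dots,\frac N2-1\}$, let $\tau>0$, $t_n=n\tau$, and for a grid vector $U$ let $\widetilde U_l=\frac1N\sum_{j=0}^{N-1}U_je^{-i\mu_l(x_j-a)}$ and $I_NU(x)=\sum_{l\in\mathcal T_N}\widetilde U_l\,e^{i\mu_l(x-a)}$. Starting from $\eta^0_{\pm,j}=u_0(x_j)\mp i\sum_{l\in\mathcal T_N}\delta_l^{-1}\widetilde{(u_1)}_le^{i\mu_l(x_j-a)}$, where $\widetilde{(u_1)}_l$ is formed from the grid values $u_1(x_j)$, set for $n\ge0$ $$\eta^{(1)}_{\pm,j}=\sum_{l\in\mathcal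 T_N}e^{\pm i\tau\delta_l/2}\,\widetilde{(\eta^n_\pm)}_l\,e^{i\mu_l(x_j-a)},\qquad \eta^{(2)}_{\pm,j}=\eta^{(1)}_{\pm,j}\pm\varepsilon^{2p}\tau\, i\sum_{l\in\mathcal T_N}\frac1{\delta_l}\widetilde{\Big(f\big(\tfrac12(\eta^{(1)}_++\eta^{(1)}_-)\big)\Big)}_l\,e^{i\mu_l(x_j-a)},$$ $$\eta^{n+1}_{\pm,j}=\sum_{l\in\mathcal T_N}e^{\pm i\tau\delta_l/2}\,\widetilde{(\eta^{(2)}_\pm)}_l\,e^{i\mu_l(x_j-a)},$$ $$u^{n+1}_j=\tfrac12(\eta^{n+1}_{+,j}+\eta^{n+1}_{-,j}),\qquad v^{n+1}_j=\frac i2\sum_{l\in\mathcal T_N}\delta_l\Big(\widetilde{(\eta_+^{n+1})}_l-\widetilde{(\eta_-^{n+1})}_l\Big)e^{i\mu_l(x_j-a)},$$ and $u^0_j=u_0(x_j)$, $v^0_j=u_1(x_j)$. **Theorem.** Let $a<b$ and $p\ge1$ be fixed. (i) There is $\alpha>0$, depending only on $a,b,p$, such that for every integer $m\ge1$, every $T>0$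 and every $M$ there exist $h_0>0$, $\tau_*\in(0,1)$ and $C>0$, depending only on $a,b,p,m,T,M$, with the following property. Let $0<\tau_0\le\tau_*$, $0<\varepsilon\le1$, and let $u$ be a solution on $[0,T/\varepsilon^{2p}]$ with $$\|u\|_{L^\infty([0,T/\varepsilon^{2p}];H^{m+1})}\le M,\qquad \|\partial_tu\|_{L^\infty([0,T/\varepsilon^{2p}];H^{m})}\le M .\tag{B}$$ If $h\le h_0$ and $0<\tau\le\alpha\tau_0$, then $$\|u(\cdot,t_n)-I_Nu^n\|_1+\|\partial_tu(\cdot,t_n)-I_Nv^n\|\le C\big(h^m+\varepsilon^{2p}\tau^2+\tau_0^{m+1}\big),\qquad 0\le n\le\frac{T/\varepsilon^{2p}}{\tau}.$$ (ii) For every integer $m\ge1$, every $T>0$, every sequence $(M_k)_{k\ge0}$ and every $\delta>0$ there exist $h_0>0$, $\tau_*>0$ and $C>0$, depending only on $a,b,p,m,T,(M_k),\delta$, such that for all $0<\varepsilon\le1$ and every solution $u$ on $[0,T/\varepsilon^{2p}]$ with $\|u\|_{L^\infty([0,T/\varepsilon^{2p}];H^k)}\le M_k$ and $\|\partial_tu\|_{L^\infty([0,T/\varepsilon^{2p}];H^k)}\le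 M_k$ for all $k$, the following holds: if $h\le h_0$ and $0<\tau\le\tau_*\varepsilon^{\delta}$, then $$\|u(\cdot,t_n)-I_Nu^n\|_1+\|\partial_tu(\cdot,t_n)-I_Nv^n\|\le C\big(h^m+\varepsilon^{2p}\tau^2\big),\qquad 0\le n\le\frac{T/\varepsilon^{2p}}{\tau}.$$ -/

import Mathlib

open MeasureTheory

namespace NKGE

noncomputable section

/-! ### Periodic functions on the interval `(a, b)` -/

/-- The wave number `μ_l = 2 π l / (b - a)`. -/
def waveNumber (a b : ℝ) (l : ℤ) : ℝ := 2 * Real.pi * l / (b - a)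

/-- The symbol `δ_l = √(1 + μ_l²)` of the operator `⟨∇⟩ = √(1 - Δ)`. -/
def symbol (a b : ℝ) (l : ℤ) : ℝ := Real.sqrt (1 + waveNumber a b l ^ 2)

/-- The Fourier mode `exp (i μ_l (x - a))`. -/
def mode (a b : ℝ) (l : ℤ) (x : ℝ) : ℂ :=
  Complex.exp (Complex.I * ((waveNumber a b l * (x - a) : ℝ) : ℂ))

/-- The Fourier coefficient `(b - a)⁻¹ ∫_a^b w(x) exp (-i μ_l (x - a)) dx`. -/
def fourierCoef (a b : ℝ) (w : ℝ → ℂ) (l : ℤ) : ℂ :=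
  ((1 / (b - a) : ℝ) : ℂ) *
    ∫ x in a..b, w x * Complex.exp (-(Complex.I * ((waveNumber a b l * (x - a) : ℝ) : ℂ)))

/-- The norm `(∑_l (1 + μ_l²)^s |ŵ_l|²)^(1/2)` of the periodic Sobolev space `H^s`, with values in
`[0, ∞]`; a (continuous) function lies in `H^s` iff the value is finite.
For `s = 0` this is the `L²` norm. -/
def sobolevNorm (a b : ℝ) (s : ℕ) (w : ℝ → ℂ) : ENNReal :=
  (∑' l : ℤ, ENNReal.ofReal ((1 + waveNumber a b l ^ 2) ^ s * ‖fourierCoef a b w l‖ ^ 2))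
    ^ (1 / 2 : ℝ)

/-- The norm of `L^∞([0, S]; H^s)` of a function `w t x` of time `t` and space `x`. -/
def linftySobolevNorm (a b S : ℝ) (s : ℕ) (w : ℝ → ℝ → ℂ) : ENNReal :=
  essSup (fun t => sobolevNorm a b s (w t)) (volume.restrict (Set.Icc 0 S))

/-! ### The complex nonlinear Klein-Gordon equation -/

/-- The power nonlinearity `f(z) = |z|^(2p) z`. -/
def powerNonlin (p : ℕ) (z : ℂ) : ℂ := ((‖z‖ ^ (2 * p) : ℝ) : ℂ) * z

/-- `u` is a solution on the time interval `[0, S]`, with time derivative `v = ∂_t u`, of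
`∂_tt u - ∂_xx u + u + ε^(2p) |u|^(2p) u = 0`, `u(0) = u₀`, `∂_t u(0) = u₁`,
under periodic boundary conditions on `(a, b)`. Functions on `(a, b)` with periodic boundary
conditions are represented by `(b - a)`-periodic functions on the real line.
Since `∂_xx u` need only be square integrable, the equation is tested in space against smooth
periodic functions. -/
structure IsSolution (a b : ℝ) (p : ℕ) (ε S : ℝ) (u₀ u₁ : ℝ → ℂ) (u v : ℝ → ℝ → ℂ) : Prop where
  continuousOn_u : ContinuousOn (fun q : ℝ × ℝ => u q.1 q.2) (Set.Icc 0 S ×ˢ Set.univ)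
  continuousOn_v : ContinuousOn (fun q : ℝ × ℝ => v q.1 q.2) (Set.Icc 0 S ×ˢ Set.univ)
  periodic : ∀ t ∈ Set.Icc 0 S, Function.Periodic (u t) (b - a)
  hasDeriv : ∀ t ∈ Set.Icc 0 S, ∀ x : ℝ,
    HasDerivWithinAt (fun s => u s x) (v t x) (Set.Icc 0 S) t
  equation : ∀ φ : ℝ → ℂ, ContDiff ℝ (⊤ : ℕ∞) φ → Function.Periodic φ (b - a) →
    ∀ t ∈ Set.Icc 0 S,
      HasDerivWithinAt (fun s => ∫ x in a..b, v s x * φ x)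
        (∫ x in a..b, (u t x * deriv (deriv φ) x - u t x * φ x
          - ((ε ^ (2 * p) : ℝ) : ℂ) * powerNonlin p (u t x) * φ x))
        (Set.Icc 0 S) t
  initial_u : u 0 = u₀
  initial_v : v 0 = u₁

/-! ### The time-splitting Fourier pseudospectral (TSFP) method -/

/-- The index set `{-N/2, …, N/2 - 1}` (for even `N`). -/
def freqs (N : ℕ) : Finset ℤ := Finset.Ico (-((N : ℤ) / 2)) ((N : ℤ) / 2)

/-- The grid points `x_j = a + j h`, `h = (b - a) / N`. -/
def gridPt (a b : ℝ) (N j : ℕ) : ℝ := a + j * ((b - a) / N)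

/-- The discrete Fourier coefficient `N⁻¹ ∑_{j=0}^{N-1} U_j exp (-i μ_l (x_j - a))` of a grid
vector `U = (U_0, …, U_N)`. -/
def discreteCoef (a b : ℝ) (N : ℕ) (U : Fin (N + 1) → ℂ) (l : ℤ) : ℂ :=
  (1 / (N : ℂ)) * ∑ j : Fin N, U j.castSucc *
    Complex.exp (-(Complex.I * ((waveNumber a b l * (gridPt a b N j - a) : ℝ) : ℂ)))

/-- The trigonometric polynomial `∑_l m(l) Ũ_l exp (i μ_l (x - a))`: the interpolant of the grid
vector `U` with the Fourier multiplier `m` applied to it. -/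
def multInterp (a b : ℝ) (N : ℕ) (mult : ℤ → ℂ) (U : Fin (N + 1) → ℂ) (x : ℝ) : ℂ :=
  ∑ l ∈ freqs N, mult l * discreteCoef a b N U l * mode a b l x

/-- The trigonometric interpolant `I_N U`. -/
def interp (a b : ℝ) (N : ℕ) (U : Fin (N + 1) → ℂ) (x : ℝ) : ℂ :=
  multInterp a b N (fun _ => 1) U x

/-- The restriction of a function to the grid. -/
def sample (a b : ℝ) (N : ℕ) (w : ℝ → ℂ) : Fin (N + 1) → ℂ := fun j => w (gridPt a b N j)

/-- The linear half step `exp (σ i (τ/2) ⟨∇⟩)` on the grid, with the sign `σ = ± 1`. -/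
def halfStep (a b : ℝ) (N : ℕ) (τ σ : ℝ) (U : Fin (N + 1) → ℂ) : Fin (N + 1) → ℂ :=
  sample a b N (multInterp a b N
    (fun l => Complex.exp (Complex.I * ((σ * (τ * symbol a b l / 2) : ℝ) : ℂ))) U)

/-- The nonlinear increment `i ⟨∇⟩⁻¹ f((U₊ + U₋)/2)` on the grid. -/
def nonlinInc (a b : ℝ) (p N : ℕ) (U : (Fin (N + 1) → ℂ) × (Fin (N + 1) → ℂ)) :
    Fin (N + 1) → ℂ :=
  fun j => Complex.I * sample a b N (multInterp a b N
    (fun l => ((1 / symbol a b l : ℝ) : ℂ))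
    (fun k => powerNonlin p ((U.1 k + U.2 k) / 2))) j

/-- One step `(η₊^n, η₋^n) ↦ (η₊^{n+1}, η₋^{n+1})` of the TSFP method: a linear half step, a full
nonlinear step, a linear half step. -/
def step (a b : ℝ) (p N : ℕ) (ε τ : ℝ) (U : (Fin (N + 1) → ℂ) × (Fin (N + 1) → ℂ)) :
    (Fin (N + 1) → ℂ) × (Fin (N + 1) → ℂ) :=
  let E : (Fin (N + 1) → ℂ) × (Fin (N + 1) → ℂ) :=
    (halfStep a b N τ 1 U.1, halfStep a b N τ (-1) U.2)
  let F := nonlinInc a b p N E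
  (halfStep a b N τ 1 (fun j => E.1 j + ((ε ^ (2 * p) * τ : ℝ) : ℂ) * F j),
    halfStep a b N τ (-1) (fun j => E.2 j - ((ε ^ (2 * p) * τ : ℝ) : ℂ) * F j))

/-- The initial grid vectors `η_±^0 = u₀ ∓ i ⟨∇⟩⁻¹ u₁`. -/
def initialEta (a b : ℝ) (N : ℕ) (u₀ u₁ : ℝ → ℂ) : (Fin (N + 1) → ℂ) × (Fin (N + 1) → ℂ) :=
  let w := sample a b N (multInterp a b N
    (fun l => ((1 / symbol a b l : ℝ) : ℂ)) (sample a b N u₁))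
  (fun j => sample a b N u₀ j - Complex.I * w j, fun j => sample a b N u₀ j + Complex.I * w j)

/-- The grid vectors `(η₊^n, η₋^n)`. -/
def eta (a b : ℝ) (p N : ℕ) (ε τ : ℝ) (u₀ u₁ : ℝ → ℂ) :
    ℕ → (Fin (N + 1) → ℂ) × (Fin (N + 1) → ℂ)
  | 0 => initialEta a b N u₀ u₁
  | n + 1 => step a b p N ε τ (eta a b p N ε τ u₀ u₁ n)

/-- The approximation `u^n` of `u(·, nτ)` on the grid. -/
def uNum (a b : ℝ) (p N : ℕ) (ε τ : ℝ) (u₀ u₁ : ℝ → ℂ) : ℕ → Fin (N + 1) → ℂ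
  | 0 => sample a b N u₀
  | n + 1 => fun j => ((eta a b p N ε τ u₀ u₁ (n + 1)).1 j +
      (eta a b p N ε τ u₀ u₁ (n + 1)).2 j) / 2

/-- The approximation `v^n` of `∂_t u(·, nτ)` on the grid. -/
def vNum (a b : ℝ) (p N : ℕ) (ε τ : ℝ) (u₀ u₁ : ℝ → ℂ) : ℕ → Fin (N + 1) → ℂ
  | 0 => sample a b N u₁
  | n + 1 => fun j => Complex.I / 2 * sample a b N (multInterp a b N
      (fun l => ((symbol a b l : ℝ) : ℂ))
      (fun k => (eta a b p N ε τ u₀ u₁ (n + 1)).1 k -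
        (eta a b p N ε τ u₀ u₁ (n + 1)).2 k)) j

/-- The error `‖u(·, t_n) - I_N u^n‖_{H¹} + ‖∂_t u(·, t_n) - I_N v^n‖_{L²}` at `t_n = nτ`, for a
function `u` with time derivative `v`. -/
def tsfpError (a b : ℝ) (p N : ℕ) (ε τ : ℝ) (u₀ u₁ : ℝ → ℂ) (u v : ℝ → ℝ → ℂ) (n : ℕ) :
    ENNReal :=
  sobolevNorm a b 1 (fun x => u (n * τ) x - interp a b N (uNum a b p N ε τ u₀ u₁ n) x) +
    sobolevNorm a b 0 (fun x => v (n * τ) x - interp a b N (vNum a b p N ε τ u₀ u₁ n) x)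

end

end NKGE

namespace NKGE
open scoped ComplexConjugate

/-! ### Wave numbers, symbols and modes -/

section Symbol

variable {a b : ℝ}

/-! Write e = ε^(2p) and pass to the twisted coefficients exp(∓i t δ_l) η̂_±. They move only through
the nonlinearity: their derivative is ± i e δ_l⁻¹ times the twisted coefficient of f(u)
(`RegularSolution.hasDerivWithinAt_twist`). In the same variables one splitting step is exactly the
midpoint rule for this derivative, with the coefficients frozen at t_n (`numTwist_succ`). The energy
norm carries the weight δ_l, which cancels δ_l⁻¹. About T/(eτ) steps are made, so local errors of
size e²τ³ add up to the desired eτ², whereas the usual midpoint error eτ³ would only give τ².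

Two mechanisms supply the missing factor e. First, freezing the coefficients changes u inside a step
only by eτ², because the contributions of η₊ and η₋ combine to sin(δ_l(s - r))/δ_l
(`RegularSolution.l2_sub_linCoef_le`). Second, f is a monomial in z and its conjugate, so at a
linear flow it is a finite sum of exponentials exp(iωs). For each of them the midpoint error is
exactly a difference of boundary values with a factor bounded by τ²|ω| (`cisPrim_sub_eq`,
`abs_midFactor_le`). Once the boundary term is added to the error (`modErr`), these differences
telescope. What remains is the change of the coefficients during the step, which is O(eτ), so the
local error is again e²τ³ (`l2_modErr_succ_le`). The factor |ω| costs one derivative, which is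
affordable since ∑ δ_l |η̂_l| converges for m ≥ 1.

The boundary formula needs sin(ωτ/2) ≠ 0, so it is applied only below a frequency cutoff of order
1/(h + τ). The same cutoff keeps all product frequencies on the grid, so no aliasing occurs there
(`exists_cutoff`). The discarded frequencies contribute (h + τ)^(m+1) per unit of the slow time e t
≤ T, which is the origin of the term τ₀^(m+1). Aliasing of the initial data and the projection error
give h^m.

A discrete Gronwall argument in slow time, run together with the a priori bound error ≤ 1 that
controls the numerical solution pointwise, gives `errNorm_le`. Part (i) then only uses τ ≤ τ₀. Part
(ii) applies the same bound with so many derivatives that the cutoff term falls below eτ². -/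

lemma waveNumber_add (k l : ℤ) :
    waveNumber a b (k + l) = waveNumber a b k + waveNumber a b l := by
  simp only [waveNumber]; push_cast; ring

lemma waveNumber_neg (l : ℤ) : waveNumber a b (-l) = -waveNumber a b l := by
  simp only [waveNumber]; push_cast; ring

lemma symbol_sq (l : ℤ) : symbol a b l ^ 2 = 1 + waveNumber a b l ^ 2 :=
  Real.sq_sqrt (by positivity)

lemma one_le_symbol (l : ℤ) : 1 ≤ symbol a b l := by
  rw [symbol, Real.one_le_sqrt]; nlinarith [sq_nonneg (waveNumber a b l)]

lemma symbol_pos (l : ℤ) : 0 < symbol a b l := lt_of_lt_of_le one_pos (one_le_symbol l)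

lemma symbol_ne (l : ℤ) : ((symbol a b l : ℝ) : ℂ) ≠ 0 := by
  exact_mod_cast (symbol_pos l).ne'

lemma abs_waveNumber_le_symbol (l : ℤ) : |waveNumber a b l| ≤ symbol a b l := by
  rw [symbol]; apply Real.abs_le_sqrt; linarith

lemma symbol_le (l : ℤ) : symbol a b l ≤ 1 + |waveNumber a b l| := by
  rw [symbol, Real.sqrt_le_left (by positivity)]
  nlinarith [sq_abs (waveNumber a b l), abs_nonneg (waveNumber a b l)]

lemma symbol_neg (l : ℤ) : symbol a b (-l) = symbol a b l := by
  simp [symbol, waveNumber_neg]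

lemma symbol_add_le (k l : ℤ) : symbol a b (k + l) ≤ symbol a b k + symbol a b l := by
  have hk := symbol_pos (a := a) (b := b) k
  have hl := symbol_pos (a := a) (b := b) l
  rw [symbol, Real.sqrt_le_left (by positivity), add_sq, symbol_sq, symbol_sq, waveNumber_add]
  have h1 : |waveNumber a b k| * |waveNumber a b l| ≤ symbol a b k * symbol a b l :=
    mul_le_mul (abs_waveNumber_le_symbol k) (abs_waveNumber_le_symbol l) (abs_nonneg _) hk.le
  rw [← abs_mul] at h1
  nlinarith [le_abs_self (waveNumber a b k * waveNumber a b l)]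

lemma symbol_sum_le {ι : Type*} (s : Finset ι) (hs : s.Nonempty) (k : ι → ℤ) :
    symbol a b (∑ i ∈ s, k i) ≤ ∑ i ∈ s, symbol a b (k i) := by
  induction hs using Finset.Nonempty.cons_induction with
  | singleton i => simp
  | cons i s hi hs ih =>
    rw [Finset.sum_cons, Finset.sum_cons]
    exact (symbol_add_le _ _).trans (by linarith)

lemma summable_inv_symbol_sq (hab : a < b) : Summable fun l : ℤ => (symbol a b l ^ 2)⁻¹ := by
  have hba : 0 < b - a := sub_pos.2 hab
  have h1 : Summable fun l : ℤ => ((l : ℝ) ^ 2)⁻¹ := by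
    simpa using (Real.summable_one_div_int_pow (p := 2)).2 one_lt_two
  -- The indicator covers `l = 0`, where the inverse square is `0` by convention while the symbol is
  -- `1`.
  have h2 : Summable fun l : ℤ => ((b - a) / (2 * Real.pi)) ^ 2 * ((l : ℝ) ^ 2)⁻¹ + if l = 0 then 1 else 0 :=
    (h1.mul_left _).add (summable_of_ne_finset_zero (s := {0}) (by intro l hl; simp at hl; simp [hl]))
  refine Summable.of_nonneg_of_le (fun l => by positivity) (fun l => ?_) h2
  rw [symbol_sq]
  by_cases hl : l = 0
  · simp [hl, waveNumber]
  · have hl' : (0 : ℝ) < (l : ℝ) ^ 2 := by positivity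
    have hpi := Real.pi_pos
    rw [if_neg hl, add_zero, ← div_eq_mul_inv, inv_eq_one_div, div_le_div_iff₀ (by positivity) hl',
      waveNumber]
    have : (2 * Real.pi * l / (b - a)) ^ 2 * ((b - a) / (2 * Real.pi)) ^ 2 = (l : ℝ) ^ 2 := by
      field_simp
    nlinarith [sq_nonneg ((b - a) / (2 * Real.pi))]

lemma mode_eq (l : ℤ) (x : ℝ) :
    mode a b l x = Complex.exp (((waveNumber a b l * (x - a) : ℝ) : ℂ) * Complex.I) := by
  rw [mode, mul_comm]

lemma norm_mode (l : ℤ) (x : ℝ) : ‖mode a b l x‖ = 1 := by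
  rw [mode_eq, Complex.norm_exp_ofReal_mul_I]

lemma mode_add (k l : ℤ) (x : ℝ) : mode a b (k + l) x = mode a b k x * mode a b l x := by
  rw [mode_eq, mode_eq, mode_eq, ← Complex.exp_add, waveNumber_add]; push_cast; ring_nf

@[simp] lemma mode_zero (x : ℝ) : mode a b 0 x = 1 := by simp [mode, waveNumber]

lemma conj_mode (l : ℤ) (x : ℝ) : conj (mode a b l x) = mode a b (-l) x := by
  rw [mode_eq, mode_eq, ← Complex.exp_conj, waveNumber_neg]
  simp

lemma mode_neg_eq (l : ℤ) (x : ℝ) :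
    Complex.exp (-(Complex.I * ((waveNumber a b l * (x - a) : ℝ) : ℂ))) = mode a b (-l) x := by
  rw [mode_eq, waveNumber_neg]; congr 1; push_cast; ring

lemma mode_sum {ι : Type*} (s : Finset ι) (k : ι → ℤ) (x : ℝ) :
    mode a b (∑ i ∈ s, k i) x = ∏ i ∈ s, mode a b (k i) x := by
  classical
  induction s using Finset.induction_on with
  | empty => simp
  | insert i s hi ih => rw [Finset.sum_insert hi, Finset.prod_insert hi, mode_add, ih]

lemma contDiff_mode (l : ℤ) {n : WithTop ℕ∞} : ContDiff ℝ n (mode a b l) := by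
  have h : ContDiff ℝ n fun x : ℝ => ((waveNumber a b l * (x - a) : ℝ) : ℂ) :=
    Complex.ofRealCLM.contDiff.comp (contDiff_const.mul (contDiff_id.sub contDiff_const))
  exact (contDiff_const.mul h).cexp

lemma continuous_mode (l : ℤ) : Continuous (mode a b l) := (contDiff_mode l (n := 0)).continuous

lemma periodic_mode (hab : a < b) (l : ℤ) : Function.Periodic (mode a b l) (b - a) := by
  intro x
  have hba : b - a ≠ 0 := (sub_pos.2 hab).ne'
  rw [mode_eq, mode_eq]
  have : ((waveNumber a b l * (x + (b - a) - a) : ℝ) : ℂ) * Complex.I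
      = ((waveNumber a b l * (x - a) : ℝ) : ℂ) * Complex.I + l * (2 * Real.pi * Complex.I) := by
    have : waveNumber a b l * (x + (b - a) - a) = waveNumber a b l * (x - a) + l * (2 * Real.pi) := by
      simp only [waveNumber]; field_simp; ring
    rw [this]; push_cast; ring
  rw [this, Complex.exp_add, Complex.exp_int_mul_two_pi_mul_I, mul_one]

lemma hasDerivAt_mode (l : ℤ) (x : ℝ) :
    HasDerivAt (mode a b l) (Complex.I * waveNumber a b l * mode a b l x) x := by
  have h1 : HasDerivAt (fun x : ℝ => waveNumber a b l * (x - a)) (waveNumber a b l) x := by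
    simpa using ((hasDerivAt_id x).sub_const a).const_mul (waveNumber a b l)
  have h2 := (h1.ofReal_comp.const_mul Complex.I).cexp
  exact h2.congr_deriv (by rw [mode]; ring)

lemma deriv_deriv_mode (l : ℤ) (x : ℝ) :
    deriv (deriv (mode a b l)) x = -((waveNumber a b l ^ 2 : ℝ) : ℂ) * mode a b l x := by
  have h : deriv (mode a b l) = fun x => Complex.I * waveNumber a b l * mode a b l x :=
    funext fun x => (hasDerivAt_mode l x).deriv
  rw [h, ((hasDerivAt_mode l x).const_mul _).deriv]
  push_cast
  linear_combination (waveNumber a b l : ℂ) ^ 2 * mode a b l x * Complex.I_sq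

end Symbol

/-! ### Fourier coefficients -/

section Fourier

variable {a b : ℝ}

lemma fourierCoef_eq (w : ℝ → ℂ) (l : ℤ) :
    fourierCoef a b w l = ((1 / (b - a) : ℝ) : ℂ) * ∫ x in a..b, w x * mode a b (-l) x := by
  simp only [fourierCoef, mode_neg_eq]

lemma fourierCoef_sub {w₁ w₂ : ℝ → ℂ} (h₁ : Continuous w₁) (h₂ : Continuous w₂) (l : ℤ) :
    fourierCoef a b (fun x => w₁ x - w₂ x) l = fourierCoef a b w₁ l - fourierCoef a b w₂ l := by
  simp only [fourierCoef_eq, ← mul_sub, sub_mul]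
  congr 1
  exact intervalIntegral.integral_sub ((h₁.mul (continuous_mode _)).intervalIntegrable _ _)
    ((h₂.mul (continuous_mode _)).intervalIntegrable _ _)

lemma fourierCoef_mode (hab : a < b) (k l : ℤ) :
    fourierCoef a b (mode a b k) l = if k = l then 1 else 0 := by
  have hba : b - a ≠ 0 := (sub_pos.2 hab).ne'
  rw [fourierCoef_eq]
  simp_rw [← mode_add]
  split_ifs with h
  · subst h
    have : ((b : ℂ) - a) ≠ 0 := by exact_mod_cast hba
    simp [this]
  · have hk : waveNumber a b (k + -l) ≠ 0 := by
      rw [waveNumber]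
      have : ((k + -l : ℤ) : ℝ) ≠ 0 := by
        exact_mod_cast (by omega : k + -l ≠ 0)
      have := Real.pi_ne_zero
      positivity
    have hk' : Complex.I * (waveNumber a b (k + -l) : ℂ) ≠ 0 :=
      mul_ne_zero Complex.I_ne_zero (by exact_mod_cast hk)
    have hd : ∀ x ∈ Set.uIcc a b, HasDerivAt
        (fun x => (Complex.I * waveNumber a b (k + -l))⁻¹ * mode a b (k + -l) x)
        (mode a b (k + -l) x) x := fun x _ =>
      ((hasDerivAt_mode (k + -l) x).const_mul _).congr_deriv (by
        rw [← mul_assoc, inv_mul_cancel₀ hk', one_mul])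
    rw [intervalIntegral.integral_eq_sub_of_hasDerivAt hd
      ((continuous_mode _).intervalIntegrable _ _)]
    have hp := periodic_mode hab (k + -l) a
    rw [add_sub_cancel] at hp
    rw [hp, sub_self, mul_zero]

lemma fourierCoef_finset_sum {ι : Type*} (s : Finset ι) (c : ι → ℂ) (w : ι → ℝ → ℂ)
    (hw : ∀ i ∈ s, Continuous (w i)) (l : ℤ) :
    fourierCoef a b (fun x => ∑ i ∈ s, c i * w i x) l = ∑ i ∈ s, c i * fourierCoef a b (w i) l := by
  simp only [fourierCoef_eq, Finset.sum_mul]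
  rw [intervalIntegral.integral_finsetSum, Finset.mul_sum]
  · refine Finset.sum_congr rfl fun i _ => ?_
    simp_rw [mul_assoc (c i)]
    rw [intervalIntegral.integral_const_mul]; ring
  · intro i hi
    exact ((continuous_const.mul (hw i hi)).mul (continuous_mode _)).intervalIntegrable _ _

lemma fourierCoef_sum_mode (hab : a < b) {ι : Type*} (s : Finset ι) (c : ι → ℂ) (k : ι → ℤ) (l : ℤ) :
    fourierCoef a b (fun x => ∑ i ∈ s, c i * mode a b (k i) x) l
      = ∑ i ∈ s, if k i = l then c i else 0 := by
  rw [fourierCoef_finset_sum s c _ fun i _ => continuous_mode _]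
  simp only [fourierCoef_mode hab, mul_ite, mul_one, mul_zero]

lemma fourierCoef_trigPoly (hab : a < b) (s : Finset ℤ) (c : ℤ → ℂ) (l : ℤ) :
    fourierCoef a b (fun x => ∑ k ∈ s, c k * mode a b k x) l = if l ∈ s then c l else 0 := by
  rw [fourierCoef_sum_mode hab s c fun k => k]
  simp

/-- The characters of the circle are based at `0`, the modes at `a`. The discrepancy is a unimodular
phase, invisible in norms and cancelling in Fourier series. -/
lemma fourier_coe_eq (hab : a < b) (l : ℤ) (x : ℝ) :
    (fourier l (x : AddCircle (b - a)) : ℂ)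
      = Complex.exp (((waveNumber a b l * a : ℝ) : ℂ) * Complex.I) * mode a b l x := by
  rw [fourier_coe_apply, mode_eq, ← Complex.exp_add]
  congr 1
  simp only [waveNumber]
  have : ((b : ℂ) - a) ≠ 0 := by exact_mod_cast (sub_pos.2 hab).ne'
  push_cast
  field_simp
  ring

lemma fourierCoeffOn_eq_mul (hab : a < b) (w : ℝ → ℂ) (l : ℤ) :
    fourierCoeffOn hab w l
      = Complex.exp (((waveNumber a b (-l) * a : ℝ) : ℂ) * Complex.I) * fourierCoef a b w l := by
  rw [fourierCoeffOn_eq_integral, fourierCoef_eq]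
  simp_rw [fourier_coe_eq hab, smul_eq_mul]
  rw [Complex.real_smul, mul_left_comm]
  simp only [mul_assoc, mul_comm (w _), intervalIntegral.integral_const_mul]

lemma hasSum_norm_sq_fourierCoef (hab : a < b) {w : ℝ → ℂ} (hw : Continuous w) :
    HasSum (fun l => ‖fourierCoef a b w l‖ ^ 2) ((b - a)⁻¹ * ∫ x in a..b, ‖w x‖ ^ 2) := by
  have h2 : MemLp w 2 (volume.restrict (Set.Ioc a b)) := by
    rw [memLp_two_iff_integrable_sq_norm hw.aestronglyMeasurable]
    exact ((hw.norm.pow 2).intervalIntegrable a b).1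
  have h := hasSum_sq_fourierCoeffOn hab h2
  simpa only [fourierCoeffOn_eq_mul, norm_mul, Complex.norm_exp_ofReal_mul_I, one_mul,
    smul_eq_mul] using h

/-- A pointwise Lipschitz bound carries over to the `ℓ²` norms of Fourier coefficients. -/
lemma sum_sq_fourierCoef_le (hab : a < b) {g₁ g₂ w₁ w₂ : ℝ → ℂ} (hg₁ : Continuous g₁)
    (hg₂ : Continuous g₂) (hw₁ : Continuous w₁) (hw₂ : Continuous w₂) {K D : ℝ}
    (hg : ∀ x, ‖g₁ x - g₂ x‖ ≤ K * ‖w₁ x - w₂ x‖)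
    (hw : ∀ F : Finset ℤ, ∑ l ∈ F, ‖fourierCoef a b w₁ l - fourierCoef a b w₂ l‖ ^ 2 ≤ D ^ 2)
    (F : Finset ℤ) :
    ∑ l ∈ F, ‖fourierCoef a b g₁ l - fourierCoef a b g₂ l‖ ^ 2 ≤ (K * D) ^ 2 := by
  have h1 := hasSum_norm_sq_fourierCoef hab (hg₁.sub hg₂)
  have h2 := hasSum_norm_sq_fourierCoef hab (hw₁.sub hw₂)
  simp only [Pi.sub_def, fourierCoef_sub hg₁ hg₂] at h1
  simp only [Pi.sub_def, fourierCoef_sub hw₁ hw₂] at h2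
  -- By Parseval the hypothesis on all finite partial sums becomes a bound of the integral, where
  -- the pointwise estimate can act.
  have h3 : (b - a)⁻¹ * ∫ x in a..b, ‖w₁ x - w₂ x‖ ^ 2 ≤ D ^ 2 :=
    h2.tsum_eq ▸ Real.tsum_le_of_sum_le (fun _ => sq_nonneg _) hw
  refine (sum_le_hasSum F (fun _ _ => sq_nonneg _) h1).trans ?_
  have hba : 0 < b - a := sub_pos.2 hab
  have h4 : ∫ x in a..b, ‖g₁ x - g₂ x‖ ^ 2 ≤ ∫ x in a..b, K ^ 2 * ‖w₁ x - w₂ x‖ ^ 2 := by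
    refine intervalIntegral.integral_mono_on hab.le
      ((hg₁.sub hg₂).norm.pow 2 |>.intervalIntegrable _ _)
      (((hw₁.sub hw₂).norm.pow 2).const_mul _ |>.intervalIntegrable _ _) fun x _ => ?_
    rw [← mul_pow]
    exact pow_le_pow_left₀ (norm_nonneg _) (hg x) 2
  rw [intervalIntegral.integral_const_mul] at h4
  calc _ ≤ (b - a)⁻¹ * (K ^ 2 * ∫ x in a..b, ‖w₁ x - w₂ x‖ ^ 2) := by gcongr
    _ = K ^ 2 * ((b - a)⁻¹ * ∫ x in a..b, ‖w₁ x - w₂ x‖ ^ 2) := by ring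
    _ ≤ K ^ 2 * D ^ 2 := by gcongr
    _ = _ := by ring

/-- A continuous function on the circle with absolutely summable coefficients is the pointwise sum
of its Fourier series. The phase in the coefficient is the inverse of the phase in the character. -/
lemma hasSum_fourierCoef_mul_mode (hab : a < b) {w : ℝ → ℂ} (hw : Continuous w)
    (hp : Function.Periodic w (b - a)) (hs : Summable fun l => ‖fourierCoef a b w l‖) (x : ℝ) :
    HasSum (fun l => fourierCoef a b w l * mode a b l x) (w x) := by
  have : Fact (0 < b - a) := ⟨sub_pos.2 hab⟩
  let f : C(AddCircle (b - a), ℂ) := ⟨hp.lift, continuous_coinduced_dom.mpr hw⟩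
  have hc : ∀ l, fourierCoeff f l
      = Complex.exp (((waveNumber a b (-l) * a : ℝ) : ℂ) * Complex.I) * fourierCoef a b w l := by
    intro l
    rw [← fourierCoeffOn_eq_mul hab, fourierCoeffOn_eq_integral, fourierCoeff_eq_intervalIntegral f l a,
      add_sub_cancel]
    rfl
  have hsum : Summable (fourierCoeff f) := by
    apply Summable.of_norm
    simpa only [hc, norm_mul, Complex.norm_exp_ofReal_mul_I, one_mul] using hs
  have h := has_pointwise_sum_fourier_series_of_summable hsum (x : AddCircle (b - a))
  have hf : f (x : AddCircle (b - a)) = w x := rfl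
  rw [hf] at h
  convert h using 2 with l
  rw [hc, fourier_coe_eq hab, smul_eq_mul, waveNumber_neg]
  have : Complex.exp (((-waveNumber a b l * a : ℝ) : ℂ) * Complex.I)
      * Complex.exp (((waveNumber a b l * a : ℝ) : ℂ) * Complex.I) = 1 := by
    rw [← Complex.exp_add, ← Complex.exp_zero]; congr 1; push_cast; ring
  linear_combination (-(fourierCoef a b w l * mode a b l x)) * this

end Fourier

/-! ### Norms of finite families of coefficients -/

section L2

/-- The `ℓ²` norm of a family of coefficients over a finite set of frequencies. -/
noncomputable def l2 (F : Finset ℤ) (c : ℤ → ℂ) : ℝ := Real.sqrt (∑ l ∈ F, ‖c l‖ ^ 2)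

lemma l2_nonneg (F : Finset ℤ) (c : ℤ → ℂ) : 0 ≤ l2 F c := Real.sqrt_nonneg _

lemma l2_sq (F : Finset ℤ) (c : ℤ → ℂ) : l2 F c ^ 2 = ∑ l ∈ F, ‖c l‖ ^ 2 :=
  Real.sq_sqrt (Finset.sum_nonneg fun _ _ => sq_nonneg _)

lemma l2_le_iff {F : Finset ℤ} {c : ℤ → ℂ} {D : ℝ} (hD : 0 ≤ D) :
    l2 F c ≤ D ↔ ∑ l ∈ F, ‖c l‖ ^ 2 ≤ D ^ 2 := by
  rw [l2, Real.sqrt_le_left hD]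

lemma l2_eq_norm (F : Finset ℤ) (c : ℤ → ℂ) :
    l2 F c = ‖(WithLp.toLp 2 fun l : F => c l : EuclideanSpace ℂ F)‖ := by
  rw [EuclideanSpace.norm_eq, l2, ← Finset.sum_coe_sort F]

lemma l2_add_le (F : Finset ℤ) (c d : ℤ → ℂ) : l2 F (fun l => c l + d l) ≤ l2 F c + l2 F d := by
  simp only [l2_eq_norm]
  exact norm_add_le (WithLp.toLp 2 fun l : F => c l : EuclideanSpace ℂ F)
    (WithLp.toLp 2 fun l : F => d l)

lemma l2_mono {F : Finset ℤ} {c d : ℤ → ℂ} (h : ∀ l ∈ F, ‖c l‖ ≤ ‖d l‖) : l2 F c ≤ l2 F d :=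
  Real.sqrt_le_sqrt (Finset.sum_le_sum fun l hl => pow_le_pow_left₀ (norm_nonneg _) (h l hl) 2)

lemma l2_subset {F G : Finset ℤ} (h : F ⊆ G) (c : ℤ → ℂ) : l2 F c ≤ l2 G c :=
  Real.sqrt_le_sqrt (Finset.sum_le_sum_of_subset_of_nonneg h fun _ _ _ => sq_nonneg _)

lemma l2_congr {F : Finset ℤ} {c d : ℤ → ℂ} (h : ∀ l ∈ F, ‖c l‖ = ‖d l‖) : l2 F c = l2 F d :=
  le_antisymm (l2_mono fun l hl => (h l hl).le) (l2_mono fun l hl => (h l hl).ge)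

lemma l2_smul (F : Finset ℤ) (z : ℂ) (c : ℤ → ℂ) : l2 F (fun l => z * c l) = ‖z‖ * l2 F c := by
  simp only [l2, norm_mul, mul_pow, ← Finset.mul_sum]
  rw [Real.sqrt_mul (sq_nonneg _), Real.sqrt_sq (norm_nonneg _)]

lemma l2_neg (F : Finset ℤ) (c : ℤ → ℂ) : l2 F (fun l => -c l) = l2 F c :=
  l2_congr fun _ _ => norm_neg _

lemma l2_sub_le (F : Finset ℤ) (c d : ℤ → ℂ) : l2 F (fun l => c l - d l) ≤ l2 F c + l2 F d := by
  simpa only [sub_eq_add_neg, l2_neg] using l2_add_le F c fun l => -d l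

lemma l2_le_sum (F : Finset ℤ) (c : ℤ → ℂ) : l2 F c ≤ ∑ l ∈ F, ‖c l‖ := by
  rw [l2_le_iff (Finset.sum_nonneg fun _ _ => norm_nonneg _)]
  exact Finset.sum_sq_le_sq_sum_of_nonneg fun _ _ => norm_nonneg _

/-- Mean value inequality for families of coefficients in the `ℓ²` norm. -/
lemma l2_sub_le_of_deriv {F : Finset ℤ} {y y' : ℝ → ℤ → ℂ} {t₀ t₁ C : ℝ} (ht : t₀ ≤ t₁)
    (hy : ∀ l ∈ F, ∀ s ∈ Set.Icc t₀ t₁, HasDerivWithinAt (fun r => y r l) (y' s l) (Set.Icc t₀ t₁) s)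
    (hC : ∀ s ∈ Set.Icc t₀ t₁, l2 F (y' s) ≤ C) :
    l2 F (fun l => y t₁ l - y t₀ l) ≤ C * (t₁ - t₀) := by
  set D := l2 F (fun l => y t₁ l - y t₀ l) with hD
  -- Pairing with the conjugate of the total increment reduces to one scalar function. Its increment
  -- is `D ^ 2` and its derivative is at most `D * C` by Cauchy–Schwarz.
  have h1 : ∀ s ∈ Set.Icc t₀ t₁, HasDerivWithinAt
      (fun r => ∑ l ∈ F, conj (y t₁ l - y t₀ l) * y r l)
      (∑ l ∈ F, conj (y t₁ l - y t₀ l) * y' s l) (Set.Icc t₀ t₁) s := fun s hs =>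
    HasDerivWithinAt.fun_sum fun l hl => (hy l hl s hs).const_mul _
  have h2 : ∀ s ∈ Set.Icc t₀ t₁, ‖∑ l ∈ F, conj (y t₁ l - y t₀ l) * y' s l‖ ≤ D * C := by
    intro s hs
    calc _ ≤ ∑ l ∈ F, ‖y t₁ l - y t₀ l‖ * ‖y' s l‖ := by
          refine (norm_sum_le _ _).trans_eq (Finset.sum_congr rfl fun l _ => ?_)
          rw [norm_mul, RCLike.norm_conj]
      _ ≤ D * l2 F (y' s) := Real.sum_mul_le_sqrt_mul_sqrt F _ _
      _ ≤ D * C := mul_le_mul_of_nonneg_left (hC s hs) (l2_nonneg _ _)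
  have h3 := (convex_Icc t₀ t₁).norm_image_sub_le_of_norm_hasDerivWithin_le h1 h2
    (Set.left_mem_Icc.2 ht) (Set.right_mem_Icc.2 ht)
  have h4 : ‖∑ l ∈ F, conj (y t₁ l - y t₀ l) * y t₁ l - ∑ l ∈ F, conj (y t₁ l - y t₀ l) * y t₀ l‖
      = D ^ 2 := by
    rw [← Finset.sum_sub_distrib, hD, l2_sq]
    have : ∀ l ∈ F, conj (y t₁ l - y t₀ l) * y t₁ l - conj (y t₁ l - y t₀ l) * y t₀ l
        = ((‖y t₁ l - y t₀ l‖ ^ 2 : ℝ) : ℂ) := by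
      intro l _
      rw [← mul_sub, Complex.conj_mul']; push_cast; rfl
    rw [Finset.sum_congr rfl this, ← Complex.ofReal_sum, Complex.norm_real, Real.norm_of_nonneg]
    exact Finset.sum_nonneg fun _ _ => sq_nonneg _
  rw [h4, Real.norm_of_nonneg (sub_nonneg.2 ht)] at h3
  have hC0 : 0 ≤ C := (l2_nonneg _ _).trans (hC t₀ (Set.left_mem_Icc.2 ht))
  rcases (l2_nonneg F (fun l => y t₁ l - y t₀ l)).eq_or_lt with h0 | h0
  · rw [hD, ← h0]; exact mul_nonneg hC0 (sub_nonneg.2 ht)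
  · rw [← hD] at h0
    have : D * D ≤ D * (C * (t₁ - t₀)) := by nlinarith
    exact le_of_mul_le_mul_left this h0

/-- Mean value inequality for families of coefficients in the `ℓ¹` norm. -/
lemma sum_norm_sub_le_of_deriv {ι : Type*} {F : Finset ι} {y y' : ℝ → ι → ℂ} {t₀ t₁ C : ℝ} (ht : t₀ ≤ t₁)
    (hy : ∀ l ∈ F, ∀ s ∈ Set.Icc t₀ t₁, HasDerivWithinAt (fun r => y r l) (y' s l) (Set.Icc t₀ t₁) s)
    (hC : ∀ s ∈ Set.Icc t₀ t₁, ∑ l ∈ F, ‖y' s l‖ ≤ C) :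
    ∑ l ∈ F, ‖y t₁ l - y t₀ l‖ ≤ C * (t₁ - t₀) := by
  -- The phase `θ` realises the duality of ℓ¹ and ℓ^∞: pairing the increments with their phases sums
  -- their absolute values.
  have hθ : ∀ z : ℂ, ∃ θ : ℂ, ‖θ‖ ≤ 1 ∧ θ * z = (‖z‖ : ℂ) := by
    intro z
    rcases eq_or_ne z 0 with rfl | hz
    · exact ⟨0, by simp⟩
    · refine ⟨conj z / ‖z‖, ?_, ?_⟩
      · rw [norm_div, RCLike.norm_conj, Complex.norm_real, norm_norm, div_self (norm_ne_zero_iff.2 hz)]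
      · have : (‖z‖ : ℂ) ≠ 0 := by exact_mod_cast norm_ne_zero_iff.2 hz
        rw [div_mul_eq_mul_div, Complex.conj_mul', sq, mul_div_assoc, div_self this, mul_one]
  choose θ hθ1 hθ2 using hθ
  have h1 : ∀ s ∈ Set.Icc t₀ t₁, HasDerivWithinAt
      (fun r => ∑ l ∈ F, θ (y t₁ l - y t₀ l) * y r l)
      (∑ l ∈ F, θ (y t₁ l - y t₀ l) * y' s l) (Set.Icc t₀ t₁) s := fun s hs =>
    HasDerivWithinAt.fun_sum fun l hl => (hy l hl s hs).const_mul _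
  have h2 : ∀ s ∈ Set.Icc t₀ t₁, ‖∑ l ∈ F, θ (y t₁ l - y t₀ l) * y' s l‖ ≤ C := by
    intro s hs
    refine (norm_sum_le _ _).trans ((Finset.sum_le_sum fun l _ => ?_).trans (hC s hs))
    rw [norm_mul]
    exact mul_le_of_le_one_left (norm_nonneg _) (hθ1 _)
  have h3 := (convex_Icc t₀ t₁).norm_image_sub_le_of_norm_hasDerivWithin_le h1 h2
    (Set.left_mem_Icc.2 ht) (Set.right_mem_Icc.2 ht)
  rw [Real.norm_of_nonneg (sub_nonneg.2 ht)] at h3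
  convert h3 using 1
  rw [← Finset.sum_sub_distrib]
  simp only [← mul_sub, hθ2]
  rw [← Complex.ofReal_sum, Complex.norm_real, Real.norm_of_nonneg]
  exact Finset.sum_nonneg fun _ _ => norm_nonneg _

/-- The constant `(∑_l δ_l^{-2})^{1/2}` of the embedding of `H¹` into absolutely convergent series. -/
noncomputable def embConst (a b : ℝ) : ℝ := Real.sqrt (∑' l : ℤ, (symbol a b l ^ 2)⁻¹)

lemma embConst_nonneg (a b : ℝ) : 0 ≤ embConst a b := Real.sqrt_nonneg _

/-- Cauchy–Schwarz for the product of δ_l⁻¹ and δ_l |c_l|. -/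
lemma sum_norm_le_embConst_mul {a b : ℝ} (hab : a < b) (F : Finset ℤ) (c : ℤ → ℂ) :
    ∑ l ∈ F, ‖c l‖ ≤ embConst a b * l2 F fun l => symbol a b l * c l := by
  have h1 : ∑ l ∈ F, ‖c l‖ = ∑ l ∈ F, (symbol a b l)⁻¹ * ‖(symbol a b l : ℂ) * c l‖ := by
    refine Finset.sum_congr rfl fun l _ => ?_
    rw [norm_mul, Complex.norm_real, Real.norm_of_nonneg (symbol_pos l).le, ← mul_assoc,
      inv_mul_cancel₀ (symbol_pos l).ne', one_mul]
  rw [h1]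
  refine (Real.sum_mul_le_sqrt_mul_sqrt F _ _).trans (mul_le_mul_of_nonneg_right ?_ (l2_nonneg _ _))
  refine Real.sqrt_le_sqrt ?_
  simp only [inv_pow]
  exact (summable_inv_symbol_sq hab).sum_le_tsum F fun l _ => by positivity

end L2

/-! ### Discrete Fourier coefficients -/

section Discrete

variable {a b : ℝ}

lemma mem_freqs {N : ℕ} {l : ℤ} : l ∈ freqs N ↔ -((N : ℤ) / 2) ≤ l ∧ l < (N : ℤ) / 2 := by
  simp [freqs]

/-- At most `N` consecutive integers are pairwise incongruent modulo `N`. This is what makes the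
grid resolve the frequencies in `freqs N`. -/
lemma eq_of_mem_freqs {N : ℕ} {k l : ℤ} (hk : k ∈ freqs N) (hl : l ∈ freqs N)
    (h : (N : ℤ) ∣ k - l) : k = l := by
  rw [mem_freqs] at hk hl
  by_contra hne
  have := Int.le_of_dvd (a := N) (b := |k - l|) (abs_pos.2 (sub_ne_zero.2 hne)) ((dvd_abs _ _).2 h)
  rcases abs_cases (k - l) with h' | h' <;> omega

lemma mode_gridPt (hab : a < b) {N : ℕ} (hN : 0 < N) (l : ℤ) (j : ℕ) :
    mode a b l (gridPt a b N j) = Complex.exp (2 * Real.pi * Complex.I * (l / N)) ^ j := by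
  rw [← Complex.exp_nat_mul, mode_eq]
  congr 1
  have : ((b : ℂ) - a) ≠ 0 := by exact_mod_cast (sub_pos.2 hab).ne'
  have hN' : (N : ℂ) ≠ 0 := by exact_mod_cast hN.ne'
  simp only [waveNumber, gridPt]
  push_cast
  field_simp
  ring

/-- On the grid a mode runs through the powers of an `N`-th root of unity, so the mean is a
geometric sum, which vanishes unless the root is `1`. -/
lemma sum_mode_gridPt (hab : a < b) {N : ℕ} (hN : 0 < N) (l : ℤ) :
    (1 / (N : ℂ)) * ∑ j : Fin N, mode a b l (gridPt a b N j) = if (N : ℤ) ∣ l then 1 else 0 := by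
  have hN' : (N : ℂ) ≠ 0 := by exact_mod_cast hN.ne'
  simp only [mode_gridPt hab hN]
  rw [Fin.sum_univ_eq_sum_range (fun j => Complex.exp (2 * Real.pi * Complex.I * (l / N)) ^ j) N]
  set z := Complex.exp (2 * Real.pi * Complex.I * (l / N)) with hz
  have hzN : z ^ N = 1 := by
    rw [hz, ← Complex.exp_nat_mul, Complex.exp_eq_one_iff]
    exact ⟨l, by field_simp⟩
  split_ifs with h
  · obtain ⟨q, rfl⟩ := h
    have : z = 1 := by
      rw [hz, Complex.exp_eq_one_iff]
      exact ⟨q, by push_cast; field_simp⟩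
    simp [this, hN']
  · have hz1 : z ≠ 1 := by
      rw [hz, Ne, Complex.exp_eq_one_iff]
      rintro ⟨q, hq⟩
      apply h
      have hpi : (2 * Real.pi * Complex.I : ℂ) ≠ 0 := Complex.two_pi_I_ne_zero
      rw [mul_comm (q : ℂ)] at hq
      have hq' := mul_left_cancel₀ hpi hq
      rw [div_eq_iff hN'] at hq'
      exact ⟨q, by rw [mul_comm]; exact_mod_cast hq'⟩
    rw [geom_sum_eq hz1, hzN, sub_self, zero_div, mul_zero]

lemma discreteCoef_eq (N : ℕ) (U : Fin (N + 1) → ℂ) (l : ℤ) :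
    discreteCoef a b N U l
      = (1 / (N : ℂ)) * ∑ j : Fin N, U j.castSucc * mode a b (-l) (gridPt a b N j) := by
  simp only [discreteCoef, mode_neg_eq]

lemma discreteCoef_add (N : ℕ) (U V : Fin (N + 1) → ℂ) (l : ℤ) :
    discreteCoef a b N (fun j => U j + V j) l = discreteCoef a b N U l + discreteCoef a b N V l := by
  simp only [discreteCoef_eq, add_mul, Finset.sum_add_distrib, mul_add]

lemma discreteCoef_smul (N : ℕ) (z : ℂ) (U : Fin (N + 1) → ℂ) (l : ℤ) :
    discreteCoef a b N (fun j => z * U j) l = z * discreteCoef a b N U l := by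
  simp only [discreteCoef_eq, mul_assoc, ← Finset.mul_sum]
  ring

lemma discreteCoef_sub (N : ℕ) (U V : Fin (N + 1) → ℂ) (l : ℤ) :
    discreteCoef a b N (fun j => U j - V j) l = discreteCoef a b N U l - discreteCoef a b N V l := by
  simp only [discreteCoef_eq, sub_mul, Finset.sum_sub_distrib, mul_sub]

lemma discreteCoef_sum {ι : Type*} (N : ℕ) (s : Finset ι) (U : ι → Fin (N + 1) → ℂ) (l : ℤ) :
    discreteCoef a b N (fun j => ∑ i ∈ s, U i j) l = ∑ i ∈ s, discreteCoef a b N (U i) l := by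
  simp only [discreteCoef_eq, Finset.sum_mul]
  rw [Finset.sum_comm, Finset.mul_sum]

lemma discreteCoef_mode (hab : a < b) {N : ℕ} (hN : 0 < N) (k l : ℤ) :
    discreteCoef a b N (sample a b N (mode a b k)) l = if (N : ℤ) ∣ k - l then 1 else 0 := by
  rw [discreteCoef_eq, ← sum_mode_gridPt hab hN, sub_eq_add_neg]
  simp only [sample, mode_add, Fin.val_castSucc]

/-- No aliasing: frequencies in `freqs N` that agree on the grid are equal, so the discrete
coefficients agree with the Fourier coefficients. -/
lemma discreteCoef_sum_mode (hab : a < b) {N : ℕ} (hN : 0 < N) {ι : Type*} (s : Finset ι)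
    (c : ι → ℂ) (k : ι → ℤ) (hk : ∀ i ∈ s, k i ∈ freqs N) {l : ℤ} (hl : l ∈ freqs N) :
    discreteCoef a b N (sample a b N fun x => ∑ i ∈ s, c i * mode a b (k i) x) l
      = ∑ i ∈ s, if k i = l then c i else 0 := by
  have h : discreteCoef a b N (sample a b N fun x => ∑ i ∈ s, c i * mode a b (k i) x) l
      = ∑ i ∈ s, c i * discreteCoef a b N (sample a b N (mode a b (k i))) l := by
    simp only [← discreteCoef_smul]
    exact discreteCoef_sum N s (fun i j => c i * sample a b N (mode a b (k i)) j) l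
  rw [h]
  refine Finset.sum_congr rfl fun i hi => ?_
  rw [discreteCoef_mode hab hN]
  by_cases hkl : k i = l
  · simp [hkl]
  · rw [if_neg fun h => hkl (eq_of_mem_freqs (hk i hi) hl h), if_neg hkl, mul_zero]

lemma discreteCoef_trigPoly (hab : a < b) {N : ℕ} (hN : 0 < N) {s : Finset ℤ} (hs : s ⊆ freqs N)
    (c : ℤ → ℂ) {l : ℤ} (hl : l ∈ freqs N) :
    discreteCoef a b N (sample a b N fun x => ∑ k ∈ s, c k * mode a b k x) l
      = if l ∈ s then c l else 0 := by
  rw [discreteCoef_sum_mode hab hN s c (fun k => k) hs hl]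
  simp

lemma discreteCoef_multInterp (hab : a < b) {N : ℕ} (hN : 0 < N) (mult : ℤ → ℂ)
    (U : Fin (N + 1) → ℂ) {l : ℤ} (hl : l ∈ freqs N) :
    discreteCoef a b N (sample a b N (multInterp a b N mult U)) l
      = mult l * discreteCoef a b N U l := by
  rw [show multInterp a b N mult U
    = fun x => ∑ k ∈ freqs N, (mult k * discreteCoef a b N U k) * mode a b k x from rfl,
    discreteCoef_trigPoly hab hN subset_rfl _ hl, if_pos hl]

/-- The discrete inner product with a trigonometric polynomial. It serves both Parseval (with the
same polynomial in both slots) and Bessel (with the interpolant). -/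
lemma sum_mul_conj_trigPoly (N : ℕ) (U : Fin (N + 1) → ℂ) (c : ℤ → ℂ) (s : Finset ℤ) :
    (1 / (N : ℂ)) * ∑ j : Fin N, U j.castSucc * conj (∑ k ∈ s, c k * mode a b k (gridPt a b N j))
      = ∑ k ∈ s, conj (c k) * discreteCoef a b N U k := by
  simp only [discreteCoef_eq, map_sum, map_mul, conj_mode, Finset.mul_sum]
  rw [Finset.sum_comm]
  refine Finset.sum_congr rfl fun k _ => Finset.sum_congr rfl fun j _ => ?_
  ring

/-- Discrete Parseval identity for trigonometric polynomials. -/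
lemma sum_norm_sq_trigPoly (hab : a < b) {N : ℕ} (hN : 0 < N) (c : ℤ → ℂ) :
    1 / (N : ℝ) * ∑ j : Fin N, ‖∑ k ∈ freqs N, c k * mode a b k (gridPt a b N j)‖ ^ 2
      = ∑ k ∈ freqs N, ‖c k‖ ^ 2 := by
  have h := sum_mul_conj_trigPoly (a := a) (b := b) N
    (sample a b N fun x => ∑ k ∈ freqs N, c k * mode a b k x) c (freqs N)
  have h' : ∑ k ∈ freqs N, conj (c k) * discreteCoef a b N
      (sample a b N fun x => ∑ k ∈ freqs N, c k * mode a b k x) k = ∑ k ∈ freqs N, (‖c k‖ : ℂ) ^ 2 :=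
    Finset.sum_congr rfl fun k hk => by
      rw [discreteCoef_trigPoly hab hN subset_rfl c hk, if_pos hk, Complex.conj_mul']
  rw [h'] at h
  simp only [sample, Fin.val_castSucc, Complex.mul_conj'] at h
  apply Complex.ofReal_injective
  push_cast
  exact h

/-- Discrete Bessel inequality. -/
lemma sum_norm_sq_discreteCoef_le (hab : a < b) {N : ℕ} (hN : 0 < N) (U : Fin (N + 1) → ℂ) :
    ∑ l ∈ freqs N, ‖discreteCoef a b N U l‖ ^ 2 ≤ 1 / (N : ℝ) * ∑ j : Fin N, ‖U j.castSucc‖ ^ 2 := by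
  set c := discreteCoef a b N U with hc
  have h1 := sum_norm_sq_trigPoly hab hN c
  have h2 := sum_mul_conj_trigPoly (a := a) (b := b) N U c (freqs N)
  rw [← hc] at h2
  have h2' := congrArg Complex.re h2
  simp only [Complex.conj_mul'] at h2'
  have e1 : (1 / (N : ℂ)) = ((1 / (N : ℝ) : ℝ) : ℂ) := by push_cast; rfl
  have e2 : (∑ k ∈ freqs N, (‖c k‖ : ℂ) ^ 2) = ((∑ k ∈ freqs N, ‖c k‖ ^ 2 : ℝ) : ℂ) := by push_cast; rfl
  rw [e1, e2, Complex.re_ofReal_mul, Complex.ofReal_re, Complex.re_sum] at h2'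
  set P : Fin N → ℂ := fun j => ∑ k ∈ freqs N, c k * mode a b k (gridPt a b N j) with hP
  -- The mean square of `U - P`, with `P` the interpolant of `U`, is nonnegative; when it is
  -- expanded, the cross term is minus twice the mean square of `P`.
  have h3 : 0 ≤ 1 / (N : ℝ) * ∑ j : Fin N, ‖U j.castSucc - P j‖ ^ 2 := by positivity
  have h4 : ∀ j : Fin N, ‖U j.castSucc - P j‖ ^ 2
      = ‖U j.castSucc‖ ^ 2 + ‖P j‖ ^ 2 - 2 * (U j.castSucc * conj (P j)).re := by
    intro j
    rw [← Complex.normSq_eq_norm_sq, ← Complex.normSq_eq_norm_sq, ← Complex.normSq_eq_norm_sq,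
      Complex.normSq_sub]
  simp only [h4, Finset.sum_sub_distrib, Finset.sum_add_distrib, ← Finset.mul_sum] at h3
  nlinarith

/-- A pointwise Lipschitz bound on the grid carries over to discrete Fourier coefficients. -/
lemma l2_discreteCoef_sub_le (hab : a < b) {N : ℕ} (hN : 0 < N) (U V : Fin (N + 1) → ℂ)
    (c d : ℤ → ℂ) {K : ℝ} (hK : 0 ≤ K)
    (h : ∀ j : Fin N, ‖U j.castSucc - V j.castSucc‖
      ≤ K * ‖∑ k ∈ freqs N, c k * mode a b k (gridPt a b N j)
          - ∑ k ∈ freqs N, d k * mode a b k (gridPt a b N j)‖) :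
    l2 (freqs N) (fun l => discreteCoef a b N U l - discreteCoef a b N V l)
      ≤ K * l2 (freqs N) fun l => c l - d l := by
  have e : (fun l => discreteCoef a b N U l - discreteCoef a b N V l)
      = discreteCoef a b N fun j => U j - V j := funext fun l => (discreteCoef_sub N U V l).symm
  rw [e, l2_le_iff (mul_nonneg hK (l2_nonneg _ _)), mul_pow, l2_sq,
    ← sum_norm_sq_trigPoly hab hN fun l => c l - d l]
  refine (sum_norm_sq_discreteCoef_le hab hN _).trans ?_
  rw [mul_left_comm]
  gcongr
  rw [Finset.mul_sum]
  refine Finset.sum_le_sum fun j _ => ?_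
  simp only [sub_mul, Finset.sum_sub_distrib]
  rw [← mul_pow]
  exact pow_le_pow_left₀ (norm_nonneg _) (h j) 2

end Discrete

/-! ### Aliasing -/

section Aliasing

variable {a b : ℝ}

/-- Aliasing formula. -/
lemma hasSum_discreteCoef (hab : a < b) {N : ℕ} (hN : 0 < N) {w : ℝ → ℂ} {c : ℤ → ℂ}
    (hw : ∀ x, HasSum (fun k => c k * mode a b k x) (w x)) (l : ℤ) :
    HasSum (fun k => if (N : ℤ) ∣ k - l then c k else 0)
      (discreteCoef a b N (sample a b N w) l) := by
  have h := (hasSum_sum (s := Finset.univ) fun (j : Fin N) _ =>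
    ((hw (gridPt a b N j)).mul_right (mode a b (-l) (gridPt a b N j)))).mul_left (1 / (N : ℂ))
  rw [discreteCoef_eq]
  simp only [sample, Fin.val_castSucc]
  have e : (fun k => if (N : ℤ) ∣ k - l then c k else 0) = fun k => (1 / (N : ℂ)) *
      ∑ j : Fin N, c k * mode a b k (gridPt a b N j) * mode a b (-l) (gridPt a b N j) := by
    funext k
    simp only [mul_assoc, ← Finset.mul_sum, ← mode_add]
    rw [mul_left_comm, sum_mode_gridPt hab hN, ← sub_eq_add_neg]
    simp
  rw [e]
  exact h

lemma summable_int_inv_sq : Summable fun q : ℤ => ((q : ℝ) ^ 2)⁻¹ := by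
  simpa using (Real.summable_one_div_int_pow (p := 2)).2 one_lt_two

/-- Since |l| ≤ N/2, the alias `l + q * N` has modulus at least |q|N/2. The factor 2π in the wave
number absorbs the loss of 1/2. -/
lemma le_symbol_of_alias (hab : a < b) {N : ℕ} (hN : 0 < N) (hE : Even N) {l : ℤ} (hl : l ∈ freqs N)
    (q : ℤ) (hq : q ≠ 0) :
    (|q| : ℝ) * ((b - a) / N)⁻¹ ≤ symbol a b (l + q * N) := by
  have hba : 0 < b - a := sub_pos.2 hab
  have hN' : (0 : ℝ) < N := by exact_mod_cast hN
  refine le_trans ?_ (abs_waveNumber_le_symbol _)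
  obtain ⟨r, hr⟩ := hE
  have hl2 : |l| * 2 ≤ N := by
    rw [mem_freqs] at hl
    rcases abs_cases l with h | h <;> omega
  have hq1 : 1 ≤ |q| := Int.one_le_abs hq
  have h1 : |q| * N ≤ 2 * |l + q * N| := by
    have h2 : |q * N| ≤ |l + q * N| + |l| := by
      have := abs_sub (l + q * N) l
      simpa using this
    rw [abs_mul, Nat.abs_cast] at h2
    nlinarith
  have h3 : (|q| : ℝ) * N ≤ 2 * |(l + q * N : ℝ)| := by exact_mod_cast h1
  rw [waveNumber, abs_div, abs_of_pos hba, abs_mul, abs_of_pos (by positivity : 0 < 2 * Real.pi),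
    inv_div, ← mul_div_assoc]
  refine div_le_div_of_nonneg_right ?_ hba.le
  push_cast
  have := Real.pi_gt_three
  nlinarith [abs_nonneg (l + q * N : ℝ)]

/-- The aliases of `l` are numbered injectively by `q = (k - l) / N`, and each is of size at least
|q|/h. Hence the sum is dominated by h^(2s) ∑ q⁻², where s ≥ 1 is used for |q|^(2s) ≥ q². -/
lemma sum_inv_symbol_alias_le (hab : a < b) {N : ℕ} (hN : 0 < N) (hE : Even N) {l : ℤ}
    (hl : l ∈ freqs N) {s : ℕ} (hs : 1 ≤ s) (F : Finset ℤ) :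
    ∑ k ∈ F with (N : ℤ) ∣ k - l ∧ k ≠ l, (symbol a b k ^ (2 * s))⁻¹
      ≤ ((b - a) / N) ^ (2 * s) * ∑' q : ℤ, ((q : ℝ) ^ 2)⁻¹ := by
  have hba : 0 < b - a := sub_pos.2 hab
  have hN' : (0 : ℝ) < N := by exact_mod_cast hN
  have hNz : (N : ℤ) ≠ 0 := by exact_mod_cast hN.ne'
  set G := F.filter fun k => (N : ℤ) ∣ k - l ∧ k ≠ l with hG
  have hinj : Set.InjOn (fun k : ℤ => (k - l) / N) G := by
    intro k hk k' hk' h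
    simp only [hG, Finset.coe_filter, Set.mem_ofPred_eq] at hk hk'
    have := (Int.ediv_left_inj hk.2.1 hk'.2.1).1 h
    linarith
  calc _ ≤ ∑ k ∈ G, ((b - a) / N) ^ (2 * s) * ((((k - l) / (N : ℤ) : ℤ) : ℝ) ^ 2)⁻¹ := by
        refine Finset.sum_le_sum fun k hk => ?_
        simp only [hG, Finset.mem_filter] at hk
        obtain ⟨_, ⟨q, hq⟩, hne⟩ := hk
        have hk' : k = l + q * N := by linarith
        have hq0 : q ≠ 0 := by rintro rfl; apply hne; simp [hk']
        have h1 := le_symbol_of_alias hab hN hE hl q hq0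
        rw [← hk'] at h1
        rw [hq, Int.mul_ediv_cancel_left _ hNz]
        have hq1 : (1 : ℝ) ≤ |(q : ℝ)| := by exact_mod_cast Int.one_le_abs hq0
        have hq2 : (q : ℝ) ^ 2 ≤ |(q : ℝ)| ^ (2 * s) := by
          rw [← sq_abs]; exact pow_le_pow_right₀ hq1 (by omega)
        have h2 : (q : ℝ) ^ 2 * (((b - a) / N)⁻¹) ^ (2 * s) ≤ symbol a b k ^ (2 * s) :=
          calc _ ≤ |(q : ℝ)| ^ (2 * s) * (((b - a) / N)⁻¹) ^ (2 * s) := by gcongr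
            _ = (|(q : ℝ)| * ((b - a) / N)⁻¹) ^ (2 * s) := by rw [mul_pow]
            _ ≤ _ := by gcongr
        have hq3 : (0 : ℝ) < (q : ℝ) ^ 2 := by positivity
        calc _ ≤ ((q : ℝ) ^ 2 * (((b - a) / N)⁻¹) ^ (2 * s))⁻¹ := by gcongr
          _ = _ := by rw [mul_inv, inv_pow, inv_inv, mul_comm]
    _ = ((b - a) / N) ^ (2 * s) * ∑ q ∈ G.image fun k => (k - l) / (N : ℤ), ((q : ℝ) ^ 2)⁻¹ := by
        rw [Finset.sum_image hinj, Finset.mul_sum]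
    _ ≤ _ := by
        gcongr
        exact summable_int_inv_sq.sum_le_tsum _ fun q _ => by positivity

/-- The difference at `l` is the sum over the nontrivial aliases of `l`. Cauchy–Schwarz on each
residue class splits off the factor h^s, and distinct `l` have disjoint residue classes, so the
weighted sums add up to the Sobolev norm. -/
lemma l2_discreteCoef_sub_fourier_le (hab : a < b) {N : ℕ} (hN : 0 < N) (hE : Even N)
    {w : ℝ → ℂ} {c : ℤ → ℂ} (hw : ∀ x, HasSum (fun k => c k * mode a b k x) (w x))
    {s : ℕ} (hs : 1 ≤ s) {M : ℝ} (hM : 0 ≤ M)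
    (hc : ∀ F : Finset ℤ, ∑ k ∈ F, symbol a b k ^ (2 * s) * ‖c k‖ ^ 2 ≤ M ^ 2) :
    l2 (freqs N) (fun l => discreteCoef a b N (sample a b N w) l - c l)
      ≤ Real.sqrt (∑' q : ℤ, ((q : ℝ) ^ 2)⁻¹) * ((b - a) / N) ^ s * M := by
  have hba : 0 < b - a := sub_pos.2 hab
  have hA : (0 : ℝ) ≤ ∑' q : ℤ, ((q : ℝ) ^ 2)⁻¹ := tsum_nonneg fun q => by positivity
  rw [l2_le_iff (by positivity)]
  -- The aliasing series is truncated to a finite set `F` containing `freqs N`, and the estimate,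
  -- uniform in `F`, passes to the limit.
  have hlim : Filter.Tendsto (fun F : Finset ℤ => ∑ l ∈ freqs N,
      ‖∑ k ∈ F, (if (N : ℤ) ∣ k - l then c k else 0) - c l‖ ^ 2) Filter.atTop
      (nhds (∑ l ∈ freqs N, ‖discreteCoef a b N (sample a b N w) l - c l‖ ^ 2)) :=
    tendsto_finsetSum _ fun l _ => (((hasSum_discreteCoef hab hN hw l).sub_const _).norm).pow 2
  refine le_of_tendsto hlim ?_
  filter_upwards [Filter.eventually_ge_atTop (freqs N)] with F hF
  have hl : ∀ l ∈ freqs N, ‖∑ k ∈ F, (if (N : ℤ) ∣ k - l then c k else 0) - c l‖ ^ 2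
      ≤ (((b - a) / N) ^ (2 * s) * ∑' q : ℤ, ((q : ℝ) ^ 2)⁻¹) *
        ∑ k ∈ F with (N : ℤ) ∣ k - l, symbol a b k ^ (2 * s) * ‖c k‖ ^ 2 := by
    intro l hl
    have e1 : ∑ k ∈ F, (if (N : ℤ) ∣ k - l then c k else 0) - c l
        = ∑ k ∈ F with (N : ℤ) ∣ k - l ∧ k ≠ l, c k := by
      rw [← Finset.sum_filter, ← Finset.filter_filter, Finset.filter_ne', sub_eq_iff_eq_add,
        Finset.sum_erase_add]
      simp [hF hl]
    rw [e1]
    have e2 : ‖∑ k ∈ F with (N : ℤ) ∣ k - l ∧ k ≠ l, c k‖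
        ≤ ∑ k ∈ F with (N : ℤ) ∣ k - l ∧ k ≠ l, (symbol a b k ^ s)⁻¹ * (symbol a b k ^ s * ‖c k‖) := by
      refine (norm_sum_le _ _).trans_eq (Finset.sum_congr rfl fun k _ => ?_)
      rw [← mul_assoc, inv_mul_cancel₀ (pow_pos (symbol_pos k) s).ne', one_mul]
    have e3 := Finset.sum_mul_sq_le_sq_mul_sq (F.filter fun k => (N : ℤ) ∣ k - l ∧ k ≠ l)
      (fun k => (symbol a b k ^ s)⁻¹) fun k => symbol a b k ^ s * ‖c k‖
    simp only [inv_pow, mul_pow, ← pow_mul, mul_comm s 2] at e3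
    refine (pow_le_pow_left₀ (norm_nonneg _) e2 2).trans (e3.trans ?_)
    refine mul_le_mul (sum_inv_symbol_alias_le hab hN hE hl hs F) ?_
      (Finset.sum_nonneg fun k _ => mul_nonneg (pow_nonneg (symbol_pos k).le _) (sq_nonneg _))
      (by positivity)
    refine Finset.sum_le_sum_of_subset_of_nonneg ?_ fun k _ _ =>
      mul_nonneg (pow_nonneg (symbol_pos k).le _) (sq_nonneg _)
    intro k hk
    simp only [Finset.mem_filter] at hk ⊢
    exact ⟨hk.1, hk.2.1⟩
  refine (Finset.sum_le_sum hl).trans ?_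
  rw [← Finset.mul_sum, mul_pow, mul_pow, Real.sq_sqrt hA, ← pow_mul, mul_comm s 2,
    mul_comm (∑' q : ℤ, ((q : ℝ) ^ 2)⁻¹)]
  gcongr
  refine le_trans ?_ (hc F)
  rw [← Finset.sum_biUnion]
  · refine Finset.sum_le_sum_of_subset_of_nonneg ?_ fun k _ _ =>
      mul_nonneg (pow_nonneg (symbol_pos k).le _) (sq_nonneg _)
    intro k hk
    simp only [Finset.mem_biUnion, Finset.mem_filter] at hk
    obtain ⟨_, _, hk, _⟩ := hk
    exact hk
  · intro l hl l' hl' hne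
    rw [Function.onFun, Finset.disjoint_left]
    intro k hk hk'
    simp only [Finset.mem_filter] at hk hk'
    apply hne
    refine eq_of_mem_freqs hl hl' ?_
    have := dvd_sub hk'.2 hk.2
    simpa using this

end Aliasing

/-! ### The power nonlinearity -/

section Nonlin

lemma powerNonlin_eq (p : ℕ) (z : ℂ) : powerNonlin p z = z ^ (p + 1) * conj z ^ p := by
  rw [powerNonlin, pow_mul, Complex.ofReal_pow, Complex.ofReal_pow, ← Complex.mul_conj', mul_pow,
    pow_succ]
  ring

@[simp] lemma powerNonlin_zero (p : ℕ) : powerNonlin p 0 = 0 := by simp [powerNonlin]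

lemma continuous_powerNonlin (p : ℕ) : Continuous (powerNonlin p) := by
  unfold powerNonlin
  fun_prop

lemma norm_powerNonlin_sub_le (p : ℕ) {R : ℝ} {z w : ℂ} (hz : ‖z‖ ≤ R) (hw : ‖w‖ ≤ R) :
    ‖powerNonlin p z - powerNonlin p w‖ ≤ (2 * p + 1) * R ^ (2 * p) * ‖z - w‖ := by
  have hR : 0 ≤ R := (norm_nonneg z).trans hz
  have e : powerNonlin p z - powerNonlin p w
      = ((‖z‖ ^ (2 * p) : ℝ) : ℂ) * (z - w)
        + ((‖z‖ ^ (2 * p) - ‖w‖ ^ (2 * p) : ℝ) : ℂ) * w := by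
    simp only [powerNonlin]; push_cast; ring
  have h1 : |‖z‖ ^ (2 * p) - ‖w‖ ^ (2 * p)| ≤ ‖z - w‖ * (2 * p : ℕ) * R ^ (2 * p - 1) := by
    refine (abs_pow_sub_pow_le _ _ _).trans ?_
    rw [abs_of_nonneg (norm_nonneg z), abs_of_nonneg (norm_nonneg w)]
    gcongr
    · exact abs_norm_sub_norm_le z w
    · exact max_le hz hw
  -- For `p = 0` the exponent `2 * p - 1` truncates, but the factor `2 * p` makes both sides zero.
  have h2 : (2 * p : ℕ) * R ^ (2 * p - 1) * R = (2 * p : ℕ) * R ^ (2 * p) := by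
    rcases Nat.eq_zero_or_pos p with rfl | hp
    · simp
    · rw [mul_assoc, ← pow_succ, Nat.sub_add_cancel (by omega)]
  rw [e]
  refine (norm_add_le _ _).trans ?_
  rw [norm_mul, norm_mul, Complex.norm_real, Complex.norm_real, Real.norm_of_nonneg (by positivity),
    Real.norm_eq_abs]
  calc _ ≤ R ^ (2 * p) * ‖z - w‖ + ‖z - w‖ * (2 * p : ℕ) * R ^ (2 * p - 1) * R := by gcongr
    _ = R ^ (2 * p) * ‖z - w‖ + ‖z - w‖ * ((2 * p : ℕ) * R ^ (2 * p - 1) * R) := by ring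
    _ = _ := by rw [h2]; push_cast; ring

end Nonlin

/-! ### Products of sums -/

section Prod

variable {ι : Type*}

/-- Expanding ∏ (B + (A - B)) and dropping the leading term bounds the difference. This form is
chosen because a difference of products factorises again when summed over multi-indices. -/
lemma norm_prod_sub_prod_le (s : Finset ι) (A B : ι → ℂ) :
    ‖∏ i ∈ s, A i - ∏ i ∈ s, B i‖ ≤ ∏ i ∈ s, (‖B i‖ + ‖A i - B i‖) - ∏ i ∈ s, ‖B i‖ := by
  classical
  induction s using Finset.induction_on with
  | empty => simp
  | insert i s hi ih =>
    simp only [Finset.prod_insert hi]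
    have h1 : ‖∏ i ∈ s, A i‖ ≤ ∏ i ∈ s, (‖B i‖ + ‖A i - B i‖) := by
      rw [norm_prod]
      exact Finset.prod_le_prod (fun _ _ => norm_nonneg _) fun i _ => norm_le_norm_add_norm_sub' _ _
    have e : A i * ∏ i ∈ s, A i - B i * ∏ i ∈ s, B i
        = (A i - B i) * ∏ i ∈ s, A i + B i * (∏ i ∈ s, A i - ∏ i ∈ s, B i) := by ring
    rw [e]
    refine (norm_add_le _ _).trans ?_
    rw [norm_mul, norm_mul]
    have h2 := mul_le_mul_of_nonneg_left h1 (norm_nonneg (A i - B i))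
    have h3 := mul_le_mul_of_nonneg_left ih (norm_nonneg (B i))
    linarith

lemma prod_add_sub_prod_le (s : Finset ι) {x d : ι → ℝ} {R D : ℝ} (hx : ∀ i ∈ s, 0 ≤ x i)
    (hxR : ∀ i ∈ s, x i ≤ R) (hd : ∀ i ∈ s, 0 ≤ d i) (hdD : ∀ i ∈ s, d i ≤ D)
    (hR : 0 ≤ R) (hD : 0 ≤ D) :
    ∏ i ∈ s, (x i + d i) - ∏ i ∈ s, x i ≤ (R + D) ^ s.card - R ^ s.card := by
  classical
  induction s using Finset.induction_on with
  | empty => simp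
  | insert i s hi ih =>
    simp only [Finset.prod_insert hi, Finset.card_insert_of_notMem hi, Finset.forall_mem_insert] at *
    have h1 : ∏ i ∈ s, (x i + d i) ≤ (R + D) ^ s.card := by
      rw [← Finset.prod_const]
      exact Finset.prod_le_prod (fun i hi => add_nonneg (hx.2 i hi) (hd.2 i hi))
        fun i hi => add_le_add (hxR.2 i hi) (hdD.2 i hi)
    have h0 : (0 : ℝ) ≤ ∏ i ∈ s, (x i + d i) :=
      Finset.prod_nonneg fun i hi => add_nonneg (hx.2 i hi) (hd.2 i hi)
    have h2 := ih hx.2 hxR.2 hd.2 hdD.2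
    have h3 : (0 : ℝ) ≤ (R + D) ^ s.card - R ^ s.card :=
      sub_nonneg.2 (pow_le_pow_left₀ hR (by linarith) _)
    have h4 := mul_le_mul_of_nonneg_left h2 hx.1
    have h5 := mul_le_mul_of_nonneg_right hxR.1 h3
    have h6 := mul_le_mul hdD.1 h1 h0 hD
    rw [pow_succ, pow_succ]
    nlinarith

/-- After `norm_prod_sub_prod_le` both terms on the right are sums over all multi-indices of
products, that is, products of ℓ¹ sums; the number of frequencies does not enter. -/
lemma sum_norm_prod_sub_prod_le [Fintype ι] [DecidableEq ι] {Q : Type*} (s : Finset Q) (A B : ι → Q → ℂ) {R D : ℝ}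
    (hR : ∀ i, ∑ q ∈ s, ‖B i q‖ ≤ R) (hD : ∀ i, ∑ q ∈ s, ‖A i q - B i q‖ ≤ D) (hR0 : 0 ≤ R)
    (hD0 : 0 ≤ D) :
    ∑ j ∈ Fintype.piFinset fun _ : ι => s, ‖∏ i, A i (j i) - ∏ i, B i (j i)‖
      ≤ (R + D) ^ Fintype.card ι - R ^ Fintype.card ι := by
  refine (Finset.sum_le_sum fun j _ => norm_prod_sub_prod_le Finset.univ (fun i => A i (j i))
    fun i => B i (j i)).trans ?_
  rw [Finset.sum_sub_distrib, ← Finset.prod_univ_sum (fun _ => s) fun i q => ‖B i q‖ + ‖A i q - B i q‖,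
    ← Finset.prod_univ_sum (fun _ => s) fun i q => ‖B i q‖]
  simp only [Finset.sum_add_distrib]
  exact prod_add_sub_prod_le Finset.univ (fun i _ => Finset.sum_nonneg fun _ _ => norm_nonneg _)
    (fun i _ => hR i) (fun i _ => Finset.sum_nonneg fun _ _ => norm_nonneg _) (fun i _ => hD i) hR0 hD0

lemma add_pow_sub_pow_le {R D : ℝ} (hR : 0 ≤ R) (hD : 0 ≤ D) (n : ℕ) :
    (R + D) ^ n - R ^ n ≤ n * (R + D) ^ (n - 1) * D := by
  have h := abs_pow_sub_pow_le (R + D) R n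
  rw [add_sub_cancel_left, abs_of_nonneg hD, abs_of_nonneg hR, abs_of_nonneg (add_nonneg hR hD),
    max_eq_left (by linarith)] at h
  calc _ ≤ _ := le_abs_self _
    _ ≤ _ := h
    _ = _ := by ring

/-- Each factor is at most the product because all are at least `1`. This turns a sum of symbols
into a weight that can be distributed over the factors of a multilinear expression. -/
lemma sum_le_card_mul_prod [Fintype ι] {x : ι → ℝ} (hx : ∀ i, 1 ≤ x i) :
    ∑ i, x i ≤ Fintype.card ι * ∏ i, x i := by
  classical
  have h : ∀ i ∈ Finset.univ, x i ≤ ∏ i, x i := fun i hi => by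
    rw [← Finset.mul_prod_erase _ _ hi]
    have : (1 : ℝ) ≤ ∏ j ∈ Finset.univ.erase i, x j := by
      rw [← Finset.prod_const_one (s := Finset.univ.erase i)]
      exact Finset.prod_le_prod (fun _ _ => zero_le_one) fun i _ => hx i
    nlinarith [hx i]
  simpa using Finset.sum_le_card_nsmul _ _ _ h

end Prod

/-! ### The midpoint rule for oscillating exponentials -/

section Midpoint

/-- The imaginary exponential `exp (i x)`. -/
noncomputable def cis (x : ℝ) : ℂ := Complex.exp (Complex.I * (x : ℂ))

lemma cis_eq (x : ℝ) : cis x = Complex.exp ((x : ℂ) * Complex.I) := by rw [cis, mul_comm]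

@[simp] lemma norm_cis (x : ℝ) : ‖cis x‖ = 1 := by rw [cis_eq, Complex.norm_exp_ofReal_mul_I]

lemma cis_add (x y : ℝ) : cis (x + y) = cis x * cis y := by
  rw [cis, cis, cis, ← Complex.exp_add]; push_cast; ring_nf

@[simp] lemma cis_zero : cis 0 = 1 := by simp [cis]

lemma cis_neg_mul (x : ℝ) : cis (-x) * cis x = 1 := by rw [← cis_add, neg_add_cancel, cis_zero]

lemma cis_mul_neg (x : ℝ) : cis x * cis (-x) = 1 := by rw [mul_comm, cis_neg_mul]

lemma conj_cis (x : ℝ) : conj (cis x) = cis (-x) := by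
  rw [cis_eq, cis_eq, ← Complex.exp_conj]; simp

lemma cis_sum {ι : Type*} (s : Finset ι) (x : ι → ℝ) : cis (∑ i ∈ s, x i) = ∏ i ∈ s, cis (x i) := by
  classical
  induction s using Finset.induction_on with
  | empty => simp
  | insert i s hi ih => rw [Finset.sum_insert hi, Finset.prod_insert hi, cis_add, ih]

lemma hasDerivAt_cis_mul (ω t : ℝ) :
    HasDerivAt (fun s : ℝ => cis (ω * s)) (Complex.I * ω * cis (ω * t)) t := by
  have h1 : HasDerivAt (fun s : ℝ => ω * s) ω t := by simpa using (hasDerivAt_id t).const_mul ω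
  have h2 := (h1.ofReal_comp.const_mul Complex.I).cexp
  exact h2.congr_deriv (by rw [cis]; ring)

/-- An antiderivative of `s ↦ exp (i ω s)`. -/
noncomputable def cisPrim (ω s : ℝ) : ℂ := if ω = 0 then (s : ℂ) else cis (ω * s) / (Complex.I * ω)

lemma hasDerivAt_cisPrim (ω t : ℝ) : HasDerivAt (cisPrim ω) (cis (ω * t)) t := by
  by_cases h : ω = 0
  · have e : cisPrim ω = fun s : ℝ => (s : ℂ) := by funext s; simp [cisPrim, h]
    rw [e, h]
    simpa using (hasDerivAt_id t).ofReal_comp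
  · have e : cisPrim ω = fun s : ℝ => cis (ω * s) / (Complex.I * ω) := by funext s; simp [cisPrim, h]
    rw [e]
    have hω : (Complex.I * ω : ℂ) ≠ 0 := mul_ne_zero Complex.I_ne_zero (by exact_mod_cast h)
    refine ((hasDerivAt_cis_mul ω t).div_const (Complex.I * ω)).congr_deriv ?_
    rw [mul_div_assoc, mul_div_cancel₀ _ hω]

/-- The factor by which the error of the midpoint rule with step `τ` for `s ↦ exp (i ω s)` is a
difference of boundary values. -/
noncomputable def midFactor (τ ω : ℝ) : ℝ := 1 / ω - τ / (2 * Real.sin (ω * τ / 2))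

lemma cis_sub_cis (ω t τ : ℝ) : cis (ω * (t + τ)) - cis (ω * t)
    = cis (ω * (t + τ / 2)) * (2 * Complex.I * Real.sin (ω * τ / 2)) := by
  have e1 : ω * (t + τ) = ω * (t + τ / 2) + ω * τ / 2 := by ring
  have e2 : ω * t = ω * (t + τ / 2) + -(ω * τ / 2) := by ring
  rw [e1, e2, cis_add, cis_add, ← mul_sub]
  rw [cis_eq (ω * τ / 2), cis_eq (-(ω * τ / 2)), Complex.ofReal_sin, Complex.sin]
  push_cast
  linear_combination (cis (ω * (t + τ / 2)) * (Complex.exp (ω * τ / 2 * Complex.I)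
    - Complex.exp (-(ω * τ / 2) * Complex.I))) * Complex.I_sq

lemma sin_ne_zero_of_abs_le {τ ω : ℝ} (hτ : 0 < τ) (hω : ω ≠ 0) (h : |ω| * τ ≤ Real.pi) :
    Real.sin (ω * τ / 2) ≠ 0 := by
  have hx : ω * τ / 2 ≠ 0 := by positivity
  have hpi := Real.pi_pos
  have h2 : |ω * τ / 2| < Real.pi := by
    rw [abs_div, abs_mul, abs_of_pos hτ, abs_two]; linarith
  rw [abs_lt] at h2
  rcases lt_or_gt_of_ne hx with h0 | h0
  · exact (Real.sin_neg_of_neg_of_neg_pi_lt h0 h2.1).ne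
  · exact (Real.sin_pos_of_pos_of_lt_pi h0 h2.2).ne'

/-- Both the integral over the step and the midpoint value are multiples of the boundary difference
of exp(iωs): the integral with factor 1/(iω), the value times `τ` with factor τ/(2i sin(ωτ/2)). The
second factor blows up at resonances of ω with the step, which |ω|τ ≤ π excludes. -/
lemma cisPrim_sub_eq {τ ω : ℝ} (hτ : 0 < τ) (h : |ω| * τ ≤ Real.pi) (t : ℝ) :
    cisPrim ω (t + τ) - cisPrim ω t = τ * cis (ω * (t + τ / 2))
      + (-Complex.I * midFactor τ ω) * cis (ω * (t + τ)) - (-Complex.I * midFactor τ ω) * cis (ω * t) := by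
  by_cases hω : ω = 0
  -- For ω = 0 the midpoint rule is exact, and `midFactor` vanishes by the convention on division by
  -- zero.
  · simp [cisPrim, hω, midFactor]
  · have hs : (Real.sin (ω * τ / 2) : ℂ) ≠ 0 := by exact_mod_cast sin_ne_zero_of_abs_le hτ hω h
    have hω' : (ω : ℂ) ≠ 0 := by exact_mod_cast hω
    rw [add_sub_assoc, ← mul_sub, cis_sub_cis]
    simp only [cisPrim, hω, if_false]
    rw [← sub_div, cis_sub_cis, midFactor]
    set S := Real.sin (ω * τ / 2)
    push_cast
    field_simp
    linear_combination (cis (ω * (t * 2 + τ) / 2) * (2 * S - ω * τ)) * Complex.I_sq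

lemma midFactor_neg (τ ω : ℝ) : midFactor τ (-ω) = -midFactor τ ω := by
  simp only [midFactor, neg_mul, neg_div, Real.sin_neg, mul_neg, div_neg]; ring

/-- With x = ωτ/2 the factor equals -(τ/2)(x - sin x)/(x sin x). Here x - sin x ≤ x³ and sin x ≥
x/2, so the quotient is at most 2x. The first power of ω is the only derivative lost by the
second-order bound. -/
lemma abs_midFactor_le {τ ω : ℝ} (hτ : 0 < τ) (h : |ω| * τ ≤ Real.pi) :
    |midFactor τ ω| ≤ τ ^ 2 * |ω| := by
  wlog hω : 0 < ω generalizing ω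
  · rcases (not_lt.1 hω).eq_or_lt with rfl | h0
    · simp [midFactor]
    · have := this (ω := -ω) (by rwa [abs_neg]) (by linarith)
      rwa [midFactor_neg, abs_neg, abs_neg] at this
  rw [abs_of_pos hω] at h ⊢
  set x := ω * τ / 2 with hx
  have hx0 : 0 < x := by positivity
  have hx2 : x ≤ Real.pi / 2 := by rw [hx]; linarith
  have h1 : x - x ^ 3 ≤ Real.sin x := by
    have := Real.sin_gt_sub_cube hx0
    have := pow_pos hx0 3
    linarith
  -- Jordan's inequality requires x ≤ π/2, which is the step restriction |ω|τ ≤ π.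
  have h2 := Real.mul_le_sin hx0.le hx2
  have h3 := Real.sin_le hx0.le
  have hpi := Real.pi_pos
  have hpi4 := Real.pi_le_four
  have hs : 0 < Real.sin x := lt_of_lt_of_le (by positivity) h2
  have e : midFactor τ ω = -(τ / 2 * ((x - Real.sin x) / (x * Real.sin x))) := by
    rw [midFactor, ← hx]
    have : ω = 2 * x / τ := by rw [hx]; field_simp
    rw [this]; field_simp; ring
  rw [e, abs_neg, abs_of_nonneg (mul_nonneg (by positivity) (div_nonneg (by linarith) (by positivity)))]
  have h4 : (x - Real.sin x) / (x * Real.sin x) ≤ 2 * x := by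
    rw [div_le_iff₀ (by positivity)]
    have h5 : x / 2 ≤ Real.sin x := by
      refine le_trans ?_ h2
      rw [div_eq_inv_mul]
      gcongr
      rw [inv_eq_one_div, div_le_div_iff₀ (by norm_num) hpi]; linarith
    have : x ^ 2 * (x / 2) ≤ x ^ 2 * Real.sin x := by gcongr
    nlinarith
  calc _ ≤ τ / 2 * (2 * x) := by gcongr
    _ = τ ^ 2 * ω / 2 := by rw [hx]; ring
    _ ≤ _ := by nlinarith [mul_pos (pow_pos hτ 2) hω]

end Midpoint

/-! ### The nonlinearity evaluated at a linear flow -/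

section Expansion

variable {a b : ℝ}

/-- The sign `± 1` attached to a Boolean. -/
def sg (s : Bool) : ℝ := if s then 1 else -1

@[simp] lemma sg_true : sg true = 1 := rfl
@[simp] lemma sg_false : sg false = -1 := rfl

@[simp] lemma abs_sg (s : Bool) : |sg s| = 1 := by cases s <;> simp

lemma sg_mul_self (s : Bool) : sg s * sg s = 1 := by cases s <;> simp

/-- The linear flow with twisted coefficients `c` on the frequencies `B`. -/
noncomputable def linFlow (a b : ℝ) (B : Finset ℤ) (c : Bool → ℤ → ℂ) (s x : ℝ) : ℂ :=
  ∑ q ∈ (Finset.univ : Finset Bool) ×ˢ B,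
    c q.1 q.2 / 2 * cis (sg q.1 * symbol a b q.2 * s) * mode a b q.2 x

/-- The Fourier coefficients of the linear flow. -/
noncomputable def linCoef (a b : ℝ) (B : Finset ℤ) (c : Bool → ℤ → ℂ) (s : ℝ) (l : ℤ) : ℂ :=
  if l ∈ B then ∑ σ : Bool, c σ l / 2 * cis (sg σ * symbol a b l * s) else 0

lemma linFlow_eq (B : Finset ℤ) (c : Bool → ℤ → ℂ) (s x : ℝ) :
    linFlow a b B c s x = ∑ l ∈ B, linCoef a b B c s l * mode a b l x := by
  rw [linFlow, Finset.sum_product_right]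
  refine Finset.sum_congr rfl fun l hl => ?_
  rw [linCoef, if_pos hl, Finset.sum_mul]

lemma linFlow_eq_of_subset {B F : Finset ℤ} (h : B ⊆ F) (c : Bool → ℤ → ℂ) (s x : ℝ) :
    linFlow a b B c s x = ∑ l ∈ F, linCoef a b B c s l * mode a b l x := by
  rw [linFlow_eq]
  refine Finset.sum_subset h fun l _ hl => ?_
  rw [linCoef, if_neg hl, zero_mul]

lemma fourierCoef_linFlow (hab : a < b) (B : Finset ℤ) (c : Bool → ℤ → ℂ) (s : ℝ) (l : ℤ) :
    fourierCoef a b (linFlow a b B c s) l = linCoef a b B c s l := by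
  rw [show linFlow a b B c s = fun x => ∑ l ∈ B, linCoef a b B c s l * mode a b l x from
    funext fun x => linFlow_eq B c s x, fourierCoef_trigPoly hab]
  by_cases hl : l ∈ B
  · rw [if_pos hl]
  · rw [if_neg hl, linCoef, if_neg hl]

lemma continuous_linFlow (B : Finset ℤ) (c : Bool → ℤ → ℂ) (s : ℝ) :
    Continuous (linFlow a b B c s) :=
  continuous_finsetSum _ fun _ _ => continuous_const.mul (continuous_mode _)

lemma norm_linFlow_le (B : Finset ℤ) (c : Bool → ℤ → ℂ) (s x : ℝ) :
    ‖linFlow a b B c s x‖ ≤ ∑ q ∈ (Finset.univ : Finset Bool) ×ˢ B, ‖c q.1 q.2‖ / 2 := by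
  refine (norm_sum_le _ _).trans (Finset.sum_le_sum fun q _ => ?_)
  simp [norm_mode]

/-- Indices of the factors in `f(z) = z^(p+1) conj(z)^p`. -/
abbrev Factor (p : ℕ) := Fin (p + 1) ⊕ Fin p

lemma card_factor (p : ℕ) : Fintype.card (Factor p) = 2 * p + 1 := by
  simp [Factor]; ring

/-- The sign of a factor: `-1` for the conjugated ones. -/
def parity {p : ℕ} : Factor p → ℤ := Sum.elim (fun _ => 1) fun _ => -1

/-- The coefficient attached to a factor. -/
noncomputable def factorCoef {p : ℕ} (c : Bool → ℤ → ℂ) : Factor p → Bool × ℤ → ℂ :=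
  Sum.elim (fun _ q => c q.1 q.2 / 2) fun _ q => conj (c q.1 q.2 / 2)

/-- The multi-indices of the expansion of the nonlinearity. -/
noncomputable def multiIdx (p : ℕ) (B : Finset ℤ) : Finset (Factor p → Bool × ℤ) :=
  Fintype.piFinset fun _ => (Finset.univ : Finset Bool) ×ˢ B

/-- The spatial frequency of a multi-index. -/
def spaceFreq {p : ℕ} (j : Factor p → Bool × ℤ) : ℤ := ∑ i, parity i * (j i).2

/-- The temporal frequency of a multi-index. -/
noncomputable def timeFreq (a b : ℝ) {p : ℕ} (j : Factor p → Bool × ℤ) : ℝ :=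
  ∑ i, (parity i : ℝ) * (sg (j i).1 * symbol a b (j i).2)

/-- The amplitude of a multi-index. -/
noncomputable def amp {p : ℕ} (c : Bool → ℤ → ℂ) (j : Factor p → Bool × ℤ) : ℂ :=
  ∏ i, factorCoef c i (j i)

/-- Since f(z) is z^(p+1) times the p-th power of the conjugate of z, inserting a sum of plane waves
gives one plane wave for each choice of a wave per factor. Conjugated factors reverse both the
spatial and the temporal frequency. -/
lemma powerNonlin_linFlow (p : ℕ) (B : Finset ℤ) (c : Bool → ℤ → ℂ) (s x : ℝ) :
    powerNonlin p (linFlow a b B c s x)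
      = ∑ j ∈ multiIdx p B, amp c j * cis (timeFreq a b j * s) * mode a b (spaceFreq j) x := by
  have h1 : powerNonlin p (linFlow a b B c s x) = ∏ i : Factor p,
      ∑ q ∈ (Finset.univ : Finset Bool) ×ˢ B, factorCoef c i q
        * cis ((parity i : ℝ) * (sg q.1 * symbol a b q.2) * s) * mode a b (parity i * q.2) x := by
    rw [powerNonlin_eq, Fintype.prod_sum_type]
    congr 1
    · simp [linFlow, factorCoef, parity]
    · simp only [factorCoef, parity, Sum.elim_inr, Finset.prod_const, Finset.card_univ,
        Fintype.card_fin]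
      congr 1
      simp only [linFlow, map_sum, map_mul, conj_cis, conj_mode]
      refine Finset.sum_congr rfl fun q _ => ?_
      congr 3 <;> push_cast <;> ring
  rw [h1, Finset.prod_univ_sum]
  refine Finset.sum_congr rfl fun j _ => ?_
  rw [Finset.prod_mul_distrib, Finset.prod_mul_distrib, spaceFreq, mode_sum, timeFreq, Finset.sum_mul,
    cis_sum, amp]

/-- The Fourier coefficients of the nonlinearity at the linear flow. -/
noncomputable def nlCoef (a b : ℝ) (p : ℕ) (B : Finset ℤ) (c : Bool → ℤ → ℂ) (s : ℝ) (l : ℤ) : ℂ :=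
  ∑ j ∈ multiIdx p B, if spaceFreq j = l then amp c j * cis (timeFreq a b j * s) else 0

lemma fourierCoef_powerNonlin_linFlow (hab : a < b) (p : ℕ) (B : Finset ℤ) (c : Bool → ℤ → ℂ)
    (s : ℝ) (l : ℤ) :
    fourierCoef a b (fun x => powerNonlin p (linFlow a b B c s x)) l = nlCoef a b p B c s l := by
  simp only [powerNonlin_linFlow]
  exact fourierCoef_sum_mode hab _ (fun j => amp c j * cis (timeFreq a b j * s)) _ l

/-- If all product frequencies stay in `freqs N`, sampling commutes with the nonlinearity, so the
method sees the exact Fourier coefficients. -/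
lemma discreteCoef_powerNonlin_linFlow (hab : a < b) {N : ℕ} (hN : 0 < N) (p : ℕ) {B : Finset ℤ}
    (hB : ∀ j ∈ multiIdx p B, spaceFreq j ∈ freqs N) (c : Bool → ℤ → ℂ) (s : ℝ) {l : ℤ}
    (hl : l ∈ freqs N) :
    discreteCoef a b N (sample a b N fun x => powerNonlin p (linFlow a b B c s x)) l
      = nlCoef a b p B c s l := by
  simp only [powerNonlin_linFlow]
  exact discreteCoef_sum_mode hab hN _ (fun j => amp c j * cis (timeFreq a b j * s)) _ hB hl

lemma abs_spaceFreq_le {p : ℕ} {B : Finset ℤ} {K : ℤ} (hB : ∀ l ∈ B, |l| ≤ K)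
    {j : Factor p → Bool × ℤ} (hj : j ∈ multiIdx p B) : |spaceFreq j| ≤ (2 * p + 1) * K := by
  have h : ∀ i ∈ (Finset.univ : Finset (Factor p)), |parity i * (j i).2| ≤ K := by
    intro i _
    have hi := (Finset.mem_product.1 (Fintype.mem_piFinset.1 hj i)).2
    rw [abs_mul]
    rcases i with i | i <;> simpa [parity] using hB _ hi
  have h2 := (Finset.abs_sum_le_sum_abs (fun i => parity i * (j i).2) Finset.univ).trans
    (Finset.sum_le_card_nsmul _ _ _ h)
  rw [Finset.card_univ, card_factor, nsmul_eq_mul] at h2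
  rw [spaceFreq]
  exact_mod_cast h2

/-- The temporal frequency of a multi-index relative to the mode that it excites. -/
noncomputable def relFreq (a b : ℝ) {p : ℕ} (σ : Bool) (j : Factor p → Bool × ℤ) : ℝ :=
  timeFreq a b j - sg σ * symbol a b (spaceFreq j)

/-- The symbol is subadditive, so the symbol of the excited mode is bounded by the sum of the
symbols of the interacting ones, just as the temporal frequency is. -/
lemma abs_relFreq_le {p : ℕ} (σ : Bool) (j : Factor p → Bool × ℤ) :
    |relFreq a b σ j| ≤ 2 * ∑ i, symbol a b (j i).2 := by
  have h1 : |timeFreq a b j| ≤ ∑ i, symbol a b (j i).2 := by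
    refine (Finset.abs_sum_le_sum_abs _ _).trans_eq (Finset.sum_congr rfl fun i _ => ?_)
    rw [abs_mul, abs_mul, abs_sg, abs_of_pos (symbol_pos _)]
    rcases i with i | i <;> simp [parity]
  have h2 : symbol a b (spaceFreq j) ≤ ∑ i, symbol a b (j i).2 := by
    refine (symbol_sum_le _ Finset.univ_nonempty _).trans_eq (Finset.sum_congr rfl fun i _ => ?_)
    rcases i with i | i <;> simp [parity, symbol_neg]
  refine (abs_sub _ _).trans ?_
  rw [abs_mul, abs_sg, abs_of_pos (symbol_pos _)]
  linarith

/-- An antiderivative of the twisted nonlinearity at the linear flow. -/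
noncomputable def nlPrim (a b : ℝ) (p : ℕ) (B : Finset ℤ) (c : Bool → ℤ → ℂ) (σ : Bool) (s : ℝ)
    (l : ℤ) : ℂ :=
  ∑ j ∈ multiIdx p B, if spaceFreq j = l then amp c j * cisPrim (relFreq a b σ j) s else 0

/-- The boundary term of the midpoint rule for the twisted nonlinearity at the linear flow. -/
noncomputable def nlBdry (a b : ℝ) (p : ℕ) (B : Finset ℤ) (τ : ℝ) (c : Bool → ℤ → ℂ) (σ : Bool)
    (s : ℝ) (l : ℤ) : ℂ :=
  ∑ j ∈ multiIdx p B, if spaceFreq j = l then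
    amp c j * ((-Complex.I * midFactor τ (relFreq a b σ j)) * cis (relFreq a b σ j * s)) else 0

lemma cis_mul_nlCoef (p : ℕ) (B : Finset ℤ) (c : Bool → ℤ → ℂ) (σ : Bool) (s : ℝ) (l : ℤ) :
    cis (-(sg σ * symbol a b l * s)) * nlCoef a b p B c s l
      = ∑ j ∈ multiIdx p B, if spaceFreq j = l then amp c j * cis (relFreq a b σ j * s) else 0 := by
  rw [nlCoef, Finset.mul_sum]
  refine Finset.sum_congr rfl fun j _ => ?_
  split_ifs with h
  · rw [relFreq, h, sub_mul, sub_eq_add_neg, cis_add]; ring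
  · rw [mul_zero]

lemma hasDerivAt_nlPrim (p : ℕ) (B : Finset ℤ) (c : Bool → ℤ → ℂ) (σ : Bool) (s : ℝ) (l : ℤ) :
    HasDerivAt (fun s => nlPrim a b p B c σ s l)
      (cis (-(sg σ * symbol a b l * s)) * nlCoef a b p B c s l) s := by
  rw [cis_mul_nlCoef]
  refine HasDerivAt.fun_sum fun j _ => ?_
  split_ifs with h
  · exact (hasDerivAt_cisPrim _ _).const_mul _
  · exact hasDerivAt_const _ _

/-- The step restriction that excludes resonances of the time step with the frequencies in `B`. -/
def NonResonant (a b : ℝ) (p : ℕ) (B : Finset ℤ) (τ : ℝ) : Prop :=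
  ∀ l ∈ B, 2 * (2 * p + 1) * symbol a b l * τ ≤ Real.pi

/-- The constant 2(2p+1) in `NonResonant` is the factor 2 of `abs_relFreq_le` times the number of
factors of the nonlinearity. -/
lemma NonResonant.abs_relFreq_mul_le {p : ℕ} {B : Finset ℤ} {τ : ℝ} (hτ : 0 < τ)
    (h : NonResonant a b p B τ) (σ : Bool) {j : Factor p → Bool × ℤ} (hj : j ∈ multiIdx p B) :
    |relFreq a b σ j| * τ ≤ Real.pi := by
  have h1 : ∀ i ∈ (Finset.univ : Finset (Factor p)),
      symbol a b (j i).2 ≤ Real.pi / (2 * (2 * p + 1) * τ) := by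
    intro i _
    have hi := (Finset.mem_product.1 (Fintype.mem_piFinset.1 hj i)).2
    rw [le_div_iff₀ (by positivity)]
    linarith [h _ hi]
  have h2 := Finset.sum_le_card_nsmul _ _ _ h1
  rw [Finset.card_univ, card_factor, nsmul_eq_mul] at h2
  calc |relFreq a b σ j| * τ ≤ (2 * (((2 * p + 1 : ℕ) : ℝ) * (Real.pi / (2 * (2 * p + 1) * τ)))) * τ := by
        gcongr
        exact (abs_relFreq_le σ j).trans (by linarith)
    _ = Real.pi := by push_cast; field_simp

/-- With frozen coefficients the midpoint error is a pure boundary difference. In the sum over time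
steps only the change of the coefficients from step to step prevents exact telescoping. -/
lemma nlPrim_sub_eq {p : ℕ} {B : Finset ℤ} {τ : ℝ} (hτ : 0 < τ) (h : NonResonant a b p B τ)
    (c : Bool → ℤ → ℂ) (σ : Bool) (t : ℝ) (l : ℤ) :
    nlPrim a b p B c σ (t + τ) l - nlPrim a b p B c σ t l
      = τ * (cis (-(sg σ * symbol a b l * (t + τ / 2))) * nlCoef a b p B c (t + τ / 2) l)
        + nlBdry a b p B τ c σ (t + τ) l - nlBdry a b p B τ c σ t l := by
  rw [cis_mul_nlCoef, nlPrim, nlPrim, nlBdry, nlBdry, Finset.mul_sum, ← Finset.sum_sub_distrib,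
    ← Finset.sum_add_distrib, ← Finset.sum_sub_distrib]
  refine Finset.sum_congr rfl fun j hj => ?_
  split_ifs with hl
  · rw [← mul_sub, cisPrim_sub_eq hτ (h.abs_relFreq_mul_le hτ σ hj)]
    ring
  · simp

lemma norm_factorCoef_sub {p : ℕ} (c c' : Bool → ℤ → ℂ) (i : Factor p) (q : Bool × ℤ) :
    ‖factorCoef c i q - factorCoef c' i q‖ = ‖c q.1 q.2 - c' q.1 q.2‖ / 2 := by
  rcases i with i | i
  · simp only [factorCoef, Sum.elim_inl]
    rw [← sub_div, norm_div, Complex.norm_ofNat]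
  · simp only [factorCoef, Sum.elim_inr]
    rw [← map_sub, RCLike.norm_conj, ← sub_div, norm_div, Complex.norm_ofNat]

lemma norm_factorCoef {p : ℕ} (c : Bool → ℤ → ℂ) (i : Factor p) (q : Bool × ℤ) :
    ‖factorCoef c i q‖ = ‖c q.1 q.2‖ / 2 := by
  rcases i with i | i <;> simp [factorCoef]

/-- The boundary term is of second order and Lipschitz continuous in the coefficients. -/
lemma sum_norm_nlBdry_sub_le {p : ℕ} {B : Finset ℤ} {τ : ℝ} (hτ : 0 < τ) (h : NonResonant a b p B τ)
    (c c' : Bool → ℤ → ℂ) (σ : Bool) (t : ℝ) (F : Finset ℤ) {R D : ℝ} (hR0 : 0 ≤ R) (hD0 : 0 ≤ D)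
    (hR : ∑ q ∈ (Finset.univ : Finset Bool) ×ˢ B, symbol a b q.2 * ‖c' q.1 q.2‖ ≤ 2 * R)
    (hD : ∑ q ∈ (Finset.univ : Finset Bool) ×ˢ B,
      symbol a b q.2 * ‖c q.1 q.2 - c' q.1 q.2‖ ≤ 2 * D) :
    ∑ l ∈ F, ‖nlBdry a b p B τ c σ t l - nlBdry a b p B τ c' σ t l‖
      ≤ 2 * (2 * p + 1) * τ ^ 2 * ((R + D) ^ (2 * p + 1) - R ^ (2 * p + 1)) := by
  have h1 : ∀ l ∈ F, ‖nlBdry a b p B τ c σ t l - nlBdry a b p B τ c' σ t l‖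
      ≤ ∑ j ∈ multiIdx p B, if spaceFreq j = l then
        ‖amp c j - amp c' j‖ * |midFactor τ (relFreq a b σ j)| else 0 := by
    intro l _
    rw [nlBdry, nlBdry, ← Finset.sum_sub_distrib]
    refine (norm_sum_le _ _).trans (Finset.sum_le_sum fun j _ => ?_)
    split_ifs
    · rw [← sub_mul]; simp
    · simp
  -- The factor `midFactor` costs τ² times a sum of symbols. Bounding that sum by a product puts one
  -- symbol on each coefficient, so a weighted ℓ¹ norm of the coefficients suffices.
  have h2 : ∀ j ∈ multiIdx p B, ‖amp c j - amp c' j‖ * |midFactor τ (relFreq a b σ j)|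
      ≤ 2 * (2 * p + 1) * τ ^ 2 * ‖∏ i, (symbol a b (j i).2 : ℂ) * factorCoef c i (j i)
        - ∏ i, (symbol a b (j i).2 : ℂ) * factorCoef c' i (j i)‖ := by
    intro j hj
    have h3 := abs_midFactor_le hτ (h.abs_relFreq_mul_le hτ σ hj)
    have h4 := sum_le_card_mul_prod (x := fun i => symbol a b (j i).2) fun i => one_le_symbol _
    rw [card_factor] at h4
    have h5 := (abs_relFreq_le (a := a) (b := b) σ j).trans
      (mul_le_mul_of_nonneg_left h4 zero_le_two)
    rw [Finset.prod_mul_distrib, Finset.prod_mul_distrib, ← mul_sub, norm_mul, norm_prod]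
    simp only [Complex.norm_real, Real.norm_of_nonneg (symbol_pos _).le]
    change _ ≤ 2 * (2 * p + 1) * τ ^ 2 * ((∏ i, symbol a b (j i).2) * ‖amp c j - amp c' j‖)
    calc _ ≤ ‖amp c j - amp c' j‖ * (τ ^ 2 *
          (2 * (((2 * p + 1 : ℕ) : ℝ) * ∏ i, symbol a b (j i).2))) := by
          gcongr
          exact h3.trans (by gcongr)
      _ = _ := by push_cast; ring
  refine (Finset.sum_le_sum h1).trans ?_
  rw [Finset.sum_comm]
  calc _ ≤ ∑ j ∈ multiIdx p B, ‖amp c j - amp c' j‖ * |midFactor τ (relFreq a b σ j)| := by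
        refine Finset.sum_le_sum fun j _ => ?_
        rw [Finset.sum_ite_eq]
        split_ifs
        · exact le_rfl
        · positivity
    _ ≤ _ := Finset.sum_le_sum h2
    _ ≤ _ := by
        rw [← Finset.mul_sum, ← card_factor]
        gcongr
        refine sum_norm_prod_sub_prod_le _ (fun i q => (symbol a b q.2 : ℂ) * factorCoef c i q)
          (fun i q => (symbol a b q.2 : ℂ) * factorCoef c' i q) (fun i => ?_) (fun i => ?_) hR0 hD0
        · simp only [norm_mul, norm_factorCoef, Complex.norm_real, Real.norm_of_nonneg (symbol_pos _).le,
            ← mul_div_assoc, ← Finset.sum_div]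
          linarith
        · simp only [← mul_sub, norm_mul, norm_factorCoef_sub, Complex.norm_real,
            Real.norm_of_nonneg (symbol_pos _).le, ← mul_div_assoc, ← Finset.sum_div]
          linarith

lemma nlBdry_zero (p : ℕ) (B : Finset ℤ) (τ : ℝ) (σ : Bool) (t : ℝ) (l : ℤ) :
    nlBdry a b p B τ (fun _ _ => 0) σ t l = 0 := by
  have : ∀ j : Factor p → Bool × ℤ, amp (fun _ _ => 0) j = 0 := fun j =>
    Finset.prod_eq_zero (Finset.mem_univ (Sum.inl 0)) (by simp [factorCoef])
  simp [nlBdry, this]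

lemma sum_norm_nlBdry_le {p : ℕ} {B : Finset ℤ} {τ : ℝ} (hτ : 0 < τ) (h : NonResonant a b p B τ)
    (c : Bool → ℤ → ℂ) (σ : Bool) (t : ℝ) (F : Finset ℤ) {D : ℝ} (hD0 : 0 ≤ D)
    (hD : ∑ q ∈ (Finset.univ : Finset Bool) ×ˢ B, symbol a b q.2 * ‖c q.1 q.2‖ ≤ 2 * D) :
    ∑ l ∈ F, ‖nlBdry a b p B τ c σ t l‖ ≤ 2 * (2 * p + 1) * τ ^ 2 * D ^ (2 * p + 1) := by
  have := sum_norm_nlBdry_sub_le hτ h c (fun _ _ => 0) σ t F le_rfl hD0 (by simp) (by simpa using hD)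
  simpa [nlBdry_zero] using this

/-- The Fourier coefficients of the nonlinearity at a linear flow are absolutely summable, with a
bound that does not depend on the number of frequencies. -/
lemma sum_norm_nlCoef_le (p : ℕ) (B : Finset ℤ) (c : Bool → ℤ → ℂ) (s : ℝ) (F : Finset ℤ) {D : ℝ}
    (hD : ∑ q ∈ (Finset.univ : Finset Bool) ×ˢ B, ‖c q.1 q.2‖ ≤ 2 * D) :
    ∑ l ∈ F, ‖nlCoef a b p B c s l‖ ≤ D ^ (2 * p + 1) := by
  have h1 : ∀ l ∈ F, ‖nlCoef a b p B c s l‖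
      ≤ ∑ j ∈ multiIdx p B, if spaceFreq j = l then ‖amp c j‖ else 0 := by
    intro l _
    refine (norm_sum_le _ _).trans (Finset.sum_le_sum fun j _ => ?_)
    split_ifs <;> simp
  refine (Finset.sum_le_sum h1).trans ?_
  rw [Finset.sum_comm]
  calc _ ≤ ∑ j ∈ multiIdx p B, ∏ i, ‖factorCoef c i (j i)‖ := by
        refine Finset.sum_le_sum fun j _ => ?_
        rw [Finset.sum_ite_eq, amp, norm_prod]
        split_ifs
        · exact le_rfl
        · positivity
    _ = ∏ i : Factor p, ∑ q ∈ (Finset.univ : Finset Bool) ×ˢ B, ‖factorCoef c i q‖ := by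
        rw [multiIdx, ← Finset.prod_univ_sum (fun _ => (Finset.univ : Finset Bool) ×ˢ B)
          fun i q => ‖factorCoef c i q‖]
    _ ≤ ∏ i : Factor p, D := by
        refine Finset.prod_le_prod (fun i _ => Finset.sum_nonneg fun _ _ => norm_nonneg _) fun i _ => ?_
        simp only [norm_factorCoef, ← Finset.sum_div]
        linarith
    _ = _ := by rw [Finset.prod_const, Finset.card_univ, card_factor]

end Expansion

/-! ### Sobolev norms and Fourier coefficients -/

section Sobolev

variable {a b : ℝ}

lemma symbol_pow_eq (l : ℤ) (s : ℕ) : (1 + waveNumber a b l ^ 2) ^ s = symbol a b l ^ (2 * s) := by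
  rw [pow_mul, symbol_sq]

/-- Replaces a series in `ENNReal` by real finite partial sums, the form in which all estimates
below are carried out. -/
lemma sobolevNorm_le_iff {s : ℕ} {w : ℝ → ℂ} {D : ℝ} (hD : 0 ≤ D) :
    sobolevNorm a b s w ≤ ENNReal.ofReal D ↔
      ∀ F : Finset ℤ, ∑ l ∈ F, symbol a b l ^ (2 * s) * ‖fourierCoef a b w l‖ ^ 2 ≤ D ^ 2 := by
  have h1 : sobolevNorm a b s w ≤ ENNReal.ofReal D ↔
      ∑' l : ℤ, ENNReal.ofReal ((1 + waveNumber a b l ^ 2) ^ s * ‖fourierCoef a b w l‖ ^ 2)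
        ≤ ENNReal.ofReal (D ^ 2) := by
    rw [sobolevNorm, one_div, ENNReal.rpow_inv_le_iff (by norm_num), ENNReal.ofReal_pow hD,
      ← ENNReal.rpow_natCast, Nat.cast_ofNat]
  have h0 : ∀ l : ℤ, 0 ≤ symbol a b l ^ (2 * s) * ‖fourierCoef a b w l‖ ^ 2 := fun l =>
    mul_nonneg (pow_nonneg (symbol_pos l).le _) (sq_nonneg _)
  simp only [symbol_pow_eq] at h1
  rw [h1, ENNReal.tsum_eq_iSup_sum, iSup_le_iff]
  refine forall_congr' fun F => ?_
  rw [← ENNReal.ofReal_sum_of_nonneg fun l _ => h0 l, ENNReal.ofReal_le_ofReal_iff (sq_nonneg D)]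

/-- A bound in `L^∞([0, S]; H^s)` holds at every time if the Fourier coefficients are continuous. -/
lemma sum_le_of_linftySobolevNorm_le {S : ℝ} (hS : 0 < S) {s : ℕ} {w : ℝ → ℝ → ℂ} {M : ℝ}
    (hw : ∀ l, ContinuousOn (fun t => fourierCoef a b (w t) l) (Set.Icc 0 S))
    (h : linftySobolevNorm a b S s w ≤ ENNReal.ofReal M) (hM : 0 ≤ M) {t : ℝ}
    (ht : t ∈ Set.Icc 0 S) (F : Finset ℤ) :
    ∑ l ∈ F, symbol a b l ^ (2 * s) * ‖fourierCoef a b (w t) l‖ ^ 2 ≤ M ^ 2 := by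
  set g : ℝ → ℝ := fun t => ∑ l ∈ F, symbol a b l ^ (2 * s) * ‖fourierCoef a b (w t) l‖ ^ 2 with hg
  have hgc : ContinuousOn g (Set.Icc 0 S) :=
    continuousOn_finsetSum _ fun l _ => continuousOn_const.mul ((hw l).norm.pow 2)
  have hae : ∀ᵐ t ∂volume.restrict (Set.Icc 0 S), g t ≤ M ^ 2 := by
    filter_upwards [ENNReal.ae_le_essSup fun t => sobolevNorm a b s (w t)] with t ht
    exact (sobolevNorm_le_iff hM).1 (ht.trans h) F
  -- The partial sum is continuous in time, so its maximum with `M ^ 2`, being constant almost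
  -- everywhere on the interval, is constant.
  have heq := Measure.eqOn_Icc_of_ae_eq (μ := volume) hS.ne
    (f := fun t => max (g t) (M ^ 2)) (g := fun _ => M ^ 2)
    (by filter_upwards [hae] with t ht using max_eq_right ht)
    (hgc.sup continuousOn_const) continuousOn_const
  exact max_eq_right_iff.1 (heq ht)

lemma norm_fourierCoef_le (hab : a < b) {w : ℝ → ℂ} {C : ℝ}
    (h : ∀ x ∈ Set.Icc a b, ‖w x‖ ≤ C) (l : ℤ) : ‖fourierCoef a b w l‖ ≤ C := by
  have hba : 0 < b - a := sub_pos.2 hab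
  have h1 : ‖∫ x in a..b, w x * mode a b (-l) x‖ ≤ C * |b - a| := by
    refine intervalIntegral.norm_integral_le_of_norm_le_const fun x hx => ?_
    rw [Set.uIoc_of_le hab.le] at hx
    rw [norm_mul, norm_mode, mul_one]
    exact h x (Set.Ioc_subset_Icc_self hx)
  rw [abs_of_pos hba] at h1
  rw [fourierCoef_eq, norm_mul, Complex.norm_real, Real.norm_of_nonneg (by positivity)]
  calc _ ≤ 1 / (b - a) * (C * (b - a)) := by gcongr
    _ = C := by field_simp

lemma fourierCoef_const_mul (z : ℂ) (w : ℝ → ℂ) (l : ℤ) :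
    fourierCoef a b (fun x => z * w x) l = z * fourierCoef a b w l := by
  simp only [fourierCoef_eq, mul_assoc, intervalIntegral.integral_const_mul]
  ring

end Sobolev

/-! ### Solutions in Fourier space -/

section Solution

variable {a b : ℝ} {p : ℕ} {ε S : ℝ} {u₀ u₁ : ℝ → ℂ} {u v : ℝ → ℝ → ℂ}

lemma IsSolution.continuous_u (h : IsSolution a b p ε S u₀ u₁ u v) {t : ℝ} (ht : t ∈ Set.Icc 0 S) :
    Continuous (u t) :=
  continuousOn_univ.1 (h.continuousOn_u.comp (Continuous.prodMk_right t).continuousOn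
    fun _ _ => ⟨ht, Set.mem_univ _⟩)

lemma IsSolution.continuous_v (h : IsSolution a b p ε S u₀ u₁ u v) {t : ℝ} (ht : t ∈ Set.Icc 0 S) :
    Continuous (v t) :=
  continuousOn_univ.1 (h.continuousOn_v.comp (Continuous.prodMk_right t).continuousOn
    fun _ _ => ⟨ht, Set.mem_univ _⟩)

lemma IsSolution.periodic_v (h : IsSolution a b p ε S u₀ u₁ u v) (hS : 0 < S) {t : ℝ}
    (ht : t ∈ Set.Icc 0 S) : Function.Periodic (v t) (b - a) := by
  intro x
  have h1 := h.hasDeriv t ht (x + (b - a))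
  have h2 : HasDerivWithinAt (fun s => u s x) (v t (x + (b - a))) (Set.Icc 0 S) t :=
    h1.congr (fun s hs => (h.periodic s hs x).symm) (h.periodic t ht x).symm
  exact (uniqueDiffOn_Icc hS t ht).eq_deriv _ h2 (h.hasDeriv t ht x)

/-- Uniform continuity of v on the compact set [0, S] × [a, b] and the mean value inequality make
the difference quotients of u converge uniformly in x, and Fourier coefficients are controlled by
the supremum. -/
lemma IsSolution.hasDerivWithinAt_fourierCoef_u (h : IsSolution a b p ε S u₀ u₁ u v) (hab : a < b)
    {t : ℝ} (ht : t ∈ Set.Icc 0 S) (l : ℤ) :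
    HasDerivWithinAt (fun s => fourierCoef a b (u s) l) (fourierCoef a b (v t) l) (Set.Icc 0 S) t := by
  rw [hasDerivWithinAt_iff_isLittleO, Asymptotics.isLittleO_iff]
  intro c hc
  have hK : IsCompact (Set.Icc 0 S ×ˢ Set.Icc a b) := isCompact_Icc.prod isCompact_Icc
  have huc := hK.uniformContinuousOn_of_continuous
    (h.continuousOn_v.mono (Set.prod_mono_right (Set.subset_univ _)))
  obtain ⟨d, hd, huc⟩ := Metric.uniformContinuousOn_iff.1 huc c hc
  have hnear : ∀ᶠ s in nhdsWithin t (Set.Icc 0 S), s ∈ Set.Icc 0 S ∩ Metric.ball t d :=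
    Filter.inter_mem self_mem_nhdsWithin (mem_nhdsWithin_of_mem_nhds (Metric.ball_mem_nhds t hd))
  filter_upwards [hnear] with s hs
  have hx : ∀ x ∈ Set.Icc a b, ‖(u s x - u t x) - ((s - t : ℝ) : ℂ) * v t x‖ ≤ c * ‖s - t‖ := by
    intro x hx
    have hder : ∀ r ∈ Set.Icc 0 S ∩ Metric.ball t d, HasDerivWithinAt
        (fun r => u r x - (r : ℂ) * v t x) (v r x - v t x) (Set.Icc 0 S ∩ Metric.ball t d) r := by
      intro r hr
      have h1 := (h.hasDeriv r hr.1 x).mono (Set.inter_subset_left (t := Metric.ball t d))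
      have h2 : HasDerivWithinAt (fun r : ℝ => (r : ℂ) * v t x) (v t x)
          (Set.Icc 0 S ∩ Metric.ball t d) r := by
        simpa using ((hasDerivAt_id r).ofReal_comp.mul_const (v t x)).hasDerivWithinAt
      exact h1.sub h2
    have hbd : ∀ r ∈ Set.Icc 0 S ∩ Metric.ball t d, ‖v r x - v t x‖ ≤ c := by
      intro r hr
      have := huc (r, x) ⟨hr.1, hx⟩ (t, x) ⟨ht, hx⟩ (by simpa [Prod.dist_eq] using hr.2)
      rw [← dist_eq_norm]; exact this.le
    have := ((convex_Icc 0 S).inter (convex_ball t d)).norm_image_sub_le_of_norm_hasDerivWithin_le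
      hder hbd ⟨ht, Metric.mem_ball_self hd⟩ hs
    convert this using 1
    congr 1
    push_cast; ring
  have h1 := norm_fourierCoef_le hab hx l
  rw [fourierCoef_sub (w₁ := fun x => u s x - u t x) (w₂ := fun x => ((s - t : ℝ) : ℂ) * v t x)
    ((h.continuous_u hs.1).sub (h.continuous_u ht)) (continuous_const.mul (h.continuous_v ht)),
    fourierCoef_sub (h.continuous_u hs.1) (h.continuous_u ht), fourierCoef_const_mul] at h1
  rwa [Complex.real_smul]

/-- The weak equation is tested with the mode of frequency `-l`, on which ∂_xx - 1 acts as
multiplication by -δ_l². -/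
lemma IsSolution.hasDerivWithinAt_fourierCoef_v (h : IsSolution a b p ε S u₀ u₁ u v) (hab : a < b)
    {t : ℝ} (ht : t ∈ Set.Icc 0 S) (l : ℤ) :
    HasDerivWithinAt (fun s => fourierCoef a b (v s) l)
      (-((symbol a b l ^ 2 : ℝ) : ℂ) * fourierCoef a b (u t) l
        - ((ε ^ (2 * p) : ℝ) : ℂ) * fourierCoef a b (fun x => powerNonlin p (u t x)) l)
      (Set.Icc 0 S) t := by
  have h1 := (h.equation (mode a b (-l)) (contDiff_mode _) (periodic_mode hab _) t ht).const_mul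
    (((1 / (b - a) : ℝ) : ℂ))
  simp only [fourierCoef_eq]
  refine h1.congr_deriv ?_
  have hu := h.continuous_u ht
  have i1 : IntervalIntegrable (fun x => u t x * mode a b (-l) x) volume a b :=
    (hu.mul (continuous_mode _)).intervalIntegrable _ _
  have i2 : IntervalIntegrable (fun x => powerNonlin p (u t x) * mode a b (-l) x) volume a b :=
    (((continuous_powerNonlin p).comp hu).mul (continuous_mode _)).intervalIntegrable _ _
  have e : ∀ x, u t x * deriv (deriv (mode a b (-l))) x - u t x * mode a b (-l) x
      - ((ε ^ (2 * p) : ℝ) : ℂ) * powerNonlin p (u t x) * mode a b (-l) x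
      = -((symbol a b l ^ 2 : ℝ) : ℂ) * (u t x * mode a b (-l) x)
        - ((ε ^ (2 * p) : ℝ) : ℂ) * (powerNonlin p (u t x) * mode a b (-l) x) := by
    intro x
    rw [deriv_deriv_mode, symbol_sq, waveNumber_neg]; push_cast; ring
  simp only [e]
  rw [intervalIntegral.integral_sub (i1.const_mul _) (i2.const_mul _),
    intervalIntegral.integral_const_mul, intervalIntegral.integral_const_mul]
  ring

/-- A solution of the Klein-Gordon equation in Fourier space, with coefficient `e` of the
nonlinearity and bounds in `H^(m+1) × H^m`. -/
structure RegularSolution (a b : ℝ) (p m : ℕ) (e S M : ℝ) (u v : ℝ → ℝ → ℂ) : Prop where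
  continuous_u : ∀ t ∈ Set.Icc 0 S, Continuous (u t)
  hasSum_u : ∀ t ∈ Set.Icc 0 S, ∀ x,
    HasSum (fun l => fourierCoef a b (u t) l * mode a b l x) (u t x)
  hasSum_v : ∀ t ∈ Set.Icc 0 S, ∀ x,
    HasSum (fun l => fourierCoef a b (v t) l * mode a b l x) (v t x)
  continuous_v : ∀ t ∈ Set.Icc 0 S, Continuous (v t)
  deriv_u : ∀ t ∈ Set.Icc 0 S, ∀ l, HasDerivWithinAt (fun s => fourierCoef a b (u s) l)
    (fourierCoef a b (v t) l) (Set.Icc 0 S) t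
  deriv_v : ∀ t ∈ Set.Icc 0 S, ∀ l, HasDerivWithinAt (fun s => fourierCoef a b (v s) l)
    (-((symbol a b l ^ 2 : ℝ) : ℂ) * fourierCoef a b (u t) l
        - (e : ℂ) * fourierCoef a b (fun x => powerNonlin p (u t x)) l) (Set.Icc 0 S) t
  bound_u : ∀ t ∈ Set.Icc 0 S, ∀ F : Finset ℤ,
    ∑ l ∈ F, symbol a b l ^ (2 * (m + 1)) * ‖fourierCoef a b (u t) l‖ ^ 2 ≤ M ^ 2
  bound_v : ∀ t ∈ Set.Icc 0 S, ∀ F : Finset ℤ,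
    ∑ l ∈ F, symbol a b l ^ (2 * m) * ‖fourierCoef a b (v t) l‖ ^ 2 ≤ M ^ 2

lemma sum_norm_le_of_bound (hab : a < b) {s : ℕ} (hs : 1 ≤ s) {c : ℤ → ℂ} {M : ℝ} (hM : 0 ≤ M)
    (hc : ∀ F : Finset ℤ, ∑ l ∈ F, symbol a b l ^ (2 * s) * ‖c l‖ ^ 2 ≤ M ^ 2) (F : Finset ℤ) :
    ∑ l ∈ F, ‖c l‖ ≤ embConst a b * M := by
  refine (sum_norm_le_embConst_mul hab F c).trans
    (mul_le_mul_of_nonneg_left ?_ (embConst_nonneg a b))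
  rw [l2_le_iff hM]
  refine (Finset.sum_le_sum fun l _ => ?_).trans (hc F)
  rw [norm_mul, Complex.norm_real, Real.norm_of_nonneg (symbol_pos l).le, mul_pow]
  gcongr
  · exact one_le_symbol l
  · omega

lemma hasSum_of_bound (hab : a < b) {s : ℕ} (hs : 1 ≤ s) {w : ℝ → ℂ} (hw : Continuous w)
    (hp : Function.Periodic w (b - a)) {M : ℝ} (hM : 0 ≤ M)
    (hc : ∀ F : Finset ℤ, ∑ l ∈ F, symbol a b l ^ (2 * s) * ‖fourierCoef a b w l‖ ^ 2 ≤ M ^ 2)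
    (x : ℝ) : HasSum (fun l => fourierCoef a b w l * mode a b l x) (w x) :=
  hasSum_fourierCoef_mul_mode hab hw hp
    (summable_of_sum_le (fun _ => norm_nonneg _) (sum_norm_le_of_bound hab hs hM hc)) x

lemma IsSolution.regularSolution (h : IsSolution a b p ε S u₀ u₁ u v) (hab : a < b) (hS : 0 < S)
    {m : ℕ} (hm : 1 ≤ m) {M : ℝ} (hM : 0 ≤ M)
    (hu : linftySobolevNorm a b S (m + 1) u ≤ ENNReal.ofReal M)
    (hv : linftySobolevNorm a b S m v ≤ ENNReal.ofReal M) :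
    RegularSolution a b p m (ε ^ (2 * p)) S M u v := by
  have bu : ∀ t ∈ Set.Icc 0 S, ∀ F : Finset ℤ,
      ∑ l ∈ F, symbol a b l ^ (2 * (m + 1)) * ‖fourierCoef a b (u t) l‖ ^ 2 ≤ M ^ 2 := fun t ht =>
    sum_le_of_linftySobolevNorm_le hS
      (fun l t ht => (h.hasDerivWithinAt_fourierCoef_u hab ht l).continuousWithinAt) hu hM ht
  have bv : ∀ t ∈ Set.Icc 0 S, ∀ F : Finset ℤ,
      ∑ l ∈ F, symbol a b l ^ (2 * m) * ‖fourierCoef a b (v t) l‖ ^ 2 ≤ M ^ 2 := fun t ht =>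
    sum_le_of_linftySobolevNorm_le hS
      (fun l t ht => (h.hasDerivWithinAt_fourierCoef_v hab ht l).continuousWithinAt) hv hM ht
  exact
    { continuous_u := fun t ht => h.continuous_u ht
      continuous_v := fun t ht => h.continuous_v ht
      hasSum_u := fun t ht => hasSum_of_bound hab (by omega) (h.continuous_u ht) (h.periodic t ht) hM
        (bu t ht)
      hasSum_v := fun t ht => hasSum_of_bound hab hm (h.continuous_v ht) (h.periodic_v hS ht) hM
        (bv t ht)
      deriv_u := fun t ht => h.hasDerivWithinAt_fourierCoef_u hab ht
      deriv_v := fun t ht => h.hasDerivWithinAt_fourierCoef_v hab ht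
      bound_u := bu
      bound_v := bv }

end Solution

/-! ### The exact solution in twisted variables. -/

section Twisted

variable {a b : ℝ} {p m : ℕ} {e S M : ℝ} {u v : ℝ → ℝ → ℂ}

/-- The Fourier coefficients of `exp (∓ i t ⟨∇⟩) η_±(t)`, where `η_± = u ∓ i ⟨∇⟩⁻¹ v`. -/
noncomputable def twist (a b : ℝ) (u v : ℝ → ℝ → ℂ) (t : ℝ) (σ : Bool) (l : ℤ) : ℂ :=
  cis (-(sg σ * symbol a b l * t)) *
    (fourierCoef a b (u t) l - Complex.I * sg σ / symbol a b l * fourierCoef a b (v t) l)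

/-- The Fourier coefficients of the nonlinearity. -/
noncomputable def forceCoef (a b : ℝ) (p : ℕ) (u : ℝ → ℝ → ℂ) (t : ℝ) (l : ℤ) : ℂ :=
  fourierCoef a b (fun x => powerNonlin p (u t x)) l

lemma hasDerivAt_cis_neg_mul (ω t : ℝ) :
    HasDerivAt (fun s : ℝ => cis (-(ω * s))) (-(Complex.I * ω) * cis (-(ω * t))) t := by
  have := hasDerivAt_cis_mul (-ω) t
  simp only [neg_mul] at this
  exact this.congr_deriv (by push_cast; ring)

lemma sg_sq_complex (σ : Bool) : ((sg σ : ℝ) : ℂ) ^ 2 = 1 := by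
  rw [sq]; exact_mod_cast sg_mul_self σ

/-- Diagonalising the wave operator and undoing its flow removes the linear part. The remaining
derivative carries the small factor e and the smoothing factor δ_l⁻¹. -/
lemma RegularSolution.hasDerivWithinAt_twist (h : RegularSolution a b p m e S M u v) {t : ℝ}
    (ht : t ∈ Set.Icc 0 S) (σ : Bool) (l : ℤ) :
    HasDerivWithinAt (fun s => twist a b u v s σ l)
      (Complex.I * sg σ * e / symbol a b l *
        (cis (-(sg σ * symbol a b l * t)) * forceCoef a b p u t l)) (Set.Icc 0 S) t := by
  have h1 := (hasDerivAt_cis_neg_mul (sg σ * symbol a b l) t).hasDerivWithinAt (s := Set.Icc 0 S)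
  have h2 := (h.deriv_u t ht l).sub ((h.deriv_v t ht l).const_mul (Complex.I * sg σ / symbol a b l))
  refine (h1.mul h2).congr_deriv ?_
  simp only [Pi.sub_apply, forceCoef]
  have hd := symbol_ne (a := a) (b := b) l
  set d := (symbol a b l : ℂ) with hd'
  have hs := sg_sq_complex σ
  have hI := Complex.I_sq
  push_cast
  rw [← hd']
  set c := cis (-(sg σ * symbol a b l * t))
  set s := ((sg σ : ℝ) : ℂ)
  set U := fourierCoef a b (u t) l
  set V := fourierCoef a b (v t) l
  set f := fourierCoef a b (fun x => powerNonlin p (u t x)) l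
  field_simp
  linear_combination (c * V * d) * (s ^ 2 * hI - hs)

lemma RegularSolution.l2_symbol_pow_mul_twist_le (h : RegularSolution a b p m e S M u v) (hM : 0 ≤ M)
    {t : ℝ} (ht : t ∈ Set.Icc 0 S) (σ : Bool) (F : Finset ℤ) :
    l2 F (fun l => (symbol a b l : ℂ) ^ (m + 1) * twist a b u v t σ l) ≤ 2 * M := by
  have h1 : l2 F (fun l => (symbol a b l : ℂ) ^ (m + 1) * fourierCoef a b (u t) l) ≤ M := by
    rw [l2_le_iff hM]
    refine le_trans (le_of_eq (Finset.sum_congr rfl fun l _ => ?_)) (h.bound_u t ht F)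
    rw [norm_mul, norm_pow, Complex.norm_real, Real.norm_of_nonneg (symbol_pos l).le]
    ring
  have h2 : l2 F (fun l => (symbol a b l : ℂ) ^ m * fourierCoef a b (v t) l) ≤ M := by
    rw [l2_le_iff hM]
    refine le_trans (le_of_eq (Finset.sum_congr rfl fun l _ => ?_)) (h.bound_v t ht F)
    rw [norm_mul, norm_pow, Complex.norm_real, Real.norm_of_nonneg (symbol_pos l).le]
    ring
  have h3 : l2 F (fun l => (symbol a b l : ℂ) ^ (m + 1) * twist a b u v t σ l)
      = l2 F (fun l => (symbol a b l : ℂ) ^ (m + 1) * fourierCoef a b (u t) l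
        - (Complex.I * sg σ) * ((symbol a b l : ℂ) ^ m * fourierCoef a b (v t) l)) := by
    refine l2_congr fun l _ => ?_
    rw [twist, mul_left_comm, norm_mul, norm_cis, one_mul]
    congr 1
    have := symbol_ne (a := a) (b := b) l
    field_simp
    ring
  rw [h3]
  refine (l2_sub_le _ _ _).trans ?_
  rw [l2_smul, norm_mul, Complex.norm_I, Complex.norm_real, Real.norm_eq_abs, abs_sg]
  linarith

lemma norm_le_norm_symbol_mul (l : ℤ) (z : ℂ) : ‖z‖ ≤ ‖(symbol a b l : ℂ) * z‖ := by
  rw [norm_mul, Complex.norm_real, Real.norm_of_nonneg (symbol_pos l).le]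
  exact le_mul_of_one_le_left (norm_nonneg _) (one_le_symbol l)

/-- Cauchy–Schwarz against δ_l⁻¹ leaves two symbols on the coefficient, which are available because
m + 1 ≥ 2. The sum runs over both signs, and the leading factor 2 matches the halves in `linFlow`.
-/
lemma RegularSolution.sum_symbol_mul_norm_twist_le (h : RegularSolution a b p m e S M u v)
    (hab : a < b) (hm : 1 ≤ m) (hM : 0 ≤ M) {t : ℝ} (ht : t ∈ Set.Icc 0 S) (B : Finset ℤ) :
    ∑ q ∈ (Finset.univ : Finset Bool) ×ˢ B, symbol a b q.2 * ‖twist a b u v t q.1 q.2‖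
      ≤ 2 * (2 * embConst a b * M) := by
  have h1 : ∀ σ : Bool, ∑ l ∈ B, symbol a b l * ‖twist a b u v t σ l‖ ≤ 2 * embConst a b * M := by
    intro σ
    have h2 := sum_norm_le_embConst_mul hab B fun l => (symbol a b l : ℂ) * twist a b u v t σ l
    have h3 : l2 B (fun l => (symbol a b l : ℂ) * ((symbol a b l : ℂ) * twist a b u v t σ l))
        ≤ 2 * M := by
      refine le_trans (l2_mono fun l _ => ?_) (h.l2_symbol_pow_mul_twist_le hM ht σ B)
      rw [norm_mul, norm_mul, ← mul_assoc, norm_mul, norm_pow, Complex.norm_real,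
        Real.norm_of_nonneg (symbol_pos l).le, ← sq]
      gcongr
      · exact one_le_symbol l
      · omega
    simp only [norm_mul, Complex.norm_real, Real.norm_of_nonneg (symbol_pos _).le] at h2
    calc _ ≤ _ := h2
      _ ≤ embConst a b * (2 * M) := mul_le_mul_of_nonneg_left h3 (embConst_nonneg a b)
      _ = _ := by ring
  rw [Finset.sum_product, Fintype.sum_bool]
  linarith [h1 true, h1 false]

lemma RegularSolution.sum_norm_twist_le (h : RegularSolution a b p m e S M u v)
    (hab : a < b) (hm : 1 ≤ m) (hM : 0 ≤ M) {t : ℝ} (ht : t ∈ Set.Icc 0 S) (B : Finset ℤ) :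
    ∑ q ∈ (Finset.univ : Finset Bool) ×ˢ B, ‖twist a b u v t q.1 q.2‖
      ≤ 2 * (2 * embConst a b * M) :=
  (Finset.sum_le_sum fun _ _ => le_mul_of_one_le_left (norm_nonneg _) (one_le_symbol _)).trans
    (h.sum_symbol_mul_norm_twist_le hab hm hM ht B)

lemma RegularSolution.norm_linFlow_twist_le (h : RegularSolution a b p m e S M u v)
    (hab : a < b) (hm : 1 ≤ m) (hM : 0 ≤ M) {t : ℝ} (ht : t ∈ Set.Icc 0 S) (B : Finset ℤ) (s x : ℝ) :
    ‖linFlow a b B (twist a b u v t) s x‖ ≤ 2 * embConst a b * M := by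
  refine (norm_linFlow_le _ _ _ _).trans ?_
  rw [← Finset.sum_div]
  linarith [h.sum_norm_twist_le hab hm hM ht B]

lemma norm_le_of_hasSum {c : ℤ → ℂ} {x : ℝ} {z : ℂ} {C : ℝ}
    (hz : HasSum (fun l => c l * mode a b l x) z) (hC : ∀ F : Finset ℤ, ∑ l ∈ F, ‖c l‖ ≤ C) :
    ‖z‖ ≤ C := by
  refine le_of_tendsto hz.norm (Filter.Eventually.of_forall fun F => ?_)
  refine (norm_sum_le _ _).trans ((Finset.sum_le_sum fun l _ => ?_).trans (hC F))
  rw [norm_mul, norm_mode, mul_one]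

lemma RegularSolution.norm_u_le (h : RegularSolution a b p m e S M u v)
    (hab : a < b) (hM : 0 ≤ M) {t : ℝ} (ht : t ∈ Set.Icc 0 S) (x : ℝ) :
    ‖u t x‖ ≤ 2 * embConst a b * M := by
  refine (norm_le_of_hasSum (h.hasSum_u t ht x)
    (sum_norm_le_of_bound hab (by omega) hM (h.bound_u t ht))).trans ?_
  nlinarith [mul_nonneg (embConst_nonneg a b) hM]

lemma RegularSolution.l2_u_le (h : RegularSolution a b p m e S M u v)
    (hM : 0 ≤ M) {t : ℝ} (ht : t ∈ Set.Icc 0 S) (F : Finset ℤ) :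
    l2 F (fourierCoef a b (u t)) ≤ M := by
  rw [l2_le_iff hM]
  refine (Finset.sum_le_sum fun l _ => ?_).trans (h.bound_u t ht F)
  exact le_mul_of_one_le_left (sq_nonneg _) (one_le_pow₀ (one_le_symbol l))

lemma fourierCoef_zero (l : ℤ) : fourierCoef a b (fun _ => 0) l = 0 := by simp [fourierCoef]

/-- The Lipschitz constant of the nonlinearity on the ball of radius `R`. -/
noncomputable def lipConst (p : ℕ) (R : ℝ) : ℝ := (2 * p + 1) * R ^ (2 * p)

lemma lipConst_nonneg (p : ℕ) {R : ℝ} (hR : 0 ≤ R) : 0 ≤ lipConst p R := by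
  unfold lipConst; positivity

/-- Lipschitz continuity of the nonlinearity in terms of Fourier coefficients. -/
lemma l2_fourierCoef_powerNonlin_sub_le (hab : a < b) (p : ℕ) {w₁ w₂ : ℝ → ℂ} (h₁ : Continuous w₁)
    (h₂ : Continuous w₂) {R D : ℝ} (hR₁ : ∀ x, ‖w₁ x‖ ≤ R) (hR₂ : ∀ x, ‖w₂ x‖ ≤ R) (hD : 0 ≤ D)
    (hw : ∀ F, l2 F (fun l => fourierCoef a b w₁ l - fourierCoef a b w₂ l) ≤ D) (F : Finset ℤ) :
    l2 F (fun l => fourierCoef a b (fun x => powerNonlin p (w₁ x)) l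
      - fourierCoef a b (fun x => powerNonlin p (w₂ x)) l) ≤ lipConst p R * D := by
  have hR : 0 ≤ R := (norm_nonneg _).trans (hR₁ 0)
  rw [l2_le_iff (mul_nonneg (lipConst_nonneg p hR) hD)]
  exact sum_sq_fourierCoef_le hab ((continuous_powerNonlin p).comp h₁)
    ((continuous_powerNonlin p).comp h₂) h₁ h₂
    (fun x => norm_powerNonlin_sub_le p (hR₁ x) (hR₂ x)) (fun F => (l2_le_iff hD).1 (hw F)) F

lemma RegularSolution.l2_forceCoef_le (h : RegularSolution a b p m e S M u v)
    (hab : a < b) (hM : 0 ≤ M) {R : ℝ} (hR : 2 * embConst a b * M ≤ R) {t : ℝ}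
    (ht : t ∈ Set.Icc 0 S) (F : Finset ℤ) :
    l2 F (forceCoef a b p u t) ≤ lipConst p R * M := by
  have hR0 : 0 ≤ R := le_trans (by have := embConst_nonneg a b; positivity) hR
  have := l2_fourierCoef_powerNonlin_sub_le hab p (h.continuous_u t ht) (continuous_const (y := 0))
    (fun x => (h.norm_u_le hab hM ht x).trans hR) (fun _ => by simpa using hR0) hM
    (fun F => by simpa only [fourierCoef_zero, sub_zero] using h.l2_u_le hM ht F) F
  simp only [powerNonlin_zero, fourierCoef_zero, sub_zero] at this
  exact this

/-- Untwisting at the same time leaves (η₊ + η₋)/2 = u, the contributions of v cancelling. -/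
lemma linCoef_twist_self (B : Finset ℤ) (t : ℝ) {l : ℤ} (hl : l ∈ B) :
    linCoef a b B (twist a b u v t) t l = fourierCoef a b (u t) l := by
  rw [linCoef, if_pos hl, Fintype.sum_bool]
  simp only [twist, sg_true, sg_false]
  have h1 := cis_neg_mul (1 * symbol a b l * t)
  have h2 := cis_neg_mul (-1 * symbol a b l * t)
  push_cast
  linear_combination ((fourierCoef a b (u t) l
      - Complex.I * 1 / symbol a b l * fourierCoef a b (v t) l) / 2) * h1
    + ((fourierCoef a b (u t) l
      - Complex.I * (-1) / symbol a b l * fourierCoef a b (v t) l) / 2) * h2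

/-- The Fourier coefficients of the nonlinearity are absolutely summable. -/
lemma RegularSolution.sum_norm_forceCoef_le (h : RegularSolution a b p m e S M u v)
    (hab : a < b) (hm : 1 ≤ m) (hM : 0 ≤ M) {R : ℝ} (hR : 2 * embConst a b * M ≤ R) {t : ℝ}
    (ht : t ∈ Set.Icc 0 S) (F : Finset ℤ) :
    ∑ l ∈ F, ‖forceCoef a b p u t l‖ ≤ R ^ (2 * p + 1) := by
  have hR0 : 0 ≤ R := le_trans (by have := embConst_nonneg a b; positivity) hR
  have hL := lipConst_nonneg p hR0
  refine le_of_forall_pos_le_add fun η hη => ?_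
  -- The absolute bound is known only for finite linear flows, so u is approximated in ℓ² by its
  -- part on a finite set `G`. Each coefficient of the force then errs by at most `lipConst p R *
  -- ρ`, and `ρ` makes the total over `F` at most `η`.
  set ρ := η / (F.card * lipConst p R + 1) with hρ
  have hρ0 : 0 < ρ := by positivity
  have hs : Summable fun l => ‖fourierCoef a b (u t) l‖ ^ 2 :=
    summable_of_sum_le (fun _ => sq_nonneg _)
      fun F => (l2_le_iff hM).1 (h.l2_u_le hM ht F)
  obtain ⟨G, hG⟩ := summable_iff_vanishing_norm.1 hs (ρ ^ 2) (by positivity)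
  have hdiff : ∀ F, l2 F (fun l => fourierCoef a b (u t) l
      - fourierCoef a b (linFlow a b G (twist a b u v t) t) l) ≤ ρ := by
    intro F
    rw [l2_le_iff hρ0.le, ← Finset.sum_sdiff (Finset.inter_subset_left (s₁ := F) (s₂ := G)),
      Finset.sdiff_inter_self_left]
    have h0 : ∑ l ∈ F ∩ G, ‖fourierCoef a b (u t) l
        - fourierCoef a b (linFlow a b G (twist a b u v t) t) l‖ ^ 2 = 0 :=
      Finset.sum_eq_zero fun l hl => by
        rw [fourierCoef_linFlow hab, linCoef_twist_self G t (Finset.mem_inter.1 hl).2]; simp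
    rw [h0, add_zero]
    refine le_trans (le_of_eq (Finset.sum_congr rfl fun l hl => ?_))
      ((le_abs_self _).trans (hG (F \ G) Finset.sdiff_disjoint).le)
    rw [fourierCoef_linFlow hab, linCoef, if_neg (Finset.mem_sdiff.1 hl).2, sub_zero]
  have h1 := l2_fourierCoef_powerNonlin_sub_le hab p (h.continuous_u t ht)
    (continuous_linFlow G (twist a b u v t) t) (fun x => (h.norm_u_le hab hM ht x).trans hR)
    (fun x => (h.norm_linFlow_twist_le hab hm hM ht G t x).trans hR) hρ0.le hdiff
  have h2 : ∀ l ∈ F, ‖forceCoef a b p u t l‖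
      ≤ ‖nlCoef a b p G (twist a b u v t) t l‖ + lipConst p R * ρ := by
    intro l _
    have h3 := h1 {l}
    rw [l2, Finset.sum_singleton, Real.sqrt_sq (norm_nonneg _),
      fourierCoef_powerNonlin_linFlow hab] at h3
    exact (norm_le_norm_add_norm_sub' _ _).trans (add_le_add le_rfl h3)
  refine (Finset.sum_le_sum h2).trans ?_
  rw [Finset.sum_add_distrib, Finset.sum_const, nsmul_eq_mul]
  refine add_le_add (sum_norm_nlCoef_le p G _ t F
    ((h.sum_norm_twist_le hab hm hM ht G).trans (by linarith))) ?_
  rw [hρ, ← mul_assoc, mul_div_assoc', div_le_iff₀ (by positivity)]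
  nlinarith

/-- The twisted variables are Lipschitz continuous in time with a small constant. -/
lemma RegularSolution.sum_symbol_mul_norm_twist_sub_le (h : RegularSolution a b p m e S M u v)
    (hab : a < b) (hm : 1 ≤ m) (hM : 0 ≤ M) (he : 0 ≤ e) {R : ℝ} (hR : 2 * embConst a b * M ≤ R)
    {t₀ t₁ : ℝ} (ht₀ : 0 ≤ t₀) (ht : t₀ ≤ t₁) (ht₁ : t₁ ≤ S) (B : Finset ℤ) :
    ∑ q ∈ (Finset.univ : Finset Bool) ×ˢ B,
      symbol a b q.2 * ‖twist a b u v t₁ q.1 q.2 - twist a b u v t₀ q.1 q.2‖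
      ≤ 2 * (e * R ^ (2 * p + 1) * (t₁ - t₀)) := by
  have hsub : Set.Icc t₀ t₁ ⊆ Set.Icc 0 S := Set.Icc_subset_Icc ht₀ ht₁
  have h1 := sum_norm_sub_le_of_deriv (F := (Finset.univ : Finset Bool) ×ˢ B)
    (y := fun r q => (symbol a b q.2 : ℂ) * twist a b u v r q.1 q.2)
    (y' := fun s q => (symbol a b q.2 : ℂ) * (Complex.I * sg q.1 * e / symbol a b q.2 *
        (cis (-(sg q.1 * symbol a b q.2 * s)) * forceCoef a b p u s q.2)))
    (C := 2 * (e * R ^ (2 * p + 1))) ht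
    (fun q _ s hs => ((h.hasDerivWithinAt_twist (hsub hs) q.1 q.2).mono hsub).const_mul _) ?_
  · simp only [← mul_sub, norm_mul, Complex.norm_real, Real.norm_of_nonneg (symbol_pos _).le] at h1
    exact h1.trans_eq (by ring)
  · intro s hs
    have h2 : ∀ q ∈ (Finset.univ : Finset Bool) ×ˢ B, ‖(symbol a b q.2 : ℂ) * (Complex.I * sg q.1 * e / symbol a b q.2 *
        (cis (-(sg q.1 * symbol a b q.2 * s)) * forceCoef a b p u s q.2))‖
        = e * ‖forceCoef a b p u s q.2‖ := by
      intro q _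
      have hd := (symbol_pos (a := a) (b := b) q.2)
      simp only [norm_mul, norm_div, Complex.norm_real, Real.norm_eq_abs, abs_sg, Complex.norm_I,
        norm_cis, abs_of_pos hd, abs_of_nonneg he]
      field_simp
    rw [Finset.sum_congr rfl h2, Finset.sum_product, Fintype.sum_bool]
    simp only [← Finset.mul_sum]
    have h3 := mul_le_mul_of_nonneg_left (h.sum_norm_forceCoef_le hab hm hM hR (hsub hs) B) he
    linarith

/-- This is |sin x| ≤ |x|. It expresses the cancellation between the two signs that compensates
δ_l⁻¹ by a power of the elapsed time. -/
lemma norm_cis_sub_cis_neg_le (x : ℝ) : ‖cis x - cis (-x)‖ ≤ 2 * |x| := by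
  have h := cis_sub_cis 1 (-x) (2 * x)
  rw [show (1 : ℝ) * (-x + 2 * x) = x by ring, show (1 : ℝ) * -x = -x by ring,
    show (1 : ℝ) * (2 * x) / 2 = x by ring] at h
  rw [h, norm_mul, norm_cis, one_mul, norm_mul, norm_mul, Complex.norm_I, Complex.norm_ofNat,
    Complex.norm_real, Real.norm_eq_abs, mul_one]
  exact mul_le_mul_of_nonneg_left Real.abs_sin_le_abs zero_le_two

lemma l2_ite_le (F B : Finset ℤ) (c d : ℤ → ℂ) :
    l2 F c ≤ l2 (F ∩ B) (fun l => c l - d l) + l2 F (fun l => if l ∈ B then d l else c l) := by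
  have h : l2 F (fun l => if l ∈ B then c l - d l else 0) ≤ l2 (F ∩ B) (fun l => c l - d l) := by
    rw [l2_le_iff (l2_nonneg _ _), l2_sq, ← Finset.sum_filter_add_sum_filter_not F (· ∈ B),
      Finset.filter_mem_eq_inter]
    refine le_of_eq ?_
    rw [Finset.sum_congr rfl fun l hl => by rw [if_pos (Finset.mem_inter.1 hl).2],
      Finset.sum_eq_zero (s := F.filter (· ∉ B)) fun l hl => by
        rw [if_neg (Finset.mem_filter.1 hl).2]; simp, add_zero]
  refine le_trans (le_of_eq (l2_congr fun l _ => ?_)) ((l2_add_le F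
    (fun l => if l ∈ B then c l - d l else 0) fun l => if l ∈ B then d l else c l).trans
    (add_le_add h le_rfl))
  split_ifs <;> simp

/-- High frequencies are small. -/
lemma l2_tail_le {s : ℕ} {c : ℤ → ℂ} {M Λ : ℝ} (hΛ : 0 < Λ) {B : Finset ℤ}
    (hB : ∀ l ∉ B, Λ ≤ symbol a b l) (F : Finset ℤ)
    (hc : l2 F (fun l => (symbol a b l : ℂ) ^ s * c l) ≤ M) :
    l2 F (fun l => if l ∈ B then 0 else c l) ≤ M / Λ ^ s := by
  rw [le_div_iff₀ (by positivity), mul_comm]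
  have h1 := l2_smul F ((Λ : ℂ) ^ s) fun l => if l ∈ B then 0 else c l
  rw [norm_pow, Complex.norm_real, Real.norm_of_nonneg hΛ.le] at h1
  rw [← h1]
  refine (l2_mono fun l _ => ?_).trans hc
  split_ifs with hl
  · rw [mul_zero, norm_zero]
    exact norm_nonneg _
  · rw [norm_mul, norm_mul, norm_pow, norm_pow, Complex.norm_real, Complex.norm_real,
      Real.norm_of_nonneg hΛ.le, Real.norm_of_nonneg (symbol_pos l).le]
    gcongr
    exact hB l hl

/-- On a short time interval the solution is close to a linear flow on low frequencies. -/
lemma RegularSolution.l2_sub_linCoef_le (h : RegularSolution a b p m e S M u v)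
    (hab : a < b) (hM : 0 ≤ M) (he : 0 ≤ e) {R : ℝ} (hR : 2 * embConst a b * M ≤ R)
    {t₀ s τ : ℝ} (ht₀ : 0 ≤ t₀) (ht : t₀ ≤ s) (hτ : s - t₀ ≤ τ) (hs : s ≤ S) {B : Finset ℤ} {Λ : ℝ}
    (hΛ : 0 < Λ) (hB : ∀ l ∉ B, Λ ≤ symbol a b l) (F : Finset ℤ) :
    l2 F (fun l => fourierCoef a b (u s) l - linCoef a b B (twist a b u v t₀) s l)
      ≤ e * τ ^ 2 * (lipConst p R * M) + M / Λ ^ (m + 1) := by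
  have hsub : Set.Icc t₀ s ⊆ Set.Icc 0 S := Set.Icc_subset_Icc ht₀ hs
  have hR0 : 0 ≤ R := le_trans (by have := embConst_nonneg a b; positivity) hR
  have hτ0 : 0 ≤ τ := (sub_nonneg.2 ht).trans hτ
  have hLM : 0 ≤ lipConst p R * M := mul_nonneg (lipConst_nonneg p hR0) hM
  -- The output time `s` is fixed and only the time `r` of the coefficients varies: `r = s` gives
  -- the solution, `r = t₀` the linear flow issued from `t₀`.
  have h1 := l2_sub_le_of_deriv (F := F ∩ B)
    (y := fun r l => ∑ σ : Bool, twist a b u v r σ l / 2 * cis (sg σ * symbol a b l * s))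
    (y' := fun r l => ∑ σ : Bool, (Complex.I * sg σ * e / symbol a b l *
        (cis (-(sg σ * symbol a b l * r)) * forceCoef a b p u r l)) / 2
          * cis (sg σ * symbol a b l * s)) (C := e * τ * (lipConst p R * M)) ht
    (fun l _ r hr => HasDerivWithinAt.fun_sum fun σ _ =>
      (((h.hasDerivWithinAt_twist (hsub hr) σ l).mono hsub).div_const 2).mul_const _) ?_
  · have h2 : l2 (F ∩ B) (fun l => fourierCoef a b (u s) l - linCoef a b B (twist a b u v t₀) s l)
        ≤ e * τ ^ 2 * (lipConst p R * M) := by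
      calc _ = _ := l2_congr fun l hl => by
            have hl' := (Finset.mem_inter.1 hl).2
            rw [← linCoef_twist_self (v := v) B s hl', linCoef, linCoef, if_pos hl', if_pos hl']
        _ ≤ _ := h1
        _ ≤ e * τ * (lipConst p R * M) * τ := by gcongr
        _ = _ := by ring
    refine (l2_ite_le F B _ fun _ => 0).trans ?_
    simp only [sub_zero]
    refine add_le_add h2 ?_
    have hsS : s ∈ Set.Icc 0 S := ⟨ht₀.trans ht, hs⟩
    have h3 : l2 F (fun l => (symbol a b l : ℂ) ^ (m + 1) * fourierCoef a b (u s) l) ≤ M := by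
      rw [l2_le_iff hM]
      refine le_trans (le_of_eq (Finset.sum_congr rfl fun l _ => ?_)) (h.bound_u s hsS F)
      rw [norm_mul, norm_pow, Complex.norm_real, Real.norm_of_nonneg (symbol_pos l).le]
      ring
    refine le_trans (le_of_eq (l2_congr fun l _ => ?_)) (l2_tail_le hΛ hB F h3)
    split_ifs with hl
    · rfl
    · rw [linCoef, if_neg hl, sub_zero]
  · intro r hr
    have h4 : l2 (F ∩ B) (forceCoef a b p u r) ≤ lipConst p R * M :=
      h.l2_forceCoef_le hab hM hR (hsub hr) _
    refine le_trans (l2_mono (d := fun l => ((e * τ : ℝ) : ℂ) * forceCoef a b p u r l) fun l _ => ?_) ?_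
    · rw [Fintype.sum_bool, sg_true, sg_false]
      have hd := symbol_pos (a := a) (b := b) l
      set θ := symbol a b l * (s - r) with hθ
      -- The two signs add up to a multiple of e sin(θ)/δ_l, which is at most e(s - r). This gains a
      -- factor τ over each sign taken separately, uniformly in the frequency.
      have e1 : Complex.I * ((1 : ℝ) : ℂ) * e / symbol a b l
            * (cis (-(1 * symbol a b l * r)) * forceCoef a b p u r l) / 2 * cis (1 * symbol a b l * s)
          + Complex.I * ((-1 : ℝ) : ℂ) * e / symbol a b l
            * (cis (-(-1 * symbol a b l * r)) * forceCoef a b p u r l) / 2 * cis (-1 * symbol a b l * s)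
          = Complex.I * e / symbol a b l / 2 * forceCoef a b p u r l * (cis θ - cis (-θ)) := by
        have e2 : cis θ = cis (-(1 * symbol a b l * r)) * cis (1 * symbol a b l * s) := by
          rw [← cis_add, hθ]; congr 1; ring
        have e3 : cis (-θ) = cis (-(-1 * symbol a b l * r)) * cis (-1 * symbol a b l * s) := by
          rw [← cis_add, hθ]; congr 1; ring
        rw [e2, e3]; push_cast; ring
      rw [e1]
      have h5 := norm_cis_sub_cis_neg_le θ
      rw [hθ, abs_mul, abs_of_pos hd, abs_of_nonneg (sub_nonneg.2 hr.2), ← hθ] at h5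
      simp only [norm_mul, norm_div, Complex.norm_real, Real.norm_eq_abs, Complex.norm_I, Complex.norm_ofNat,
        abs_of_pos hd, abs_of_nonneg he, abs_of_nonneg hτ0, one_mul]
      calc _ ≤ e / symbol a b l / 2 * ‖forceCoef a b p u r l‖ * (2 * (symbol a b l * (s - r))) := by gcongr
        _ = e * (s - r) * ‖forceCoef a b p u r l‖ := by field_simp
        _ ≤ _ := by
          gcongr
          linarith [hr.1]
    · rw [l2_smul, Complex.norm_real, Real.norm_of_nonneg (mul_nonneg he hτ0)]
      gcongr

/-- The increment of the twisted variables over a time step. -/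
lemma RegularSolution.l2_twist_sub_le (h : RegularSolution a b p m e S M u v)
    (hab : a < b) (hm : 1 ≤ m) (hM : 0 ≤ M) (he : 0 ≤ e) {R : ℝ} (hR : 2 * embConst a b * M ≤ R)
    {t τ : ℝ} (ht : 0 ≤ t) (hτ : 0 ≤ τ) (hs : t + τ ≤ S) {B : Finset ℤ} {Λ : ℝ}
    (hΛ : 0 < Λ) (hB : ∀ l ∉ B, Λ ≤ symbol a b l) (σ : Bool) (F : Finset ℤ) :
    l2 F (fun l => (symbol a b l : ℂ) * (twist a b u v (t + τ) σ l - twist a b u v t σ l)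
      - Complex.I * sg σ * e * (nlPrim a b p B (twist a b u v t) σ (t + τ) l
          - nlPrim a b p B (twist a b u v t) σ t l))
      ≤ e * τ * (lipConst p R * (e * τ ^ 2 * (lipConst p R * M) + M / Λ ^ (m + 1))) := by
  have hsub : Set.Icc t (t + τ) ⊆ Set.Icc 0 S := Set.Icc_subset_Icc ht hs
  have hR0 : 0 ≤ R := le_trans (by have := embConst_nonneg a b; positivity) hR
  have htS : t ∈ Set.Icc 0 S := ⟨ht, by linarith⟩
  have hD0 : 0 ≤ e * τ ^ 2 * (lipConst p R * M) + M / Λ ^ (m + 1) := by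
    have := lipConst_nonneg p hR0
    positivity
  set D := e * τ ^ 2 * (lipConst p R * M) + M / Λ ^ (m + 1)
  -- The quantity followed has as its derivative e times the difference of the nonlinearity at u(r)
  -- and at the frozen linear flow, up to unimodular factors; the weight δ_l has cancelled δ_l⁻¹.
  have h1 := l2_sub_le_of_deriv (F := F)
    (y := fun r l => (symbol a b l : ℂ) * twist a b u v r σ l
      - Complex.I * sg σ * e * nlPrim a b p B (twist a b u v t) σ r l)
    (y' := fun r l => (symbol a b l : ℂ) * (Complex.I * sg σ * e / symbol a b l *
        (cis (-(sg σ * symbol a b l * r)) * forceCoef a b p u r l))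
        - Complex.I * sg σ * e * (cis (-(sg σ * symbol a b l * r)) *
          nlCoef a b p B (twist a b u v t) r l)) (C := e * (lipConst p R * D))
    (by linarith : t ≤ t + τ)
    (fun l _ r hr => (((h.hasDerivWithinAt_twist (hsub hr) σ l).mono hsub).const_mul _).sub
      ((hasDerivAt_nlPrim p B (twist a b u v t) σ r l).hasDerivWithinAt.const_mul _)) ?_
  · calc _ = _ := l2_congr fun l _ => by congr 1; ring
      _ ≤ _ := h1
      _ = _ := by ring
  · intro r hr
    have h2 := l2_fourierCoef_powerNonlin_sub_le hab p (h.continuous_u r (hsub hr))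
      (continuous_linFlow B (twist a b u v t) r) (fun x => (h.norm_u_le hab hM (hsub hr) x).trans hR)
      (fun x => (h.norm_linFlow_twist_le hab hm hM htS B r x).trans hR) hD0
      (fun F => by
        simp only [fourierCoef_linFlow hab]
        exact h.l2_sub_linCoef_le hab hM he hR ht hr.1 (by linarith [hr.2]) (hsub hr).2 hΛ hB F) F
    simp only [fourierCoef_powerNonlin_linFlow hab] at h2
    have h3 : l2 F (fun l => (symbol a b l : ℂ) * (Complex.I * sg σ * e / symbol a b l *
        (cis (-(sg σ * symbol a b l * r)) * forceCoef a b p u r l))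
        - Complex.I * sg σ * e * (cis (-(sg σ * symbol a b l * r)) *
          nlCoef a b p B (twist a b u v t) r l))
        = l2 F (fun l => (e : ℂ) * (forceCoef a b p u r l - nlCoef a b p B (twist a b u v t) r l)) := by
      refine l2_congr fun l _ => ?_
      have hd := symbol_ne (a := a) (b := b) l
      have e1 : (symbol a b l : ℂ) * (Complex.I * sg σ * e / symbol a b l *
          (cis (-(sg σ * symbol a b l * r)) * forceCoef a b p u r l))
          - Complex.I * sg σ * e * (cis (-(sg σ * symbol a b l * r)) *
            nlCoef a b p B (twist a b u v t) r l)
          = Complex.I * sg σ * cis (-(sg σ * symbol a b l * r)) *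
            (e * (forceCoef a b p u r l - nlCoef a b p B (twist a b u v t) r l)) := by
        field_simp
      rw [e1, norm_mul, norm_mul, norm_mul, norm_cis, Complex.norm_I, Complex.norm_real,
        Real.norm_eq_abs, abs_sg, one_mul, one_mul, one_mul]
    rw [h3, l2_smul, Complex.norm_real, Real.norm_of_nonneg he]
    exact mul_le_mul_of_nonneg_left h2 he

end Twisted

/-! ### The numerical method in Fourier space -/

section Scheme

variable {a b : ℝ} {p m N : ℕ} {ε τ : ℝ} {u₀ u₁ : ℝ → ℂ}

/-- The component `η_±` of a pair `(η₊, η₋)`. -/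
def branch {X : Type*} (σ : Bool) (U : X × X) : X := if σ then U.1 else U.2

/-- The twisted discrete Fourier coefficients of the numerical solution. -/
noncomputable def numTwist (a b : ℝ) (p N : ℕ) (ε τ : ℝ) (u₀ u₁ : ℝ → ℂ) (n : ℕ) (σ : Bool) (l : ℤ) : ℂ :=
  cis (-(sg σ * symbol a b l * (n * τ))) * discreteCoef a b N (branch σ (eta a b p N ε τ u₀ u₁ n)) l

lemma discreteCoef_branch_eta (n : ℕ) (σ : Bool) (l : ℤ) :
    discreteCoef a b N (branch σ (eta a b p N ε τ u₀ u₁ n)) l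
      = cis (sg σ * symbol a b l * (n * τ)) * numTwist a b p N ε τ u₀ u₁ n σ l := by
  rw [numTwist, ← mul_assoc, cis_mul_neg, one_mul]

lemma halfStep_eq (σ : Bool) (U : Fin (N + 1) → ℂ) :
    halfStep a b N τ (sg σ) U = sample a b N fun x => ∑ l ∈ freqs N,
      cis (sg σ * symbol a b l * (τ / 2)) * discreteCoef a b N U l * mode a b l x := by
  have : ∀ l, Complex.exp (Complex.I * ((sg σ * (τ * symbol a b l / 2) : ℝ) : ℂ))
      = cis (sg σ * symbol a b l * (τ / 2)) := fun l => by
    rw [cis]; congr 3; ring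
  simp only [halfStep, this]
  rfl

lemma discreteCoef_halfStep (hab : a < b) (hN : 0 < N) (σ : Bool) (U : Fin (N + 1) → ℂ) {l : ℤ}
    (hl : l ∈ freqs N) :
    discreteCoef a b N (halfStep a b N τ (sg σ) U) l
      = cis (sg σ * symbol a b l * (τ / 2)) * discreteCoef a b N U l := by
  rw [halfStep_eq, discreteCoef_trigPoly hab hN subset_rfl _ hl, if_pos hl]

lemma branch_step (σ : Bool) (U : (Fin (N + 1) → ℂ) × (Fin (N + 1) → ℂ)) :
    branch σ (step a b p N ε τ U) = halfStep a b N τ (sg σ) fun j =>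
      halfStep a b N τ (sg σ) (branch σ U) j + (sg σ * (ε ^ (2 * p) * τ : ℝ) : ℂ) *
        nonlinInc a b p N (halfStep a b N τ 1 U.1, halfStep a b N τ (-1) U.2) j := by
  cases σ
  · simp only [branch, step, sg_false, Bool.false_eq_true, if_false]
    congr 1
    funext j
    push_cast; ring
  · simp only [branch, step, sg_true, if_true]
    congr 1
    funext j
    push_cast; ring

/-- The first half step moves the physical time to the midpoint and leaves the twisted coefficients
unchanged. Hence the argument of the nonlinearity is a linear flow. -/
lemma half_sum_halfStep (n : ℕ) (j : Fin (N + 1)) :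
    (halfStep a b N τ 1 (eta a b p N ε τ u₀ u₁ n).1 j
      + halfStep a b N τ (-1) (eta a b p N ε τ u₀ u₁ n).2 j) / 2
      = linFlow a b (freqs N) (numTwist a b p N ε τ u₀ u₁ n) (n * τ + τ / 2) (gridPt a b N j) := by
  have h1 := congrFun (halfStep_eq (a := a) (b := b) (τ := τ) true
    (branch true (eta a b p N ε τ u₀ u₁ n))) j
  have h2 := congrFun (halfStep_eq (a := a) (b := b) (τ := τ) false
    (branch false (eta a b p N ε τ u₀ u₁ n))) j
  rw [show (eta a b p N ε τ u₀ u₁ n).1 = branch true (eta a b p N ε τ u₀ u₁ n) from rfl,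
    show (eta a b p N ε τ u₀ u₁ n).2 = branch false (eta a b p N ε τ u₀ u₁ n) from rfl,
    ← sg_false, ← sg_true, h1, h2]
  simp only [sample]
  rw [← Finset.sum_add_distrib, Finset.sum_div, linFlow_eq]
  refine Finset.sum_congr rfl fun l hl => ?_
  rw [linCoef, if_pos hl, Fintype.sum_bool, discreteCoef_branch_eta, discreteCoef_branch_eta,
    mul_add, mul_add, cis_add, cis_add]
  ring

/-- The discrete Fourier coefficients of the nonlinearity in a step of the method. -/
noncomputable def numForce (a b : ℝ) (p N : ℕ) (ε τ : ℝ) (u₀ u₁ : ℝ → ℂ) (n : ℕ) (l : ℤ) : ℂ :=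
  discreteCoef a b N (sample a b N fun x => powerNonlin p
    (linFlow a b (freqs N) (numTwist a b p N ε τ u₀ u₁ n) (n * τ + τ / 2) x)) l

lemma discreteCoef_nonlinInc (hab : a < b) (hN : 0 < N) (n : ℕ) {l : ℤ} (hl : l ∈ freqs N) :
    discreteCoef a b N (nonlinInc a b p N (halfStep a b N τ 1 (eta a b p N ε τ u₀ u₁ n).1,
      halfStep a b N τ (-1) (eta a b p N ε τ u₀ u₁ n).2)) l
      = Complex.I / symbol a b l * numForce a b p N ε τ u₀ u₁ n l := by
  unfold nonlinInc
  rw [discreteCoef_smul, discreteCoef_multInterp hab hN _ _ hl]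
  dsimp only
  simp only [half_sum_halfStep]
  change _ * (_ * numForce a b p N ε τ u₀ u₁ n l) = _
  push_cast
  ring

/-- The two linear half steps disappear in the twisted variables. One step is the midpoint rule for
the twisted equation with coefficients frozen at the beginning of the step. -/
lemma numTwist_succ (hab : a < b) (hN : 0 < N) (n : ℕ) (σ : Bool) {l : ℤ} (hl : l ∈ freqs N) :
    numTwist a b p N ε τ u₀ u₁ (n + 1) σ l = numTwist a b p N ε τ u₀ u₁ n σ l
      + Complex.I * sg σ * (ε ^ (2 * p) : ℝ) / symbol a b l * (τ *
        (cis (-(sg σ * symbol a b l * (n * τ + τ / 2))) * numForce a b p N ε τ u₀ u₁ n l)) := by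
  have h1 : discreteCoef a b N (branch σ (eta a b p N ε τ u₀ u₁ (n + 1))) l
      = cis (sg σ * symbol a b l * (τ / 2)) * (cis (sg σ * symbol a b l * (τ / 2)) *
        discreteCoef a b N (branch σ (eta a b p N ε τ u₀ u₁ n)) l
        + (sg σ * (ε ^ (2 * p) * τ : ℝ) : ℂ) *
          (Complex.I / symbol a b l * numForce a b p N ε τ u₀ u₁ n l)) := by
    rw [eta, branch_step, discreteCoef_halfStep hab hN σ _ hl, discreteCoef_add,
      discreteCoef_halfStep hab hN σ _ hl, discreteCoef_smul, discreteCoef_nonlinInc hab hN n hl]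
  rw [numTwist, h1, numTwist]
  set w := sg σ * symbol a b l
  have e1 : cis (-(w * ((n + 1 : ℕ) * τ))) * cis (w * (τ / 2)) = cis (-(w * (n * τ + τ / 2))) := by
    rw [← cis_add]; congr 1; push_cast; ring
  have e2 : cis (-(w * (n * τ + τ / 2))) * cis (w * (τ / 2)) = cis (-(w * (n * τ))) := by
    rw [← cis_add]; congr 1; ring
  rw [← mul_assoc, e1, mul_add, ← mul_assoc, e2]
  push_cast
  ring

end Scheme

/-! ### Error recursion -/

section Recursion

variable {a b : ℝ} {p m N : ℕ} {ε τ S M : ℝ} {u₀ u₁ : ℝ → ℂ} {u v : ℝ → ℝ → ℂ}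

/-- The error of the twisted coefficients, weighted by the symbol. -/
noncomputable def errCoef (a b : ℝ) (p N : ℕ) (ε τ : ℝ) (u₀ u₁ : ℝ → ℂ) (u v : ℝ → ℝ → ℂ)
    (n : ℕ) (σ : Bool) (l : ℤ) : ℂ :=
  symbol a b l * (numTwist a b p N ε τ u₀ u₁ n σ l - twist a b u v (n * τ) σ l)

/-- The size of the error in the energy norm. -/
noncomputable def errNorm (a b : ℝ) (p N : ℕ) (ε τ : ℝ) (u₀ u₁ : ℝ → ℂ) (u v : ℝ → ℝ → ℂ)
    (n : ℕ) : ℝ := ∑ σ : Bool, l2 (freqs N) (errCoef a b p N ε τ u₀ u₁ u v n σ)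

/-- The error, modified by the boundary term of the midpoint rule. -/
noncomputable def modErr (a b : ℝ) (p N : ℕ) (B : Finset ℤ) (ε τ : ℝ) (u₀ u₁ : ℝ → ℂ)
    (u v : ℝ → ℝ → ℂ) (n : ℕ) (σ : Bool) (l : ℤ) : ℂ :=
  errCoef a b p N ε τ u₀ u₁ u v n σ l + Complex.I * sg σ * (ε ^ (2 * p) : ℝ) *
    nlBdry a b p B τ (twist a b u v (n * τ)) σ (n * τ) l

/-- The size of the modified error. -/
noncomputable def modErrNorm (a b : ℝ) (p N : ℕ) (B : Finset ℤ) (ε τ : ℝ) (u₀ u₁ : ℝ → ℂ)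
    (u v : ℝ → ℝ → ℂ) (n : ℕ) : ℝ := ∑ σ : Bool, l2 (freqs N) (modErr a b p N B ε τ u₀ u₁ u v n σ)

lemma errNorm_nonneg (n : ℕ) : 0 ≤ errNorm a b p N ε τ u₀ u₁ u v n :=
  Finset.sum_nonneg fun _ _ => l2_nonneg _ _

lemma l2_numTwist_sub_le (n : ℕ) (σ : Bool) :
    l2 (freqs N) (fun l => numTwist a b p N ε τ u₀ u₁ n σ l - twist a b u v (n * τ) σ l)
      ≤ l2 (freqs N) (errCoef a b p N ε τ u₀ u₁ u v n σ) :=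
  l2_mono fun l _ => norm_le_norm_symbol_mul l _

/-- An error of at most `1` in the energy norm costs at most one embedding constant in the supremum.
The Lipschitz constant of the nonlinearity can thus be fixed in advance. -/
lemma norm_linFlow_numTwist_le (hab : a < b) (hm : 1 ≤ m) (hM : 0 ≤ M) {e : ℝ}
    (h : RegularSolution a b p m e S M u v) {n : ℕ} (hn : (n : ℝ) * τ ∈ Set.Icc 0 S)
    (hE : errNorm a b p N ε τ u₀ u₁ u v n ≤ 1) (s x : ℝ) :
    ‖linFlow a b (freqs N) (numTwist a b p N ε τ u₀ u₁ n) s x‖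
      ≤ 2 * embConst a b * M + embConst a b := by
  refine (norm_linFlow_le _ _ _ _).trans ?_
  rw [← Finset.sum_div]
  have h1 := h.sum_norm_twist_le hab hm hM hn (freqs N)
  have h2 : ∑ q ∈ (Finset.univ : Finset Bool) ×ˢ freqs N,
      ‖numTwist a b p N ε τ u₀ u₁ n q.1 q.2 - twist a b u v (n * τ) q.1 q.2‖
      ≤ embConst a b * errNorm a b p N ε τ u₀ u₁ u v n := by
    rw [Finset.sum_product, errNorm, Finset.mul_sum]
    exact Finset.sum_le_sum fun σ _ => sum_norm_le_embConst_mul hab (freqs N) _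
  have h3 := Finset.sum_le_sum fun q (_ : q ∈ (Finset.univ : Finset Bool) ×ˢ freqs N) =>
    norm_le_norm_add_norm_sub' (numTwist a b p N ε τ u₀ u₁ n q.1 q.2)
      (twist a b u v (n * τ) q.1 q.2)
  rw [Finset.sum_add_distrib] at h3
  have h4 := mul_le_mul_of_nonneg_left hE (embConst_nonneg a b)
  have := embConst_nonneg a b
  linarith

lemma l2_linCoef_sub_le {c c' : Bool → ℤ → ℂ} (F : Finset ℤ) {B : Finset ℤ} (s : ℝ) :
    l2 F (fun l => linCoef a b F c s l - linCoef a b B c' s l)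
      ≤ ∑ σ : Bool, (l2 F (fun l => c σ l - c' σ l) + l2 F fun l => if l ∈ B then 0 else c' σ l) / 2 := by
  have h1 : ∀ σ : Bool, l2 F (fun l => (c σ l - if l ∈ B then c' σ l else 0) / 2
      * cis (sg σ * symbol a b l * s))
      ≤ (l2 F (fun l => c σ l - c' σ l) + l2 F fun l => if l ∈ B then 0 else c' σ l) / 2 := by
    intro σ
    have h2 := l2_add_le F (fun l => c σ l - c' σ l) fun l => if l ∈ B then 0 else c' σ l
    have h3 := l2_smul F (1 / 2) fun l => c σ l - if l ∈ B then c' σ l else 0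
    have h4 : l2 F (fun l => c σ l - c' σ l + if l ∈ B then 0 else c' σ l)
        = l2 F (fun l => c σ l - if l ∈ B then c' σ l else 0) :=
      l2_congr fun l _ => by congr 1; split_ifs <;> ring
    calc _ = l2 F (fun l => 1 / 2 * (c σ l - if l ∈ B then c' σ l else 0)) :=
          l2_congr fun l _ => by rw [norm_mul, norm_cis, mul_one]; congr 1; ring
      _ ≤ _ := by
          rw [h3, ← h4]
          norm_num
          linarith
  rw [Fintype.sum_bool]
  refine le_trans (le_of_eq (l2_congr fun l hl => ?_)) ((l2_add_le F _ _).trans (add_le_add (h1 true) (h1 false)))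
  rw [linCoef, linCoef, if_pos hl, Fintype.sum_bool, Fintype.sum_bool]
  congr 1
  split_ifs <;> ring

/-- The error of the nonlinearity in a step of the method. -/
lemma l2_numForce_sub_le (hab : a < b) (hN : 0 < N) (hm : 1 ≤ m) (hM : 0 ≤ M) {e : ℝ}
    (h : RegularSolution a b p m e S M u v) {R : ℝ} (hR : 2 * embConst a b * M + embConst a b ≤ R)
    {n : ℕ} (hn : (n : ℝ) * τ ∈ Set.Icc 0 S) (hE : errNorm a b p N ε τ u₀ u₁ u v n ≤ 1)
    {B : Finset ℤ} {Λ : ℝ} (hΛ : 0 < Λ) (hB : ∀ l ∉ B, Λ ≤ symbol a b l) (hBN : B ⊆ freqs N)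
    (hBp : ∀ j ∈ multiIdx p B, spaceFreq j ∈ freqs N) :
    l2 (freqs N) (fun l => numForce a b p N ε τ u₀ u₁ n l
      - nlCoef a b p B (twist a b u v (n * τ)) (n * τ + τ / 2) l)
      ≤ lipConst p R * (errNorm a b p N ε τ u₀ u₁ u v n / 2 + 2 * M / Λ ^ (m + 1)) := by
  have hZ := embConst_nonneg a b
  have hR' : 2 * embConst a b * M ≤ R := by linarith
  have hR0 : 0 ≤ R := le_trans (by positivity) hR
  set s := (n : ℝ) * τ + τ / 2
  -- On low frequencies without aliasing the exact coefficient is also a discrete one, so both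
  -- nonlinearities can be compared pointwise on the grid.
  have h1 : l2 (freqs N) (fun l => numForce a b p N ε τ u₀ u₁ n l
      - nlCoef a b p B (twist a b u v (n * τ)) s l)
      = l2 (freqs N) (fun l => numForce a b p N ε τ u₀ u₁ n l
      - discreteCoef a b N (sample a b N fun x =>
        powerNonlin p (linFlow a b B (twist a b u v (n * τ)) s x)) l) :=
    l2_congr fun l hl => by rw [discreteCoef_powerNonlin_linFlow hab hN p hBp _ _ hl]
  rw [h1]
  refine (l2_discreteCoef_sub_le hab hN _ _ (linCoef a b (freqs N) (numTwist a b p N ε τ u₀ u₁ n) s)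
    (linCoef a b B (twist a b u v (n * τ)) s) (lipConst_nonneg p hR0) fun j => ?_).trans ?_
  · rw [← linFlow_eq, ← linFlow_eq_of_subset hBN]
    exact norm_powerNonlin_sub_le p ((norm_linFlow_numTwist_le hab hm hM h hn hE _ _).trans hR)
      ((h.norm_linFlow_twist_le hab hm hM hn _ _ _).trans hR')
  · refine mul_le_mul_of_nonneg_left ?_ (lipConst_nonneg p hR0)
    refine (l2_linCoef_sub_le _ _).trans ?_
    have h2 : ∀ σ, l2 (freqs N) (fun l => if l ∈ B then 0 else twist a b u v (n * τ) σ l)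
        ≤ 2 * M / Λ ^ (m + 1) := fun σ =>
      l2_tail_le hΛ hB _ (h.l2_symbol_pow_mul_twist_le hM hn σ _)
    have h3 := fun σ => l2_numTwist_sub_le (a := a) (b := b) (p := p) (N := N) (ε := ε) (τ := τ)
      (u₀ := u₀) (u₁ := u₁) (u := u) (v := v) n σ
    rw [Fintype.sum_bool, errNorm, Fintype.sum_bool]
    linarith [h2 true, h2 false, h3 true, h3 false]

/-- The constant in the bound of the increments of the boundary term. -/
noncomputable def stepConst (p : ℕ) (M R : ℝ) : ℝ :=
  lipConst p R * (lipConst p R * M)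
    + 2 * (2 * p + 1) * ((2 * p + 1) * (R + R ^ (2 * p + 1)) ^ (2 * p) * R ^ (2 * p + 1))

lemma stepConst_nonneg (p : ℕ) {M R : ℝ} (hM : 0 ≤ M) (hR : 0 ≤ R) : 0 ≤ stepConst p M R := by
  have := lipConst_nonneg p hR
  unfold stepConst; positivity

/-- The increment of the modified error has three parts. The nonlinearity at the numerical and at
the exact coefficients differ by a Lipschitz term, which feeds Gronwall, plus two tails. The
boundary terms with old and new coefficients differ by O(e · τ² · eτ). Freezing the exact
coefficients costs eτ times eτ² plus one more tail, which makes the constant 3. No term of size eτ³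
survives. -/
lemma l2_modErr_succ_le (hab : a < b) (hN : 0 < N) (hm : 1 ≤ m) (hM : 0 ≤ M)
    (h : RegularSolution a b p m (ε ^ (2 * p)) S M u v) (hε : 0 ≤ ε) (hε1 : ε ≤ 1) {R : ℝ}
    (hR : 2 * embConst a b * M + embConst a b ≤ R) (hτ : 0 < τ) (hτ1 : τ ≤ 1) {n : ℕ}
    (hn : (n + 1 : ℝ) * τ ≤ S) (hE : errNorm a b p N ε τ u₀ u₁ u v n ≤ 1) {B : Finset ℤ} {Λ : ℝ}
    (hΛ : 0 < Λ) (hB : ∀ l ∉ B, Λ ≤ symbol a b l) (hBN : B ⊆ freqs N)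
    (hBp : ∀ j ∈ multiIdx p B, spaceFreq j ∈ freqs N) (hres : NonResonant a b p B τ) (σ : Bool) :
    l2 (freqs N) (modErr a b p N B ε τ u₀ u₁ u v (n + 1) σ)
      ≤ l2 (freqs N) (modErr a b p N B ε τ u₀ u₁ u v n σ)
        + ε ^ (2 * p) * τ * (lipConst p R * (errNorm a b p N ε τ u₀ u₁ u v n / 2)
          + 3 * lipConst p R * M / Λ ^ (m + 1) + stepConst p M R * (ε ^ (2 * p) * τ ^ 2)) := by
  have hZ := embConst_nonneg a b
  have hR' : 2 * embConst a b * M ≤ R := by linarith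
  have hR0 : 0 ≤ R := le_trans (by positivity) hR
  have hL := lipConst_nonneg p hR0
  have he : 0 ≤ ε ^ (2 * p) := by positivity
  have he1 : ε ^ (2 * p) ≤ 1 := pow_le_one₀ hε hε1
  set e := ε ^ (2 * p) with hedef
  have ht0 : (0 : ℝ) ≤ n * τ := by positivity
  have htS : (n : ℝ) * τ + τ ≤ S := by linarith
  have hn' : (n : ℝ) * τ ∈ Set.Icc 0 S := ⟨ht0, by linarith⟩
  have hsucc : ((n + 1 : ℕ) : ℝ) * τ = n * τ + τ := by push_cast; ring
  set t := (n : ℝ) * τ with htdef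
  have hn1 : t + τ ∈ Set.Icc 0 S := ⟨by linarith, htS⟩
  set D := e * R ^ (2 * p + 1) * τ with hD
  have hD0 : 0 ≤ D := by positivity
  set c := twist a b u v t
  set c' := twist a b u v (t + τ)
  have key : ∀ l ∈ freqs N, modErr a b p N B ε τ u₀ u₁ u v (n + 1) σ l
      = modErr a b p N B ε τ u₀ u₁ u v n σ l
        + (Complex.I * sg σ * e * (τ * (cis (-(sg σ * symbol a b l * (t + τ / 2)))
            * (numForce a b p N ε τ u₀ u₁ n l - nlCoef a b p B c (t + τ / 2) l)))
        + (Complex.I * sg σ * e * (nlBdry a b p B τ c' σ (t + τ) l - nlBdry a b p B τ c σ (t + τ) l)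
        - ((symbol a b l : ℂ) * (c' σ l - c σ l)
          - Complex.I * sg σ * e * (nlPrim a b p B c σ (t + τ) l - nlPrim a b p B c σ t l)))) := by
    intro l hl
    have hd := symbol_ne (a := a) (b := b) l
    simp only [modErr, errCoef]
    rw [hsucc, ← htdef, numTwist_succ hab hN n σ hl, nlPrim_sub_eq hτ hres, ← htdef, ← hedef]
    have e1 : (symbol a b l : ℂ) * (Complex.I * sg σ * e / symbol a b l * (τ *
        (cis (-(sg σ * symbol a b l * (t + τ / 2))) * numForce a b p N ε τ u₀ u₁ n l)))
        = Complex.I * sg σ * e * (τ *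
        (cis (-(sg σ * symbol a b l * (t + τ / 2))) * numForce a b p N ε τ u₀ u₁ n l)) := by
      field_simp
    linear_combination e1
  have b1 : l2 (freqs N) (fun l => Complex.I * sg σ * e * (τ *
      (cis (-(sg σ * symbol a b l * (t + τ / 2)))
        * (numForce a b p N ε τ u₀ u₁ n l - nlCoef a b p B c (t + τ / 2) l))))
      ≤ e * τ * (lipConst p R * (errNorm a b p N ε τ u₀ u₁ u v n / 2 + 2 * M / Λ ^ (m + 1))) := by
    have h1 := l2_numForce_sub_le hab hN hm hM h hR hn' hE hΛ hB hBN hBp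
    calc _ = l2 (freqs N) (fun l => ((e * τ : ℝ) : ℂ) *
          (numForce a b p N ε τ u₀ u₁ n l - nlCoef a b p B c (t + τ / 2) l)) :=
          l2_congr fun l _ => by
            simp only [norm_mul, norm_cis, Complex.norm_I, Complex.norm_real, Real.norm_eq_abs,
              abs_sg]
            ring
      _ ≤ _ := by
          rw [l2_smul, Complex.norm_real, Real.norm_of_nonneg (by positivity)]
          gcongr
  have b2 : l2 (freqs N) (fun l => Complex.I * sg σ * e *
      (nlBdry a b p B τ c' σ (t + τ) l - nlBdry a b p B τ c σ (t + τ) l))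
      ≤ e * (2 * (2 * p + 1) * τ ^ 2 *
        ((2 * p + 1) * (R + R ^ (2 * p + 1)) ^ (2 * p) * D)) := by
    rw [l2_smul, norm_mul, norm_mul, Complex.norm_I, Complex.norm_real, Complex.norm_real,
      Real.norm_eq_abs, abs_sg, Real.norm_of_nonneg he, one_mul, one_mul]
    refine mul_le_mul_of_nonneg_left ?_ he
    have h1 := h.sum_symbol_mul_norm_twist_sub_le hab hm hM he hR' ht0
      (by linarith : t ≤ t + τ) htS B
    rw [add_sub_cancel_left] at h1
    have h2 := h.sum_symbol_mul_norm_twist_le hab hm hM hn' B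
    refine (l2_le_sum _ _).trans ((sum_norm_nlBdry_sub_le hτ hres c' c σ (t + τ) (freqs N) hR0 hD0
      (h2.trans (by linarith)) h1).trans ?_)
    refine mul_le_mul_of_nonneg_left ?_ (by positivity)
    refine (add_pow_sub_pow_le hR0 hD0 _).trans ?_
    -- As eτ ≤ 1, one occurrence of `D` can be replaced by a constant; the other keeps the factor
    -- eτ.
    have h3 : D ≤ R ^ (2 * p + 1) := by
      rw [hD]
      have : e * τ ≤ 1 := mul_le_one₀ he1 hτ.le hτ1
      nlinarith [pow_nonneg hR0 (2 * p + 1)]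
    rw [Nat.add_sub_cancel]
    push_cast
    gcongr
  have b3 := h.l2_twist_sub_le hab hm hM he hR' ht0 hτ.le htS hΛ hB σ (freqs N)
  rw [l2_congr fun l hl => by rw [key l hl]]
  have t1 := l2_add_le (freqs N) (modErr a b p N B ε τ u₀ u₁ u v n σ) fun l =>
    (Complex.I * sg σ * e * (τ * (cis (-(sg σ * symbol a b l * (t + τ / 2)))
            * (numForce a b p N ε τ u₀ u₁ n l - nlCoef a b p B c (t + τ / 2) l)))
        + (Complex.I * sg σ * e * (nlBdry a b p B τ c' σ (t + τ) l - nlBdry a b p B τ c σ (t + τ) l)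
        - ((symbol a b l : ℂ) * (c' σ l - c σ l)
          - Complex.I * sg σ * e * (nlPrim a b p B c σ (t + τ) l - nlPrim a b p B c σ t l))))
  refine t1.trans (add_le_add le_rfl ((l2_add_le _ _ _).trans
    ((add_le_add b1 ((l2_sub_le _ _ _).trans (add_le_add b2 b3))).trans (le_of_eq ?_))))
  rw [stepConst, hD]
  ring

/-- The constant in the bound of the boundary term. -/
noncomputable def bdryConst (p : ℕ) (R : ℝ) : ℝ := 4 * (2 * p + 1) * R ^ (2 * p + 1)

lemma bdryConst_nonneg (p : ℕ) {R : ℝ} (hR : 0 ≤ R) : 0 ≤ bdryConst p R := by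
  unfold bdryConst; positivity

lemma l2_bdry_le (hab : a < b) (hm : 1 ≤ m) (hM : 0 ≤ M)
    (h : RegularSolution a b p m (ε ^ (2 * p)) S M u v) (hε : 0 ≤ ε) {R : ℝ}
    (hR : 2 * embConst a b * M + embConst a b ≤ R) (hτ : 0 < τ) {t : ℝ}
    (ht : t ∈ Set.Icc 0 S) {B : Finset ℤ} (hres : NonResonant a b p B τ) (σ : Bool) :
    l2 (freqs N) (fun l => Complex.I * sg σ * (ε ^ (2 * p) : ℝ) *
      nlBdry a b p B τ (twist a b u v t) σ t l) ≤ bdryConst p R / 2 * (ε ^ (2 * p) * τ ^ 2) := by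
  have hZ := embConst_nonneg a b
  have hR0 : 0 ≤ R := le_trans (by positivity) hR
  have h1 := h.sum_symbol_mul_norm_twist_le hab hm hM ht B
  have h2 := (l2_le_sum (freqs N) _).trans (sum_norm_nlBdry_le hτ hres (twist a b u v t) σ t (freqs N)
    hR0 (h1.trans (by linarith)))
  have he : 0 ≤ ε ^ (2 * p) := by positivity
  rw [l2_smul, norm_mul, norm_mul, Complex.norm_I, Complex.norm_real, Complex.norm_real,
    Real.norm_eq_abs, abs_sg, Real.norm_of_nonneg he, one_mul, one_mul]
  refine (mul_le_mul_of_nonneg_left h2 he).trans (le_of_eq ?_)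
  rw [bdryConst]; ring

lemma errNorm_le_modErrNorm (hab : a < b) (hm : 1 ≤ m) (hM : 0 ≤ M)
    (h : RegularSolution a b p m (ε ^ (2 * p)) S M u v) (hε : 0 ≤ ε) {R : ℝ}
    (hR : 2 * embConst a b * M + embConst a b ≤ R) (hτ : 0 < τ) {n : ℕ}
    (hn : (n : ℝ) * τ ≤ S) {B : Finset ℤ} (hres : NonResonant a b p B τ) :
    errNorm a b p N ε τ u₀ u₁ u v n
      ≤ modErrNorm a b p N B ε τ u₀ u₁ u v n + bdryConst p R * (ε ^ (2 * p) * τ ^ 2) := by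
  have h1 : ∀ σ, l2 (freqs N) (errCoef a b p N ε τ u₀ u₁ u v n σ)
      ≤ l2 (freqs N) (modErr a b p N B ε τ u₀ u₁ u v n σ)
        + bdryConst p R / 2 * (ε ^ (2 * p) * τ ^ 2) := fun σ => by
    refine le_trans (le_of_eq (l2_congr fun l _ => ?_)) ((l2_sub_le (freqs N) _ _).trans (add_le_add le_rfl
      (l2_bdry_le hab hm hM h hε hR hτ ⟨by positivity, hn⟩ hres σ)))
    rw [modErr, add_sub_cancel_right]
  rw [errNorm, modErrNorm, Fintype.sum_bool, Fintype.sum_bool]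
  linarith [h1 true, h1 false]

lemma modErrNorm_le_errNorm (hab : a < b) (hm : 1 ≤ m) (hM : 0 ≤ M)
    (h : RegularSolution a b p m (ε ^ (2 * p)) S M u v) (hε : 0 ≤ ε) {R : ℝ}
    (hR : 2 * embConst a b * M + embConst a b ≤ R) (hτ : 0 < τ) {n : ℕ}
    (hn : (n : ℝ) * τ ≤ S) {B : Finset ℤ} (hres : NonResonant a b p B τ) :
    modErrNorm a b p N B ε τ u₀ u₁ u v n
      ≤ errNorm a b p N ε τ u₀ u₁ u v n + bdryConst p R * (ε ^ (2 * p) * τ ^ 2) := by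
  have h1 : ∀ σ, l2 (freqs N) (modErr a b p N B ε τ u₀ u₁ u v n σ)
      ≤ l2 (freqs N) (errCoef a b p N ε τ u₀ u₁ u v n σ)
        + bdryConst p R / 2 * (ε ^ (2 * p) * τ ^ 2) := fun σ =>
    (l2_add_le (freqs N) _ _).trans (add_le_add le_rfl
      (l2_bdry_le hab hm hM h hε hR hτ ⟨by positivity, hn⟩ hres σ))
  rw [errNorm, modErrNorm, Fintype.sum_bool, Fintype.sum_bool]
  linarith [h1 true, h1 false]

/-- The bound of the error in terms of the initial error `E`, of `A = ε^(2p) τ²` and of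
the size `Q` of the high frequencies. -/
noncomputable def errBound (p : ℕ) (M R T E A Q : ℝ) : ℝ :=
  Real.exp (lipConst p R * T) * (E + bdryConst p R * A +
    T * ((2 * stepConst p M R + lipConst p R * bdryConst p R) * A + 6 * lipConst p R * M * Q))
    + bdryConst p R * A

/-- The error estimate in the energy norm. -/
theorem errNorm_le (hab : a < b) (hN : 0 < N) (hm : 1 ≤ m) (hM : 0 ≤ M)
    (h : RegularSolution a b p m (ε ^ (2 * p)) S M u v) (hε : 0 ≤ ε) (hε1 : ε ≤ 1) {R : ℝ}
    (hR : 2 * embConst a b * M + embConst a b ≤ R) (hτ : 0 < τ) (hτ1 : τ ≤ 1) {B : Finset ℤ} {Λ : ℝ}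
    (hΛ : 0 < Λ) (hB : ∀ l ∉ B, Λ ≤ symbol a b l) (hBN : B ⊆ freqs N)
    (hBp : ∀ j ∈ multiIdx p B, spaceFreq j ∈ freqs N) (hres : NonResonant a b p B τ) {T E : ℝ}
    (hT : ε ^ (2 * p) * S ≤ T) (hE : errNorm a b p N ε τ u₀ u₁ u v 0 ≤ E)
    (hsmall : errBound p M R T E (ε ^ (2 * p) * τ ^ 2) (1 / Λ ^ (m + 1)) ≤ 1) {n : ℕ}
    (hn : (n : ℝ) * τ ≤ S) :
    errNorm a b p N ε τ u₀ u₁ u v n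
      ≤ errBound p M R T E (ε ^ (2 * p) * τ ^ 2) (1 / Λ ^ (m + 1)) := by
  have hZ := embConst_nonneg a b
  have hR0 : 0 ≤ R := le_trans (by positivity) hR
  have hL := lipConst_nonneg p hR0
  have hC := bdryConst_nonneg p hR0
  have hG := stepConst_nonneg p hM hR0
  have he : 0 ≤ ε ^ (2 * p) := by positivity
  have hE0 : 0 ≤ E := (errNorm_nonneg 0).trans hE
  set e := ε ^ (2 * p) with hedef
  set A := e * τ ^ 2 with hA
  have hA0 : 0 ≤ A := by positivity
  set L := lipConst p R
  -- The forcing in the Gronwall inequality: the local terms are summed over both signs, and `L *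
  -- bdryConst p R` pays for replacing the error by the modified error.
  set G := (2 * stepConst p M R + L * bdryConst p R) * A + 6 * L * M * (1 / Λ ^ (m + 1)) with hGdef
  have hG0 : 0 ≤ G := by positivity
  have hbound : ∀ k : ℕ, (k : ℝ) * τ ≤ S →
      Real.exp (L * (e * (k * τ))) * (E + bdryConst p R * A + e * (k * τ) * G) + bdryConst p R * A
        ≤ errBound p M R T E A (1 / Λ ^ (m + 1)) := by
    intro k hk
    have h1 : e * (k * τ) ≤ T := (mul_le_mul_of_nonneg_left hk he).trans hT
    have h0 : 0 ≤ e * (k * τ) := by positivity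
    rw [errBound, ← hGdef]
    gcongr
  have main : ∀ k : ℕ, (k : ℝ) * τ ≤ S → modErrNorm a b p N B ε τ u₀ u₁ u v k
      ≤ Real.exp (L * (e * (k * τ))) * (E + bdryConst p R * A + e * (k * τ) * G) := by
    intro k
    induction k with
    | zero =>
      intro hk
      have := modErrNorm_le_errNorm (u₀ := u₀) (u₁ := u₁) (N := N) hab hm hM h hε hR hτ hk hres
      simp only [Nat.cast_zero, zero_mul, mul_zero, Real.exp_zero, one_mul, add_zero]
      linarith
    | succ k ih =>
      intro hk
      push_cast at hk
      have hk' : (k : ℝ) * τ ≤ S := by linarith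
      have h1 := ih hk'
      have h2 := errNorm_le_modErrNorm (u₀ := u₀) (u₁ := u₁) (N := N) hab hm hM h hε hR hτ hk' hres
      -- Bootstrap: the bound proved up to step `k`, with the smallness hypothesis, keeps the
      -- numerical solution in the ball on which the next step is estimated.
      have h3 : errNorm a b p N ε τ u₀ u₁ u v k ≤ 1 :=
        h2.trans ((add_le_add h1 le_rfl).trans ((hbound k hk').trans hsmall))
      have h4 := fun σ => l2_modErr_succ_le hab hN hm hM h hε hε1 hR hτ hτ1 hk h3 hΛ hB hBN hBp hres σ
      set x := modErrNorm a b p N B ε τ u₀ u₁ u v k with hx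
      set y := Real.exp (L * (e * (k * τ))) with hy
      have hy1 : 1 ≤ y := Real.one_le_exp (by positivity)
      have h5 : modErrNorm a b p N B ε τ u₀ u₁ u v (k + 1) ≤ x + e * τ * (L * x + G) := by
        have h6 : modErrNorm a b p N B ε τ u₀ u₁ u v (k + 1) ≤ x + e * τ *
            (L * errNorm a b p N ε τ u₀ u₁ u v k
              + 6 * L * M * (1 / Λ ^ (m + 1)) + 2 * stepConst p M R * A) := by
          rw [hx, modErrNorm, modErrNorm, Fintype.sum_bool, Fintype.sum_bool]
          refine (add_le_add (h4 true) (h4 false)).trans (le_of_eq ?_)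
          ring
        refine h6.trans ?_
        have h7 := mul_le_mul_of_nonneg_left h2 hL
        have h8 : L * errNorm a b p N ε τ u₀ u₁ u v k
              + 6 * L * M * (1 / Λ ^ (m + 1)) + 2 * stepConst p M R * A ≤ L * x + G := by
          rw [hGdef]; linarith
        gcongr
      have h9 : Real.exp (L * (e * ((k + 1 : ℕ) * τ))) = y * Real.exp (L * (e * τ)) := by
        rw [hy, ← Real.exp_add]; congr 1; push_cast; ring
      have h10 : 1 + L * (e * τ) ≤ Real.exp (L * (e * τ)) := by
        linarith [Real.add_one_le_exp (L * (e * τ))]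
      set K := E + bdryConst p R * A + e * (k * τ) * G with hK
      have hK0 : 0 ≤ K := by positivity
      have heτ : 0 ≤ e * τ := by positivity
      rw [h9]
      calc _ ≤ x + e * τ * (L * x + G) := h5
        _ = (1 + L * (e * τ)) * x + e * τ * G := by ring
        _ ≤ (1 + L * (e * τ)) * (y * K) + 1 * (e * τ * G) := by
          rw [one_mul]; gcongr
        _ ≤ Real.exp (L * (e * τ)) * (y * K) + (y * Real.exp (L * (e * τ))) * (e * τ * G) := by
          gcongr
          exact one_le_mul_of_one_le_of_one_le hy1 (Real.one_le_exp (by positivity))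
        _ = _ := by rw [hK]; push_cast; ring
  have h2 := errNorm_le_modErrNorm (u₀ := u₀) (u₁ := u₁) (N := N) hab hm hM h hε hR hτ hn hres
  exact h2.trans ((add_le_add (main n hn) le_rfl).trans (hbound n hn))

end Recursion

/-! ### The error in Sobolev norms -/

section Error

variable {a b : ℝ} {p m N : ℕ} {ε τ S M : ℝ} {u₀ u₁ : ℝ → ℂ} {u v : ℝ → ℝ → ℂ}

lemma fourierCoef_sub_interp (hab : a < b) {w : ℝ → ℂ} (hw : Continuous w) (U : Fin (N + 1) → ℂ)
    (l : ℤ) : fourierCoef a b (fun x => w x - interp a b N U x) l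
      = fourierCoef a b w l - if l ∈ freqs N then discreteCoef a b N U l else 0 := by
  have e : interp a b N U = fun x => ∑ l ∈ freqs N, discreteCoef a b N U l * mode a b l x := by
    funext x; simp only [interp, multInterp, one_mul]
  have hc : Continuous (interp a b N U) := by
    rw [e]; exact continuous_finsetSum _ fun l _ => continuous_const.mul (continuous_mode l)
  rw [fourierCoef_sub hw hc, e, fourierCoef_trigPoly hab]

lemma discreteCoef_initialEta (hab : a < b) (hN : 0 < N) (σ : Bool) {l : ℤ} (hl : l ∈ freqs N) :
    discreteCoef a b N (branch σ (initialEta a b N u₀ u₁)) l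
      = discreteCoef a b N (sample a b N u₀) l
        - Complex.I * sg σ / symbol a b l * discreteCoef a b N (sample a b N u₁) l := by
  have h := discreteCoef_multInterp hab hN (fun l => ((1 / symbol a b l : ℝ) : ℂ))
    (sample a b N u₁) hl
  cases σ
  · simp only [branch, initialEta, Bool.false_eq_true, if_false]
    rw [discreteCoef_add, discreteCoef_smul, h, sg_false]
    push_cast; ring
  · simp only [branch, initialEta, if_true]
    rw [discreteCoef_sub, discreteCoef_smul, h, sg_true]
    push_cast; ring

lemma uNum_eq (n : ℕ) : uNum a b p N ε τ u₀ u₁ n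
    = fun j => 1 / 2 * ((eta a b p N ε τ u₀ u₁ n).1 j + (eta a b p N ε τ u₀ u₁ n).2 j) := by
  cases n with
  | zero => funext j; simp only [uNum, eta, initialEta]; ring
  | succ n => funext j; simp only [uNum]; ring

lemma discreteCoef_uNum (n : ℕ) (l : ℤ) : discreteCoef a b N (uNum a b p N ε τ u₀ u₁ n) l
    = ∑ σ : Bool, 1 / 2 * discreteCoef a b N (branch σ (eta a b p N ε τ u₀ u₁ n)) l := by
  rw [uNum_eq, discreteCoef_smul, discreteCoef_add, Fintype.sum_bool, mul_add]
  rfl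

/-- At `n = 0` the velocity is sampled rather than reconstructed from η_±. The formula still holds
because the multipliers δ_l⁻¹ and δ_l cancel on the grid frequencies. -/
lemma discreteCoef_vNum (hab : a < b) (hN : 0 < N) (n : ℕ) {l : ℤ} (hl : l ∈ freqs N) :
    discreteCoef a b N (vNum a b p N ε τ u₀ u₁ n) l = ∑ σ : Bool, Complex.I / 2 * symbol a b l *
      sg σ * discreteCoef a b N (branch σ (eta a b p N ε τ u₀ u₁ n)) l := by
  have hd := symbol_ne (a := a) (b := b) l
  rw [Fintype.sum_bool]
  cases n with
  | zero =>
    rw [vNum, eta, discreteCoef_initialEta hab hN _ hl, discreteCoef_initialEta hab hN _ hl,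
      sg_true, sg_false]
    push_cast
    field_simp
    linear_combination (2 * discreteCoef a b N (sample a b N u₁) l) * Complex.I_sq
  | succ n =>
    rw [vNum, discreteCoef_smul, discreteCoef_multInterp hab hN _ _ hl, discreteCoef_sub]
    simp only [branch, Bool.false_eq_true, if_false, if_true, sg_true, sg_false]
    push_cast
    ring

lemma twist_eq (t : ℝ) (σ : Bool) (l : ℤ) :
    cis (sg σ * symbol a b l * t) * twist a b u v t σ l
      = fourierCoef a b (u t) l - Complex.I * sg σ / symbol a b l * fourierCoef a b (v t) l := by
  rw [twist, ← mul_assoc, cis_mul_neg, one_mul]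

lemma cis_mul_errCoef (n : ℕ) (σ : Bool) (l : ℤ) :
    cis (sg σ * symbol a b l * (n * τ)) * errCoef a b p N ε τ u₀ u₁ u v n σ l
      = symbol a b l * (discreteCoef a b N (branch σ (eta a b p N ε τ u₀ u₁ n)) l
        - (fourierCoef a b (u (n * τ)) l
          - Complex.I * sg σ / symbol a b l * fourierCoef a b (v (n * τ)) l)) := by
  rw [errCoef, ← twist_eq, discreteCoef_branch_eta]
  ring

lemma l2_uNum_sub_le (n : ℕ) :
    l2 (freqs N) (fun l => (symbol a b l : ℂ) * (fourierCoef a b (u (n * τ)) l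
      - discreteCoef a b N (uNum a b p N ε τ u₀ u₁ n) l))
      ≤ errNorm a b p N ε τ u₀ u₁ u v n / 2 := by
  have h : ∀ l ∈ freqs N, ‖(symbol a b l : ℂ) * (fourierCoef a b (u (n * τ)) l
      - discreteCoef a b N (uNum a b p N ε τ u₀ u₁ n) l)‖
      = ‖-(1 / 2) * (cis (sg true * symbol a b l * (n * τ)) * errCoef a b p N ε τ u₀ u₁ u v n true l)
        + -(1 / 2) *
          (cis (sg false * symbol a b l * (n * τ)) * errCoef a b p N ε τ u₀ u₁ u v n false l)‖ := by
    intro l _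
    rw [discreteCoef_uNum, Fintype.sum_bool, cis_mul_errCoef, cis_mul_errCoef, sg_true, sg_false]
    congr 1
    push_cast
    ring
  rw [l2_congr h]
  refine (l2_add_le _ _ _).trans ?_
  rw [l2_smul, l2_smul, errNorm, Fintype.sum_bool]
  have h1 : ∀ σ, l2 (freqs N) (fun l => cis (sg σ * symbol a b l * (n * τ)) *
      errCoef a b p N ε τ u₀ u₁ u v n σ l) = l2 (freqs N) (errCoef a b p N ε τ u₀ u₁ u v n σ) :=
    fun σ => l2_congr fun l _ => by rw [norm_mul, norm_cis, one_mul]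
  rw [h1, h1]
  norm_num
  linarith

lemma l2_vNum_sub_le (hab : a < b) (hN : 0 < N) (n : ℕ) :
    l2 (freqs N) (fun l => fourierCoef a b (v (n * τ)) l
      - discreteCoef a b N (vNum a b p N ε τ u₀ u₁ n) l)
      ≤ errNorm a b p N ε τ u₀ u₁ u v n / 2 := by
  have h : ∀ l ∈ freqs N, ‖fourierCoef a b (v (n * τ)) l
      - discreteCoef a b N (vNum a b p N ε τ u₀ u₁ n) l‖
      = ‖-(Complex.I / 2) *
          (cis (sg true * symbol a b l * (n * τ)) * errCoef a b p N ε τ u₀ u₁ u v n true l)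
        + Complex.I / 2 *
          (cis (sg false * symbol a b l * (n * τ)) * errCoef a b p N ε τ u₀ u₁ u v n false l)‖ := by
    intro l hl
    have hd := symbol_ne (a := a) (b := b) l
    rw [discreteCoef_vNum hab hN n hl, Fintype.sum_bool, cis_mul_errCoef, cis_mul_errCoef, sg_true,
      sg_false]
    congr 1
    push_cast
    field_simp
    linear_combination (2 * fourierCoef a b (v (n * τ)) l) * Complex.I_sq
  rw [l2_congr h]
  refine (l2_add_le _ _ _).trans ?_
  rw [l2_smul, l2_smul, errNorm, Fintype.sum_bool]
  have h1 : ∀ σ, l2 (freqs N) (fun l => cis (sg σ * symbol a b l * (n * τ)) *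
      errCoef a b p N ε τ u₀ u₁ u v n σ l) = l2 (freqs N) (errCoef a b p N ε τ u₀ u₁ u v n σ) :=
    fun σ => l2_congr fun l _ => by rw [norm_mul, norm_cis, one_mul]
  rw [h1, h1]
  norm_num
  linarith

lemma le_symbol_of_notMem_freqs (hab : a < b) (hN : 0 < N) (hE : Even N) {l : ℤ}
    (hl : l ∉ freqs N) : ((b - a) / N)⁻¹ ≤ symbol a b l := by
  have hba : 0 < b - a := sub_pos.2 hab
  refine le_trans ?_ (abs_waveNumber_le_symbol l)
  have h1 : (N : ℤ) ≤ 2 * |l| := by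
    obtain ⟨r, hr⟩ := hE
    rw [mem_freqs] at hl
    rcases abs_cases l with h | h <;> omega
  have h2 : (N : ℝ) ≤ 2 * |(l : ℝ)| := by exact_mod_cast h1
  rw [waveNumber, abs_div, abs_of_pos hba, abs_mul, abs_of_pos (by positivity : 0 < 2 * Real.pi),
    inv_div]
  refine div_le_div_of_nonneg_right ?_ hba.le
  nlinarith [Real.pi_gt_three, abs_nonneg (l : ℝ)]

/-- The resolved frequencies carry the discretisation error, the unresolved ones the projection
error: they have symbol at least 1/h, so `s` derivatives give h^s. -/
lemma l2_sub_le_of_freqs (hab : a < b) (hN : 0 < N) (hE : Even N) {c d : ℤ → ℂ} {s : ℕ} {D : ℝ}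
    (h : l2 (freqs N) (fun l => c l - d l) ≤ D)
    (hc : ∀ F, l2 F (fun l => (symbol a b l : ℂ) ^ s * c l) ≤ M) (F : Finset ℤ) :
    l2 F (fun l => c l - if l ∈ freqs N then d l else 0) ≤ D + M * ((b - a) / N) ^ s := by
  have hba : 0 < b - a := sub_pos.2 hab
  have hN' : (0 : ℝ) < N := by exact_mod_cast hN
  have h1 := l2_ite_le F (freqs N) (fun l => c l - if l ∈ freqs N then d l else 0) fun _ => 0
  have h2 : l2 (F ∩ freqs N) (fun l => (c l - if l ∈ freqs N then d l else 0) - 0)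
      = l2 (F ∩ freqs N) (fun l => c l - d l) := l2_congr fun l hl => by
    rw [if_pos (Finset.mem_inter.1 hl).2, sub_zero]
  have h3 : l2 F (fun l => if l ∈ freqs N then 0 else c l - if l ∈ freqs N then d l else 0)
      = l2 F (fun l => if l ∈ freqs N then 0 else c l) := l2_congr fun l _ => by
    split_ifs <;> simp
  have h4 := l2_tail_le (s := s) (c := c) (Λ := ((b - a) / N)⁻¹) (by positivity)
    (fun l hl => le_symbol_of_notMem_freqs hab hN hE hl) F (hc F)
  rw [h2, h3] at h1
  rw [inv_pow, div_inv_eq_mul] at h4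
  exact h1.trans (add_le_add ((l2_subset Finset.inter_subset_right _).trans h) h4)

lemma tsfpError_le (hab : a < b) (hN : 0 < N) (hE : Even N) (hM : 0 ≤ M) {e : ℝ}
    (h : RegularSolution a b p m e S M u v) {n : ℕ} (hn : (n : ℝ) * τ ∈ Set.Icc 0 S) :
    tsfpError a b p N ε τ u₀ u₁ u v n ≤
      ENNReal.ofReal (errNorm a b p N ε τ u₀ u₁ u v n + 2 * M * ((b - a) / N) ^ m) := by
  have hba : 0 < b - a := sub_pos.2 hab
  have hD : 0 ≤ errNorm a b p N ε τ u₀ u₁ u v n / 2 + M * ((b - a) / N) ^ m :=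
    add_nonneg (div_nonneg (errNorm_nonneg n) zero_le_two) (by positivity)
  have h1 : sobolevNorm a b 1 (fun x => u (n * τ) x - interp a b N (uNum a b p N ε τ u₀ u₁ n) x)
      ≤ ENNReal.ofReal (errNorm a b p N ε τ u₀ u₁ u v n / 2 + M * ((b - a) / N) ^ m) := by
    rw [sobolevNorm_le_iff hD]
    intro F
    have h2 := l2_sub_le_of_freqs hab hN hE (c := fun l => symbol a b l * fourierCoef a b (u (n * τ)) l)
      (d := fun l => symbol a b l * discreteCoef a b N (uNum a b p N ε τ u₀ u₁ n) l) (s := m) (M := M)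
      (D := errNorm a b p N ε τ u₀ u₁ u v n / 2)
      (by simpa only [mul_sub] using l2_uNum_sub_le (v := v) n)
      (fun F => by
        rw [l2_le_iff hM]
        refine le_trans (le_of_eq (Finset.sum_congr rfl fun l _ => ?_)) (h.bound_u _ hn F)
        rw [norm_mul, norm_mul, norm_pow, Complex.norm_real, Real.norm_of_nonneg (symbol_pos l).le]
        ring) F
    rw [l2_le_iff hD] at h2
    refine le_trans (le_of_eq (Finset.sum_congr rfl fun l _ => ?_)) h2
    rw [fourierCoef_sub_interp hab (h.continuous_u _ hn), ← Real.norm_of_nonneg (symbol_pos l).le,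
      ← Complex.norm_real, mul_one, ← mul_pow, ← norm_mul]
    congr 2
    rw [Complex.norm_real, Real.norm_of_nonneg (symbol_pos l).le]
    split_ifs <;> ring
  have h1' : sobolevNorm a b 0 (fun x => v (n * τ) x - interp a b N (vNum a b p N ε τ u₀ u₁ n) x)
      ≤ ENNReal.ofReal (errNorm a b p N ε τ u₀ u₁ u v n / 2 + M * ((b - a) / N) ^ m) := by
    rw [sobolevNorm_le_iff hD]
    intro F
    have h2 := l2_sub_le_of_freqs hab hN hE (c := fourierCoef a b (v (n * τ)))
      (d := discreteCoef a b N (vNum a b p N ε τ u₀ u₁ n)) (s := m) (M := M)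
      (l2_vNum_sub_le (u := u) hab hN n)
      (fun F => by
        rw [l2_le_iff hM]
        refine le_trans (le_of_eq (Finset.sum_congr rfl fun l _ => ?_)) (h.bound_v _ hn F)
        rw [norm_mul, norm_pow, Complex.norm_real, Real.norm_of_nonneg (symbol_pos l).le]
        ring) F
    rw [l2_le_iff hD] at h2
    refine le_trans (le_of_eq (Finset.sum_congr rfl fun l _ => ?_)) h2
    rw [fourierCoef_sub_interp hab (h.continuous_v _ hn), mul_zero, pow_zero, one_mul]
  refine (add_le_add h1 h1').trans ?_
  rw [← ENNReal.ofReal_add hD hD]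
  exact ENNReal.ofReal_le_ofReal (by linarith)

/-- The constant in the bound of the aliasing error. -/
noncomputable def aliasConst : ℝ := Real.sqrt (∑' q : ℤ, ((q : ℝ) ^ 2)⁻¹)

lemma symbol_le_of_mem_freqs (hab : a < b) (hN : 0 < N) {l : ℤ} (hl : l ∈ freqs N) :
    symbol a b l ≤ 1 + 4 * ((b - a) / N)⁻¹ := by
  have hba : 0 < b - a := sub_pos.2 hab
  have hN' : (0 : ℝ) < N := by exact_mod_cast hN
  refine (symbol_le l).trans (add_le_add le_rfl ?_)
  have h1 : 2 * |l| ≤ N := by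
    rw [mem_freqs] at hl
    rcases abs_cases l with h | h <;> omega
  have h2 : 2 * |(l : ℝ)| ≤ N := by exact_mod_cast h1
  rw [waveNumber, abs_div, abs_of_pos hba, abs_mul, abs_of_pos (by positivity : 0 < 2 * Real.pi),
    inv_div, ← mul_div_assoc]
  refine div_le_div_of_nonneg_right ?_ hba.le
  nlinarith [Real.pi_le_four, Real.pi_pos, abs_nonneg (l : ℝ)]

/-- The initial error. -/
lemma errNorm_zero_le (hab : a < b) (hN : 0 < N) (hE : Even N) (hm : 1 ≤ m) (hM : 0 ≤ M) (hS : 0 ≤ S)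
    {e : ℝ} (h : RegularSolution a b p m e S M u v) (hh : (b - a) / N ≤ 1) :
    errNorm a b p N ε τ (u 0) (v 0) u v 0 ≤ 12 * aliasConst * M * ((b - a) / N) ^ m := by
  have hba : 0 < b - a := sub_pos.2 hab
  have hN' : (0 : ℝ) < N := by exact_mod_cast hN
  have h0 : (0 : ℝ) ∈ Set.Icc 0 S := ⟨le_rfl, hS⟩
  have hA : 0 ≤ aliasConst := Real.sqrt_nonneg _
  set r := (b - a) / N with hr
  have hr0 : 0 < r := by positivity
  have h1 := l2_discreteCoef_sub_fourier_le hab hN hE (h.hasSum_u 0 h0) (by omega : 1 ≤ m + 1) hM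
    (h.bound_u 0 h0)
  have h2 := l2_discreteCoef_sub_fourier_le hab hN hE (h.hasSum_v 0 h0) hm hM (h.bound_v 0 h0)
  rw [← hr] at h1 h2
  have h3 : l2 (freqs N) (fun l => (symbol a b l : ℂ) *
      (discreteCoef a b N (sample a b N (u 0)) l - fourierCoef a b (u 0) l))
      ≤ 5 * aliasConst * M * r ^ m := by
    -- An inverse inequality: on the resolved frequencies the symbol is O(1/h), so the weight lowers
    -- the interpolation order of u₀ from m + 1 to m.
    calc _ ≤ l2 (freqs N) (fun l => ((1 + 4 * r⁻¹ : ℝ) : ℂ) *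
          (discreteCoef a b N (sample a b N (u 0)) l - fourierCoef a b (u 0) l)) :=
          l2_mono fun l hl => by
            rw [norm_mul, norm_mul, Complex.norm_real, Complex.norm_real,
              Real.norm_of_nonneg (symbol_pos l).le, Real.norm_of_nonneg (by positivity)]
            exact mul_le_mul_of_nonneg_right (symbol_le_of_mem_freqs hab hN hl) (norm_nonneg _)
      _ ≤ (1 + 4 * r⁻¹) * (aliasConst * r ^ (m + 1) * M) := by
          rw [l2_smul, Complex.norm_real, Real.norm_of_nonneg (by positivity)]
          exact mul_le_mul_of_nonneg_left h1 (by positivity)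
      _ = (r + 4) * (aliasConst * M * r ^ m) := by field_simp; ring
      _ ≤ 5 * (aliasConst * M * r ^ m) := by gcongr; linarith
      _ = _ := by ring
  have h4 : ∀ σ, l2 (freqs N) (errCoef a b p N ε τ (u 0) (v 0) u v 0 σ)
      ≤ 6 * aliasConst * M * r ^ m := by
    intro σ
    have h5 : ∀ l ∈ freqs N, ‖errCoef a b p N ε τ (u 0) (v 0) u v 0 σ l‖
        = ‖(symbol a b l : ℂ) * (discreteCoef a b N (sample a b N (u 0)) l - fourierCoef a b (u 0) l)
          - Complex.I * sg σ *
            (discreteCoef a b N (sample a b N (v 0)) l - fourierCoef a b (v 0) l)‖ := by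
      intro l hl
      have hd := symbol_ne (a := a) (b := b) l
      have h6 := cis_mul_errCoef (a := a) (b := b) (p := p) (N := N) (ε := ε) (τ := τ) (u₀ := u 0)
        (u₁ := v 0) (u := u) (v := v) 0 σ l
      rw [Nat.cast_zero, zero_mul, mul_zero, cis_zero, one_mul, eta,
        discreteCoef_initialEta hab hN σ hl] at h6
      rw [h6]
      congr 1
      field_simp
      ring
    rw [l2_congr h5]
    refine (l2_sub_le _ _ _).trans ?_
    rw [l2_smul, norm_mul, Complex.norm_I, Complex.norm_real, Real.norm_eq_abs, abs_sg, one_mul,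
      one_mul]
    change _ ≤ aliasConst * r ^ m * M at h2
    linarith
  rw [errNorm, Fintype.sum_bool]
  linarith [h4 true, h4 false]

/-! ### The frequency cutoff -/

/-- A cutoff adapted to the mesh size and to the time step. -/
lemma exists_cutoff (hab : a < b) (p : ℕ) (hN : 0 < N) (hE : Even N) (hτ : 0 < τ)
    (hτ1 : 2 * (2 * p + 1) * τ ≤ 1) :
    ∃ B : Finset ℤ, B ⊆ freqs N ∧ (∀ j ∈ multiIdx p B, spaceFreq j ∈ freqs N) ∧
      NonResonant a b p B τ ∧ ∀ l ∉ B, (2 * (2 * p + 1) * ((b - a) / N + τ))⁻¹ ≤ symbol a b l := by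
  have hba : 0 < b - a := sub_pos.2 hab
  have hN' : (0 : ℝ) < N := by exact_mod_cast hN
  have hpi := Real.pi_gt_three
  set r := (b - a) / N with hr
  have hr0 : 0 < r := by positivity
  -- The cutoff is the largest `K` with K(h + τ) ≤ c. Then Kh ≤ c gives 8(2p+1)K ≤ N, so products of
  -- 2p+1 modes stay on the grid. And Kτ ≤ c gives 2(2p+1)|μ_l|τ ≤ π/2, which leaves room for the
  -- `1` in δ_l ≤ 1 + |μ_l|.
  set c := (b - a) / (8 * (2 * p + 1)) with hc
  have hc0 : 0 < c := by positivity
  set K := ⌊c / (r + τ)⌋₊ with hK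
  have hK1 : (K : ℝ) * (r + τ) ≤ c := by
    rw [← le_div_iff₀ (by positivity)]; exact Nat.floor_le (by positivity)
  have hK2 : c < (K + 1 : ℝ) * (r + τ) := by
    rw [← div_lt_iff₀ (by positivity)]; exact Nat.lt_floor_add_one _
  have hK0 : (0 : ℝ) ≤ K := Nat.cast_nonneg K
  have hKN : 2 * ((2 * p + 1) * (K : ℤ)) < N := by
    have h1 : (K : ℝ) * r ≤ c := le_trans (by gcongr; linarith) hK1
    rw [hr, hc, mul_div_assoc', div_le_div_iff₀ hN' (by positivity)] at h1
    have h2 : 8 * ((2 * p + 1) * (K : ℝ)) ≤ N := by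
      have : (b - a) * (8 * ((2 * p + 1) * (K : ℝ))) ≤ (b - a) * N := by linarith
      exact le_of_mul_le_mul_left this hba
    have h3 : 8 * ((2 * p + 1) * (K : ℤ)) ≤ N := by exact_mod_cast h2
    have h4 : (0 : ℤ) ≤ (2 * p + 1) * (K : ℤ) := by positivity
    omega
  have hmem : ∀ l : ℤ, |l| ≤ (2 * p + 1) * (K : ℤ) → l ∈ freqs N := by
    intro l hl
    obtain ⟨q, hq⟩ := hE
    rw [mem_freqs]
    have := abs_le.1 hl
    omega
  have habs : ∀ l ∈ Finset.Icc (-(K : ℤ)) K, |l| ≤ K := fun l hl => abs_le.2 (Finset.mem_Icc.1 hl)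
  refine ⟨Finset.Icc (-(K : ℤ)) K, fun l hl => hmem l ((habs l hl).trans ?_),
    fun j hj => hmem _ (abs_spaceFreq_le habs hj), fun l hl => ?_, fun l hl => ?_⟩
  · nlinarith [Int.natCast_nonneg K, Int.natCast_nonneg p]
  · have h1 : |(l : ℝ)| ≤ K := by exact_mod_cast habs l hl
    have h2 : |(l : ℝ)| * τ ≤ c := le_trans (by gcongr; linarith) hK1
    have h3 : |waveNumber a b l| * τ ≤ Real.pi / (4 * (2 * p + 1)) := by
      rw [waveNumber, abs_div, abs_of_pos hba, abs_mul, abs_of_pos (by positivity : 0 < 2 * Real.pi)]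
      calc 2 * Real.pi * |(l : ℝ)| / (b - a) * τ = 2 * Real.pi * (|(l : ℝ)| * τ) / (b - a) := by ring
        _ ≤ 2 * Real.pi * c / (b - a) := by gcongr
        _ = _ := by rw [hc]; field_simp; norm_num
    have h4 := mul_le_mul_of_nonneg_right (symbol_le (a := a) (b := b) l) hτ.le
    have h5 : 2 * (2 * p + 1) * (Real.pi / (4 * (2 * p + 1))) = Real.pi / 2 := by field_simp; norm_num
    calc 2 * (2 * p + 1) * symbol a b l * τ = 2 * (2 * p + 1) * (symbol a b l * τ) := by ring
      _ ≤ 2 * (2 * p + 1) * (τ + Real.pi / (4 * (2 * p + 1))) := by gcongr; linarith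
      _ = 2 * (2 * p + 1) * τ + Real.pi / 2 := by rw [mul_add, h5]
      _ ≤ Real.pi := by linarith
  · refine le_trans ?_ (abs_waveNumber_le_symbol l)
    have h1 : (K : ℤ) + 1 ≤ |l| := by
      by_contra hlt
      exact hl (Finset.mem_Icc.2 (abs_le.1 (by omega)))
    have h2 : (K : ℝ) + 1 ≤ |(l : ℝ)| := by exact_mod_cast h1
    have h3 : c ≤ |(l : ℝ)| * (r + τ) := hK2.le.trans (by gcongr)
    rw [waveNumber, abs_div, abs_of_pos hba, abs_mul, abs_of_pos (by positivity : 0 < 2 * Real.pi),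
      inv_le_iff_one_le_mul₀ (by positivity)]
    calc (1 : ℝ) ≤ Real.pi / 2 := by linarith
      _ = 2 * Real.pi * c / (b - a) * (2 * (2 * p + 1)) := by rw [hc]; field_simp; norm_num
      _ ≤ 2 * Real.pi * (|(l : ℝ)| * (r + τ)) / (b - a) * (2 * (2 * p + 1)) := by gcongr
      _ = _ := by ring

lemma errBound_mono {p : ℕ} {M R T E A Q E' A' Q' : ℝ} (hM : 0 ≤ M) (hR : 0 ≤ R) (hT : 0 ≤ T)
    (hE : E ≤ E') (hA : A ≤ A') (hQ : Q ≤ Q') : errBound p M R T E A Q ≤ errBound p M R T E' A' Q' := by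
  have hL := lipConst_nonneg p hR
  have hC := bdryConst_nonneg p hR
  have hG := stepConst_nonneg p hM hR
  unfold errBound
  gcongr

/-- Homogeneity lets the total size `W` of the error terms be factored out, so that the final
constant is a value of `errBound`. -/
lemma errBound_mul (p : ℕ) (M R T E A Q W : ℝ) :
    errBound p M R T (E * W) (A * W) (Q * W) = errBound p M R T E A Q * W := by
  unfold errBound; ring

lemma errBound_nonneg {p : ℕ} {M R T E A Q : ℝ} (hM : 0 ≤ M) (hR : 0 ≤ R) (hT : 0 ≤ T)
    (hE : 0 ≤ E) (hA : 0 ≤ A) (hQ : 0 ≤ Q) : 0 ≤ errBound p M R T E A Q := by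
  have hL := lipConst_nonneg p hR
  have hC := bdryConst_nonneg p hR
  have hG := stepConst_nonneg p hM hR
  unfold errBound
  positivity

/-- The uniform error bound, with the time step in the role of the cutoff parameter. -/
theorem exists_tsfpError_le (hab : a < b) (p : ℕ) (hm : 1 ≤ m) {T : ℝ} (hT : 0 < T) (hM : 0 ≤ M) :
    ∃ h₀ τs C : ℝ, 0 < h₀ ∧ h₀ ≤ 1 ∧ 0 < τs ∧ τs < 1 ∧ 0 < C ∧ ∀ ε : ℝ, 0 < ε → ε ≤ 1 →
      ∀ (u₀ u₁ : ℝ → ℂ) (u v : ℝ → ℝ → ℂ), IsSolution a b p ε (T / ε ^ (2 * p)) u₀ u₁ u v →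
        linftySobolevNorm a b (T / ε ^ (2 * p)) (m + 1) u ≤ ENNReal.ofReal M →
        linftySobolevNorm a b (T / ε ^ (2 * p)) m v ≤ ENNReal.ofReal M →
      ∀ N : ℕ, 0 < N → Even N → (b - a) / N ≤ h₀ → ∀ τ : ℝ, 0 < τ → τ ≤ τs →
      ∀ n : ℕ, (n : ℝ) ≤ T / ε ^ (2 * p) / τ → tsfpError a b p N ε τ u₀ u₁ u v n ≤
        ENNReal.ofReal (C * (((b - a) / N) ^ m + ε ^ (2 * p) * τ ^ 2 + τ ^ (m + 1))) := by
  have hba : 0 < b - a := sub_pos.2 hab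
  have hZ := embConst_nonneg a b
  set R := 2 * embConst a b * M + embConst a b with hR
  have hR0 : 0 ≤ R := by positivity
  have hA : 0 ≤ aliasConst := Real.sqrt_nonneg _
  -- The cutoff constant to the power m + 1, times the constant in (h + τ)^(m+1) ≤ 2^m (h^(m+1) +
  -- τ^(m+1)).
  set q : ℝ := (2 * (2 * p + 1)) ^ (m + 1) * 2 ^ m with hq
  set C₀ := errBound p M R T (12 * aliasConst * M) 1 q with hC₀
  have hC₀0 : 0 ≤ C₀ := errBound_nonneg hM hR0 hT.le (by positivity) zero_le_one (by positivity)
  -- Each of the three terms of `W` is at most 1/(3(C₀+1)), so that C₀W ≤ 1, as the bootstrap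
  -- requires. The extra factor in the bound on τ provides the step condition of the cutoff. In the
  -- last constant, `2 * M` is the projection error and `1` ensures positivity.
  refine ⟨1 / (3 * (C₀ + 1)), 1 / (2 * (2 * p + 1) * (3 * (C₀ + 1))), C₀ + 2 * M + 1, by positivity, ?_,
    by positivity, ?_, by positivity, ?_⟩
  · rw [div_le_one (by positivity)]; linarith
  · rw [div_lt_one (by positivity)]
    have : (0 : ℝ) ≤ p := Nat.cast_nonneg p
    nlinarith
  intro ε hε hε1 u₀ u₁ u v hsol hu hv N hN hE hh τ hτ hτs n hn
  have hN' : (0 : ℝ) < N := by exact_mod_cast hN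
  have he : 0 < ε ^ (2 * p) := by positivity
  have he1 : ε ^ (2 * p) ≤ 1 := pow_le_one₀ hε.le hε1
  have hS : 0 < T / ε ^ (2 * p) := by positivity
  have h := hsol.regularSolution hab hS hm hM hu hv
  obtain rfl := hsol.initial_u
  obtain rfl := hsol.initial_v
  have hp0 : (0 : ℝ) ≤ p := Nat.cast_nonneg p
  have hτs' : τ ≤ 1 / (3 * (C₀ + 1)) := by
    refine hτs.trans (one_div_le_one_div_of_le (by positivity) ?_)
    nlinarith
  have hC3 : 1 / (3 * (C₀ + 1)) ≤ 1 := by rw [div_le_one (by positivity)]; linarith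
  have hτ1 : τ ≤ 1 := hτs'.trans hC3
  have hτ2 : 2 * (2 * p + 1) * τ ≤ 1 := by
    rw [le_div_iff₀ (by positivity)] at hτs
    have : 0 < (2 * (p : ℝ) + 1) * τ := by positivity
    nlinarith
  obtain ⟨B, hBN, hBp, hres, hB⟩ := exists_cutoff hab p hN hE hτ hτ2
  set r := (b - a) / N with hr
  have hr0 : 0 < r := by positivity
  have hr1 : r ≤ 1 := hh.trans hC3
  set W := r ^ m + ε ^ (2 * p) * τ ^ 2 + τ ^ (m + 1) with hW
  have hW0 : 0 ≤ W := by positivity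
  have hnS : (n : ℝ) * τ ≤ T / ε ^ (2 * p) := by rwa [le_div_iff₀ hτ] at hn
  have hΛ : (0 : ℝ) < (2 * (2 * p + 1) * (r + τ))⁻¹ := by positivity
  have hE0 := errNorm_zero_le (ε := ε) (τ := τ) hab hN hE hm hM hS.le h hr1
  rw [← hr] at hE0
  have hQ : 1 / (2 * (2 * p + 1) * (r + τ))⁻¹ ^ (m + 1) ≤ q * W := by
    rw [inv_pow, one_div, inv_inv, mul_pow, hq, mul_assoc]
    gcongr
    calc (r + τ) ^ (m + 1) ≤ 2 ^ m * (r ^ (m + 1) + τ ^ (m + 1)) := add_pow_le hr0.le hτ.le (m + 1)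
      _ ≤ 2 ^ m * W := by
        gcongr
        have h1 : r ^ (m + 1) ≤ r ^ m := pow_le_pow_of_le_one hr0.le hr1 (Nat.le_succ m)
        have h2 : 0 ≤ ε ^ (2 * p) * τ ^ 2 := by positivity
        rw [hW]; linarith
  have hbd : errBound p M R T (12 * aliasConst * M * r ^ m) (ε ^ (2 * p) * τ ^ 2)
      (1 / (2 * (2 * p + 1) * (r + τ))⁻¹ ^ (m + 1)) ≤ C₀ * W := by
    rw [hC₀, ← errBound_mul]
    refine errBound_mono hM hR0 hT.le ?_ ?_ hQ
    · gcongr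
      have : 0 ≤ ε ^ (2 * p) * τ ^ 2 + τ ^ (m + 1) := by positivity
      rw [hW]; linarith
    · have : 0 ≤ r ^ m + τ ^ (m + 1) := by positivity
      rw [hW]; linarith
  have hW1 : C₀ * W ≤ 1 := by
    have h1 : r ^ m ≤ 1 / (3 * (C₀ + 1)) := (pow_le_of_le_one hr0.le hr1 (by omega)).trans hh
    have h2 : ε ^ (2 * p) * τ ^ 2 ≤ 1 / (3 * (C₀ + 1)) := by
      refine le_trans ?_ hτs'
      nlinarith [mul_le_mul he1 (pow_le_of_le_one hτ.le hτ1 two_ne_zero) (by positivity) zero_le_one]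
    have h3 : τ ^ (m + 1) ≤ 1 / (3 * (C₀ + 1)) :=
      (pow_le_of_le_one hτ.le hτ1 (by omega)).trans hτs'
    calc C₀ * W ≤ (C₀ + 1) * (1 / (3 * (C₀ + 1)) + 1 / (3 * (C₀ + 1)) + 1 / (3 * (C₀ + 1))) := by
          rw [hW]; gcongr; linarith
      _ = 1 := by field_simp; norm_num
  have herr := errNorm_le hab hN hm hM h hε.le hε1 le_rfl hτ hτ1 hΛ hB hBN hBp hres
    (T := T) (by rw [mul_div_cancel₀ _ he.ne']) hE0 (hbd.trans hW1) hnS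
  refine (tsfpError_le hab hN hE hM h ⟨by positivity, hnS⟩).trans (ENNReal.ofReal_le_ofReal ?_)
  rw [← hr]
  have h1 : r ^ m ≤ W := by
    have : 0 ≤ ε ^ (2 * p) * τ ^ 2 + τ ^ (m + 1) := by positivity
    rw [hW]; linarith
  have h2 : 2 * M * r ^ m ≤ 2 * M * W := by gcongr
  have h3 := herr.trans hbd
  linarith

end Error

end NKGE

/-! ### Choice of the parameters in the two error bounds. -/

theorem theorem4p1 (a b : ℝ) (hab : a < b) (p : ℕ) (hp : 1 ≤ p) :
    (∃ α : ℝ, 0 < α ∧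
      ∀ m : ℕ, 1 ≤ m → ∀ T : ℝ, 0 < T → ∀ M : ℝ,
      ∃ h₀ τs C : ℝ, 0 < h₀ ∧ 0 < τs ∧ τs < 1 ∧ 0 < C ∧
        ∀ τ₀ : ℝ, 0 < τ₀ → τ₀ ≤ τs → ∀ ε : ℝ, 0 < ε → ε ≤ 1 →
        ∀ (u₀ u₁ : ℝ → ℂ) (u v : ℝ → ℝ → ℂ),
          NKGE.IsSolution a b p ε (T / ε ^ (2 * p)) u₀ u₁ u v →
          NKGE.linftySobolevNorm a b (T / ε ^ (2 * p)) (m + 1) u ≤ ENNReal.ofReal M →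
          NKGE.linftySobolevNorm a b (T / ε ^ (2 * p)) m v ≤ ENNReal.ofReal M →
        ∀ N : ℕ, 0 < N → Even N → (b - a) / N ≤ h₀ →
        ∀ τ : ℝ, 0 < τ → τ ≤ α * τ₀ →
        ∀ n : ℕ, (n : ℝ) ≤ T / ε ^ (2 * p) / τ →
          NKGE.tsfpError a b p N ε τ u₀ u₁ u v n ≤
            ENNReal.ofReal
              (C * (((b - a) / N) ^ m + ε ^ (2 * p) * τ ^ 2 + τ₀ ^ (m + 1)))) ∧
    (∀ m : ℕ, 1 ≤ m → ∀ T : ℝ, 0 < T → ∀ M : ℕ → ℝ, ∀ δ : ℝ, 0 < δ →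
      ∃ h₀ τs C : ℝ, 0 < h₀ ∧ 0 < τs ∧ 0 < C ∧
        ∀ ε : ℝ, 0 < ε → ε ≤ 1 →
        ∀ (u₀ u₁ : ℝ → ℂ) (u v : ℝ → ℝ → ℂ),
          NKGE.IsSolution a b p ε (T / ε ^ (2 * p)) u₀ u₁ u v →
          (∀ k : ℕ,
            NKGE.linftySobolevNorm a b (T / ε ^ (2 * p)) k u ≤ ENNReal.ofReal (M k) ∧
            NKGE.linftySobolevNorm a b (T / ε ^ (2 * p)) k v ≤ ENNReal.ofReal (M k)) →
        ∀ N : ℕ, 0 < N → Even N → (b - a) / N ≤ h₀ →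
        ∀ τ : ℝ, 0 < τ → τ ≤ τs * ε ^ δ →
        ∀ n : ℕ, (n : ℝ) ≤ T / ε ^ (2 * p) / τ →
          NKGE.tsfpError a b p N ε τ u₀ u₁ u v n ≤
            ENNReal.ofReal (C * (((b - a) / N) ^ m + ε ^ (2 * p) * τ ^ 2))) := by
  have hba : 0 < b - a := sub_pos.2 hab
  -- The value α = 1 suffices: the uniform bound holds with τ in place of τ₀ and increases with τ.
  refine ⟨⟨1, one_pos, fun m hm T hT M => ?_⟩, fun m hm T hT M δ hδ => ?_⟩
  · obtain ⟨h₀, τs, C, hh₀, -, hτs, hτs1, hC, H⟩ :=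
      NKGE.exists_tsfpError_le hab p hm hT (le_max_right M 0)
    refine ⟨h₀, τs, C, hh₀, hτs, hτs1, hC, ?_⟩
    intro τ₀ hτ₀ hτ₀s ε hε hε1 u₀ u₁ u v hsol hu hv N hN hE hh τ hτ hττ₀ n hn
    rw [one_mul] at hττ₀
    have hMM : ENNReal.ofReal M ≤ ENNReal.ofReal (max M 0) :=
      ENNReal.ofReal_le_ofReal (le_max_left M 0)
    refine (H ε hε hε1 u₀ u₁ u v hsol (hu.trans hMM) (hv.trans hMM) N hN hE hh τ hτ
      (hττ₀.trans hτ₀s) n hn).trans (ENNReal.ofReal_le_ofReal ?_)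
    gcongr
  -- The regularity `k` is chosen so that k - 1 ≥ 2p/δ. Then τ ≤ ε^δ gives τ^(k-1) ≤ ε^(2p), and the
  -- term τ^(k+1) is absorbed into ε^(2p)τ².
  · set k := m + (⌈2 * p / δ⌉₊ + 1) with hk
    have hM0 : 0 ≤ max (max (M (k + 1)) (M k)) 0 := le_max_right _ _
    obtain ⟨h₀, τs, C, hh₀, hh₁, hτs, hτs1, hC, H⟩ :=
      NKGE.exists_tsfpError_le hab p (by omega : 1 ≤ k) hT hM0
    refine ⟨h₀, τs, 2 * C, hh₀, hτs, by positivity, ?_⟩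
    intro ε hε hε1 u₀ u₁ u v hsol huv N hN hE hh τ hτ hτε n hn
    have hεδ : ε ^ δ ≤ 1 := Real.rpow_le_one hε.le hε1 hδ.le
    have hεδ0 : 0 < ε ^ δ := Real.rpow_pos_of_pos hε δ
    have hτs' : τ ≤ τs := hτε.trans (mul_le_of_le_one_right hτs.le hεδ)
    have hτδ : τ ≤ ε ^ δ := hτε.trans (mul_le_of_le_one_left hεδ0.le hτs1.le)
    refine (H ε hε hε1 u₀ u₁ u v hsol
      ((huv (k + 1)).1.trans (ENNReal.ofReal_le_ofReal (le_max_of_le_left (le_max_left _ _))))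
      ((huv k).2.trans (ENNReal.ofReal_le_ofReal (le_max_of_le_left (le_max_right _ _))))
      N hN hE hh τ hτ hτs' n hn).trans (ENNReal.ofReal_le_ofReal ?_)
    have h1 : ((b - a) / N) ^ k ≤ ((b - a) / N) ^ m :=
      pow_le_pow_of_le_one (by positivity) (hh.trans hh₁) (by omega)
    have h2 : τ ^ (k + 1) ≤ ε ^ (2 * p) * τ ^ 2 := by
      rw [show k + 1 = (k - 1) + 2 by omega, pow_add]
      refine mul_le_mul_of_nonneg_right ?_ (by positivity)
      calc τ ^ (k - 1) ≤ (ε ^ δ) ^ (k - 1) := by gcongr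
        _ = ε ^ (δ * (k - 1 : ℕ)) := by rw [Real.rpow_mul hε.le, Real.rpow_natCast]
        _ ≤ ε ^ ((2 * p : ℕ) : ℝ) := by
          refine Real.rpow_le_rpow_of_exponent_ge hε hε1 ?_
          have h3 : (2 * p / δ : ℝ) ≤ (k - 1 : ℕ) :=
            (Nat.le_ceil _).trans (by exact_mod_cast (by omega : ⌈2 * p / δ⌉₊ ≤ k - 1))
          rw [div_le_iff₀ hδ] at h3
          push_cast at h3 ⊢
          linarith
        _ = _ := Real.rpow_natCast _ _
    have h4 : 0 ≤ ((b - a) / N) ^ m := by positivity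
    calc C * (((b - a) / N) ^ k + ε ^ (2 * p) * τ ^ 2 + τ ^ (k + 1))
        ≤ C * (((b - a) / N) ^ m + ε ^ (2 * p) * τ ^ 2 + ε ^ (2 * p) * τ ^ 2) := by gcongr
      _ ≤ C * (2 * (((b - a) / N) ^ m + ε ^ (2 * p) * τ ^ 2)) := by gcongr; linarith
      _ = _ := by ring
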